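/- Let $n\in\mathbb{N}$, let $A$ be the $n$-mode bosonic system with Hilbert space $\mathcal H_A=L^2(\mathbb{R}^n)$, quadratures $Q^k$ (multiplication by the coordinate $y_k$) and $P^k=-i\,\partial_{y_k}$, Hamiltonian $H_A=\frac12\sum_{k=1}^n\big((Q^k)^2+(P^k)^2\big)-\frac n2$, and displacement operators $D_A(x)=\exp\big(i\sum_k(p_kQ^k-q_kP^k)\big)$ for $x=(q,p)\in\mathbb{R}^{2n}$. Let $M$ be a quantum system with an arbitrary complex Hilbert space $\mathcal H_M$, and let $\rho_{AM}$ be a quantum state (positive operator with unit trace) on $\mathcal H_A\otimes\mathcal H_M$ such that, with $\rho_A=\mathrm{Tr}_M\,\rho_{AM}$ and $\rho_M=\mathrm{Tr}_A\,\rho_{AM}$, $$\mathrm{Tr}[H_A\,\rho_A]<\infty,\qquad S(\rho_M)<\infty,$$ where $S(\rho)=-\mathrm{Tr}[\rho\ln\rho]$. The heat semigroup on $A$ is $(\mathcal N_A(0)\otimes\mathbb I_M)(\rho_{AM})=\rho_{AM}$ and, for $t>0$, $$(\mathcal N_A(t)\otimes\mathbb I_M)(\rho_{AM})=\int_{\mathbb{R}^{2n}}D_A(x)\,\rho_{AM}\,D_A(x)^\dagger\;e^{-|x|^2/(2t)}\,\frac{\mathrm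 d^{2n}x}{(2\pi t)^n}.$$ For $t>0$ let $\sigma_{AMX}(t)$ be the joint state of $A$, $M$ and a classical Gaussian random variable $X$ in $\mathbb{R}^{2n}$ with mean zero and covariance matrix $t\,I_{2n}$ such that the state of $AM$ conditioned on $X=x$ is $D_A(x)\rho_{AM}D_A(x)^\dagger$, and let $\Delta_{A|M}(t)=I(A:X|M)_{\sigma_{AMX}(t)}$, where $I(A:X|M)=S(A|M)+S(X|M)-S(AX|M)$ and $S(Y|M)=S(YM)-S(M)$; the entropy of a joint state of a quantum system and of $X$ with operator-valued density $\sigma(x)$ is $-\int\mathrm{Tr}[\sigma(x)\ln\sigma(x)]\,\mathrm dx$. Then the conditional entropy $S(A|M)_{(\mathcal N_A(t)\otimes\mathbb I_M)(\rho_{AM})}$ is finite for every $t\ge0$; the limit defining the conditional Fisher information $$J(A|M)_{\rho_{AM}}:=\lim_{t\to0^+}\frac{\Delta_{A|M}(t)}{t}$$ exists in $[-\infty,+\infty]$; and $J(A|M)_{\rho_{AM}}$ is the right derivative (finite or infinite) of the conditional entropy at $t=0$ under the heat semigroup: $$J(A|M)_{\rho_{AM}}=\lim_{t\to0^+}\frac{S(A|M)_{(\mathcal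 N_A(t)\otimes\mathbb I_M)(\rho_{AM})}-S(A|M)_{\rho_{AM}}}{t}.$$ -/

import Mathlib

open MeasureTheory Filter Topology
open scoped TensorProduct ENNReal InnerProductSpace FourierTransform

noncomputable section

namespace Bosonic

/-! ### Traces, density operators and entropies on a complex Hilbert space -/

section General

variable (H : Type*) [NormedAddCommGroup H] [InnerProductSpace ℂ H] [CompleteSpace H]

/-- The index set of a chosen orthonormal (Hilbert) basis of `H`. -/
def basisIndex : Set H := (exists_hilbertBasis ℂ H).choose

/-- A chosen orthonormal (Hilbert) basis of `H`. -/
def basis : HilbertBasis (basisIndex H) ℂ H :=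
  (exists_hilbertBasis ℂ H).choose_spec.choose

variable {H}

/-- The trace `∑ᵢ ⟪eᵢ, T eᵢ⟫ ∈ [0, ∞]` of a positive operator `T`
(it does not depend on the orthonormal basis). -/
def trace (T : H →L[ℂ] H) : ℝ≥0∞ :=
  ∑' i, ENNReal.ofReal (RCLike.re ⟪basis H i, T (basis H i)⟫_ℂ)

/-- Quantum states: positive operators with unit trace. -/
structure IsState (ρ : H →L[ℂ] H) : Prop where
  pos : ρ.IsPositive
  trace_eq_one : trace ρ = 1

/-- The von Neumann entropy `S(ρ) = -Tr[ρ ln ρ] ∈ [0, ∞]` of a quantum state; here `-ρ ln ρ`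
is given by the functional calculus, and it is a positive operator since `0 ≤ ρ ≤ 1`. -/
def entropy (ρ : H →L[ℂ] H) : ℝ≥0∞ :=
  trace (cfc Real.negMulLog ρ)

/-- The expectation value `Tr[K ρ] = Tr[√ρ K √ρ] = ∑ᵢ ⟨√ρ eᵢ|K|√ρ eᵢ⟩ ∈ [0, ∞]` in the state `ρ` of
a positive self-adjoint, possibly unbounded operator `K`, given by its quadratic form `q`. -/
def formExpectation (q : H → ℝ≥0∞) (ρ : H →L[ℂ] H) : ℝ≥0∞ :=
  ∑' i, q (CFC.sqrt ρ (basis H i))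

/-- The entropy `-∫ Tr[σ(x) ln σ(x)] dx` of the joint state of a quantum system and of a classical
random variable `X` with values in a measure space, where the state is given by its operator-valued
density `σ`: the density of `X` is `p(x) = Tr σ(x)` and the conditional state given `X = x`
is `σ(x) / p(x)`. The integrals of the positive and of the negative parts are subtracted.
For `H = ℂ` it is the Shannon differential entropy of `X`. -/
def cqEntropy {X : Type*} [MeasureSpace X] (σ : X → H →L[ℂ] H) : EReal :=
  ((∫⁻ x, trace (cfc (fun y => max (Real.negMulLog y) 0) (σ x)) : ℝ≥0∞) : EReal) -
    ((∫⁻ x, trace (cfc (fun y => max (-Real.negMulLog y) 0) (σ x)) : ℝ≥0∞) : EReal)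

end General

/-! ### Composite systems, partial traces and conditional entropies -/

section Composite

variable (E F : Type*) [NormedAddCommGroup E] [InnerProductSpace ℂ E] [CompleteSpace E]
  [NormedAddCommGroup F] [InnerProductSpace ℂ F] [CompleteSpace F]

/-- The Hilbert space tensor product of `E` and `F`. -/
abbrev HilbertTensor : Type _ := UniformSpace.Completion (E ⊗[ℂ] F)

variable {E F}

/-- The operator `f ↦ e ⊗ f`. -/
def tensorLeft (e : E) : F →L[ℂ] HilbertTensor E F :=
  UniformSpace.Completion.toComplL ∘L TensorProduct.mkL ℂ E F e

/-- The operator `e ↦ e ⊗ f`. -/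
def tensorRight (f : F) : E →L[ℂ] HilbertTensor E F :=
  UniformSpace.Completion.toComplL ∘L (TensorProduct.mkL ℂ E F).flip f

/-- The partial trace over the first factor, `Tr_E ρ = ∑ᵢ (⟨eᵢ| ⊗ 1) ρ (|eᵢ⟩ ⊗ 1)`
(for positive trace-class `ρ` the sum converges absolutely in operator norm). -/
def traceFst (ρ : HilbertTensor E F →L[ℂ] HilbertTensor E F) : F →L[ℂ] F :=
  ∑' i, (tensorLeft (F := F) (basis E i)).adjoint ∘L ρ ∘L tensorLeft (basis E i)

/-- The partial trace over the second factor, `Tr_F ρ = ∑ⱼ (1 ⊗ ⟨fⱼ|) ρ (1 ⊗ |fⱼ⟩)`. -/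
def traceSnd (ρ : HilbertTensor E F →L[ℂ] HilbertTensor E F) : E →L[ℂ] E :=
  ∑' j, (tensorRight (E := E) (basis F j)).adjoint ∘L ρ ∘L tensorRight (basis F j)

/-- The quantum conditional entropy `S(E|F) = S(EF) - S(F)`. -/
def condEntropy (ρ : HilbertTensor E F →L[ℂ] HilbertTensor E F) : EReal :=
  ((entropy ρ : ℝ≥0∞) : EReal) - ((entropy (traceFst ρ) : ℝ≥0∞) : EReal)

/-- The quantum conditional mutual information `I(E:X|F) = S(E|F) + S(X|F) - S(EX|F)` of a joint
state of the quantum systems `E`, `F` and of the classical random variable `X`, given by its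
operator-valued density `σ`. The marginal on `EF` is `∫ σ(x) dx` and the marginal on `FX`
has density `x ↦ Tr_E σ(x)`. -/
def condMutualInfo {X : Type*} [MeasureSpace X]
    (σ : X → HilbertTensor E F →L[ℂ] HilbertTensor E F) : EReal :=
  condEntropy (∫ x, σ x)
    + (cqEntropy (fun x => traceFst (σ x)) - ((entropy (traceFst (∫ x, σ x)) : ℝ≥0∞) : EReal))
    - (cqEntropy σ - ((entropy (traceFst (∫ x, σ x)) : ℝ≥0∞) : EReal))

end Composite

/-! ### Gaussian quantum systems with `n` modes -/

section Modes

/-- The configuration space `ℝⁿ`. -/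
abbrev Config (n : ℕ) : Type := EuclideanSpace ℝ (Fin n)

/-- The phase space `ℝ²ⁿ`: the component `(k, 0)` of a vector is the displacement of the
position `Q^k`, and the component `(k, 1)` is the displacement of the momentum `P^k`. -/
abbrev PhaseSpace (n : ℕ) : Type := EuclideanSpace ℝ (Fin n × Fin 2)

/-- The Hilbert space of `n` modes: the irreducible (Schrödinger) representation of the canonical
commutation relations on `L²(ℝⁿ)`, where `Q^k` is the multiplication by `y_k`
and `P^k = -i ∂/∂y_k`. -/
abbrev Mode (n : ℕ) : Type := Lp ℂ 2 (volume : Measure (Config n))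

variable {n : ℕ}

/-- The position components of a phase space vector. -/
def position (x : PhaseSpace n) : Config n := WithLp.toLp 2 fun k => x (k, 0)

/-- The momentum components of a phase space vector. -/
def momentum (x : PhaseSpace n) : Config n := WithLp.toLp 2 fun k => x (k, 1)

/-- The phase `exp(i (p·y - p·q / 2))`, with `x = (q, p)`. -/
def displacementPhase (x : PhaseSpace n) (y : Config n) : ℂ :=
  Complex.exp (((⟪momentum x, y⟫_ℝ - ⟪momentum x, position x⟫_ℝ / 2 : ℝ) : ℂ) * Complex.I)

lemma norm_displacementPhase (x : PhaseSpace n) (y : Config n) :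
    ‖displacementPhase x y‖ = 1 := by
  unfold displacementPhase
  exact Complex.norm_exp_ofReal_mul_I _

lemma continuous_displacementPhase (x : PhaseSpace n) :
    Continuous (displacementPhase x) := by
  unfold displacementPhase
  fun_prop

lemma memLp_displacementPhase_mul (x : PhaseSpace n) (ψ : Mode n) :
    MemLp (fun y => displacementPhase x y * ψ y) 2 (volume : Measure (Config n)) :=
  (Lp.memLp ψ).of_le
    ((continuous_displacementPhase x).aestronglyMeasurable.mul (Lp.aestronglyMeasurable ψ))
    (ae_of_all _ fun y => by simp [norm_displacementPhase])

/-- The multiplication of a wave function by the phase of the displacement operator. -/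
def phaseMul (x : PhaseSpace n) : Mode n →ₗᵢ[ℂ] Mode n where
  toFun ψ := (memLp_displacementPhase_mul x ψ).toLp
  map_add' ψ φ := by
    rw [← MemLp.toLp_add]
    apply MemLp.toLp_congr
    filter_upwards [Lp.coeFn_add ψ φ] with y hy
    rw [hy]
    simp only [Pi.add_apply, mul_add]
  map_smul' c ψ := by
    rw [RingHom.id_apply, ← MemLp.toLp_const_smul]
    apply MemLp.toLp_congr
    filter_upwards [Lp.coeFn_smul c ψ] with y hy
    rw [hy]
    simp only [Pi.smul_apply, smul_eq_mul, mul_left_comm]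
  norm_map' ψ := by
    change ‖(memLp_displacementPhase_mul x ψ).toLp‖ = ‖ψ‖
    rw [Lp.norm_toLp, Lp.norm_def]
    congr 1
    apply eLpNorm_congr_norm_ae
    exact ae_of_all _ fun y => by simp [norm_displacementPhase]

/-- The displacement operator `D(x) = exp(i ∑ xⁱ (Δ⁻¹)ᵢⱼ Rʲ) = exp(i (p·Q - q·P))`,
with `x = (q, p)`, in its explicit form `(D(x) ψ)(y) = exp(i (p·y - p·q / 2)) ψ(y - q)`. -/
def displacement (x : PhaseSpace n) : Mode n →ₗᵢ[ℂ] Mode n :=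
  (phaseMul x).comp
    (Lp.compMeasurePreservingₗᵢ ℂ (fun y : Config n => y - position x)
      (measurePreserving_sub_right volume (position x)))

lemma displacement_apply_ae (x : PhaseSpace n) (ψ : Mode n) :
    displacement x ψ =ᵐ[volume] fun y =>
      Complex.exp (((⟪momentum x, y⟫_ℝ - ⟪momentum x, position x⟫_ℝ / 2 : ℝ) : ℂ) * Complex.I) *
        ψ (y - position x) := by
  have h1 := MemLp.coeFn_toLp (memLp_displacementPhase_mul x
    (Lp.compMeasurePreservingₗᵢ ℂ (fun y : Config n => y - position x)
      (measurePreserving_sub_right volume (position x)) ψ))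
  have h2 := Lp.coeFn_compMeasurePreserving ψ
    (measurePreserving_sub_right (volume : Measure (Config n)) (position x))
  refine h1.trans ?_
  filter_upwards [h2] with y hy
  have : (Lp.compMeasurePreservingₗᵢ ℂ (fun y : Config n => y - position x)
      (measurePreserving_sub_right volume (position x)) ψ : Config n → ℂ) y
      = ψ (y - position x) := hy
  rw [this]
  rfl

/-- The expectation value `⟨ψ|H|ψ⟩ ∈ [0, ∞]` of the Hamiltonian `H = ½ ∑ₖ (Q_k² + P_k²) - n/2`,
i.e. its quadratic form, equal to `∞` for `ψ` outside of the form domain. The momentum `P_k` is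
the multiplication by `2π ξ_k` on the Fourier transform `∫ exp(-2πi ξ·y) ψ(y) dy`.
The subtraction is the one of `[0, ∞]`, as `½ ∑ₖ (Q_k² + P_k²) ≥ n/2`. -/
def hamiltonianForm (ψ : Mode n) : ℝ≥0∞ :=
  (∑ k : Fin n, ((∫⁻ y : Config n, ‖((y k : ℝ) : ℂ) * ψ y‖ₑ ^ 2)
      + ∫⁻ ξ : Config n, ‖((2 * Real.pi * ξ k : ℝ) : ℂ) * (𝓕 ψ : Mode n) ξ‖ₑ ^ 2)) / 2
    - (n : ℝ≥0∞) / 2 * ‖ψ‖ₑ ^ 2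

/-- The mean energy `Tr[H ρ] ∈ [0, ∞]` of a quantum state. -/
def meanEnergy (ρ : Mode n →L[ℂ] Mode n) : ℝ≥0∞ :=
  formExpectation hamiltonianForm ρ

/-- The probability density `exp(-|x|² / (2t)) / (2πt)ⁿ` on `ℝ²ⁿ` of the centered Gaussian
random variable with covariance matrix `t I`, for `t > 0`. -/
def gaussianDensity (n : ℕ) (t : ℝ) (x : PhaseSpace n) : ℝ :=
  Real.exp (-‖x‖ ^ 2 / (2 * t)) / (2 * Real.pi * t) ^ n

variable {M : Type*} [NormedAddCommGroup M] [InnerProductSpace ℂ M] [CompleteSpace M]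

/-- The operator `D_A(x) = D(x) ⊗ 1_M`. -/
def displacementLeft (M : Type*) [NormedAddCommGroup M] [InnerProductSpace ℂ M]
    (x : PhaseSpace n) : HilbertTensor (Mode n) M →L[ℂ] HilbertTensor (Mode n) M :=
  ((displacement x).toContinuousLinearMap.rTensor M).completion

/-- The displaced state `D_A(x) ρ_AM D_A(x)†`. -/
def displace (ρ : HilbertTensor (Mode n) M →L[ℂ] HilbertTensor (Mode n) M) (x : PhaseSpace n) :
    HilbertTensor (Mode n) M →L[ℂ] HilbertTensor (Mode n) M :=
  displacementLeft M x ∘L ρ ∘L (displacementLeft M x).adjoint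

/-- The heat semigroup `(N_A(t) ⊗ I_M)(ρ_AM) = ∫ D_A(x) ρ_AM D_A(x)† exp(-|x|²/(2t)) dx / (2πt)ⁿ`
for `t > 0`, and the identity for `t = 0`. -/
def heat (t : ℝ) (ρ : HilbertTensor (Mode n) M →L[ℂ] HilbertTensor (Mode n) M) :
    HilbertTensor (Mode n) M →L[ℂ] HilbertTensor (Mode n) M :=
  if 0 < t then ∫ x : PhaseSpace n, gaussianDensity n t x • displace ρ x else ρ

/-- The operator-valued density of the state `σ_AMX(t)`: the marginal on `X` is the Gaussian with
covariance matrix `t I`, and the state of `AM` given `X = x` is `D_A(x) ρ_AM D_A(x)†`. -/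
def displacedEnsemble (ρ : HilbertTensor (Mode n) M →L[ℂ] HilbertTensor (Mode n) M) (t : ℝ)
    (x : PhaseSpace n) : HilbertTensor (Mode n) M →L[ℂ] HilbertTensor (Mode n) M :=
  gaussianDensity n t x • displace ρ x

/-- The quantum integral conditional Fisher information `Δ_{A|M}(ρ_AM)(t)`: it is the conditional
mutual information `I(A:X|M)` of `σ_AMX(t)` for `t > 0`, and `0` for `t = 0`. -/
def integralFisherInfo (ρ : HilbertTensor (Mode n) M →L[ℂ] HilbertTensor (Mode n) M)
    (t : ℝ) : EReal :=
  if 0 < t then condMutualInfo (displacedEnsemble ρ t) else 0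

/-- The quantum conditional Fisher information `J(A|M) = lim_{t → 0⁺} Δ_{A|M}(ρ_AM)(t) / t`,
possibly infinite. -/
def fisherInfo (ρ : HilbertTensor (Mode n) M →L[ℂ] HilbertTensor (Mode n) M) : EReal :=
  limUnder (𝓝[>] (0 : ℝ)) fun t : ℝ => integralFisherInfo ρ t / (t : EReal)

end Modes

end Bosonic

end

/-!
Write `f t` for the entropy of the state at time `t` of the heat semigroup.

All conditional states of the displaced ensemble are unitarily equivalent to `ρ`, so the entropy of
the classical-quantum state is `S(ρ)` plus the differential entropy of the Gaussian variable
(`cqEntropy_smul`). The displacements do not change the marginal on `M`, hence neither does the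
heat semigroup (`traceFst_heat`), so that `S(A|M)` equals `f t - S(ρ_M)` along the semigroup
(`condEntropy_heat`). In the conditional mutual information the differential entropies cancel, and
`Δ(t) = f t - f 0` (`integralFisherInfo_eq`). Both difference quotients of the theorem are therefore
equal to `(f t - f 0) / t`, and it remains to show that `f` is finite and that this quotient has a
limit.

*Existence of the limit.* For a mixture of unitary conjugates of a state, the gain of entropy is the
average relative entropy of the conjugates with respect to the mixture
(`IsMixture.lintegral_relEntropy_add`). The relative entropy cannot increase when both arguments
undergo the heat semigroup (`relEntropy_heat_le`). Together with the semigroup law `heat_heat` this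
gives `f (s + t) + f 0 ≤ f s + f t` (`entropy_heat_add_le`), and `f` is monotone because the gain is
nonnegative. Hence `f - f 0` is nonnegative, monotone and subadditive, and the difference quotients of such a function converge at `0` to their
supremum, finite or not (`exists_tendsto_div_of_subadditive`).

The relative entropy is defined by a variational formula for which data processing is immediate:
`relEntropy α β` is an integral over `s > 0` of the suprema of functionals that are affine in
`(α, β)` and are permuted by unitary conjugations (`relEntropy_le_of_isMixture`). In eigenbases of
`α` and `β` the supremum is found by completing squares, and the integral over `s` turns
`(λ - μ)² / (λ + s μ)` into `λ ln (λ / μ) - λ + μ` (`relEntropy_eq_tsum`).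

*Finiteness of the entropy.* The products of coherent states and of eigenvectors of `ρ_M` are a
tight frame, by Moyal's identity, which is Plancherel's theorem for the short-time Fourier transform
(`exists_moyal`). Klein's inequality relative to this frame, with the weights `exp(-|x|² / 2) μ` for
the eigenvalues `μ` of `ρ_M`, bounds the entropy by `S(ρ_M)`, the second moment of the phase space
density of the state, and a Gaussian integral (`mul_entropy_le`). The second moment is finite at
time `0` because the energy is, and it stays finite because the heat semigroup acts on the phase
space density as a convolution with a Gaussian (`lintegral_sq_conv_le`).

The space of `M` may be nonseparable. Quantities in `[0, ∞]` are summed over arbitrary Hilbert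
bases, and sums are interchanged with integrals by means of `lintegral_tsum_of_continuous`, where
continuity and pointwise convergence force the sum to have a countable support.
-/

set_option linter.unusedSectionVars false

noncomputable section

namespace Bosonic

/-! ### Traces of positive operators and their spectral decomposition -/

section Trace

universe u

variable {H : Type*} [NormedAddCommGroup H] [InnerProductSpace ℂ H]

lemma ofReal_norm_sq (z : ℂ) : ENNReal.ofReal (‖z‖ ^ 2) = ‖z‖ₑ ^ 2 := by
  rw [ENNReal.ofReal_pow (norm_nonneg _), ofReal_norm]

/-- Parseval's identity in `[0, ∞]`. -/
lemma tsum_enorm_inner_sq {ι : Type*} (b : HilbertBasis ι ℂ H) (v : H) :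
    ∑' i, ‖⟪b i, v⟫_ℂ‖ₑ ^ 2 = ‖v‖ₑ ^ 2 := by
  have h := Complex.hasSum_re (b.hasSum_inner_mul_inner v v)
  have h2 : ∀ i, (⟪v, b i⟫_ℂ * ⟪b i, v⟫_ℂ).re = ‖⟪b i, v⟫_ℂ‖ ^ 2 := fun i => by
    rw [← inner_conj_symm, ← Complex.normSq_eq_conj_mul_self, Complex.normSq_eq_norm_sq,
      Complex.ofReal_re]
  simp_rw [h2] at h
  have h3 : (⟪v, v⟫_ℂ).re = ‖v‖ ^ 2 := by
    rw [inner_self_eq_norm_sq_to_K]; norm_cast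
  rw [h3] at h
  simp_rw [← ofReal_norm_sq]
  rw [← ENNReal.ofReal_tsum_of_nonneg (fun _ => by positivity) h.summable, h.tsum_eq,
    ENNReal.ofReal_pow (norm_nonneg _), ofReal_norm]

lemma tsum_enorm_inner_sq' {ι : Type*} (b : HilbertBasis ι ℂ H) (v : H) :
    ∑' i, ‖⟪v, b i⟫_ℂ‖ₑ ^ 2 = ‖v‖ₑ ^ 2 := by
  rw [← tsum_enorm_inner_sq b v]
  refine tsum_congr fun i => ?_
  rw [← inner_conj_symm, RCLike.enorm_conj]

variable [CompleteSpace H]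

/-- The expectation value `⟨v|T|v⟩ ∈ [0, ∞)` of a positive operator. -/
def expect (T : H →L[ℂ] H) (v : H) : ℝ≥0∞ := ENNReal.ofReal (RCLike.re ⟪v, T v⟫_ℂ)

lemma expect_eq_enorm_sqrt {T : H →L[ℂ] H} (hT : T.IsPositive) (v : H) :
    expect T v = ‖CFC.sqrt T v‖ₑ ^ 2 := by
  have h0 : 0 ≤ T := (ContinuousLinearMap.nonneg_iff_isPositive T).2 hT
  have hs : (CFC.sqrt T).IsPositive :=
    (ContinuousLinearMap.nonneg_iff_isPositive _).1 (CFC.sqrt_nonneg T)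
  have h1 : T v = CFC.sqrt T (CFC.sqrt T v) := by
    conv_lhs => rw [← CFC.sqrt_mul_sqrt_self T h0]
    rfl
  have h2 : ⟪v, CFC.sqrt T (CFC.sqrt T v)⟫_ℂ = ⟪CFC.sqrt T v, CFC.sqrt T v⟫_ℂ :=
    (hs.isSymmetric v (CFC.sqrt T v)).symm
  rw [expect, h1, h2, ← ofReal_norm, ← ENNReal.ofReal_pow (norm_nonneg _)]
  congr 1
  exact (norm_sq_eq_re_inner (𝕜 := ℂ) _).symm

lemma sqrt_isSymmetric (T : H →L[ℂ] H) : (CFC.sqrt T).IsSymmetric :=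
  ((ContinuousLinearMap.nonneg_iff_isPositive _).1 (CFC.sqrt_nonneg T)).isSymmetric

/-- The Hilbert–Schmidt norm of a symmetric operator does not depend on the basis. -/
lemma tsum_enorm_apply_sq_comm {ι κ : Type*} (b : HilbertBasis ι ℂ H) (c : HilbertBasis κ ℂ H)
    {S : H →L[ℂ] H} (hS : S.IsSymmetric) :
    ∑' i, ‖S (b i)‖ₑ ^ 2 = ∑' j, ‖S (c j)‖ₑ ^ 2 := by
  simp_rw [← tsum_enorm_inner_sq c (S (b _)), ← tsum_enorm_inner_sq' b (S (c _))]
  rw [ENNReal.tsum_comm]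
  exact tsum_congr fun j => tsum_congr fun i => by
    rw [show ⟪c j, S (b i)⟫_ℂ = ⟪S (c j), b i⟫_ℂ from (hS (c j) (b i)).symm]

lemma tsum_expect_comm {ι κ : Type*} (b : HilbertBasis ι ℂ H) (c : HilbertBasis κ ℂ H)
    {T : H →L[ℂ] H} (hT : T.IsPositive) :
    ∑' i, expect T (b i) = ∑' j, expect T (c j) := by
  simp_rw [expect_eq_enorm_sqrt hT]
  exact tsum_enorm_apply_sq_comm b c (sqrt_isSymmetric T)

/-- The trace of a positive operator can be computed in any Hilbert basis. -/
lemma trace_eq_tsum {ι : Type*} (b : HilbertBasis ι ℂ H) {T : H →L[ℂ] H} (hT : T.IsPositive) :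
    trace T = ∑' i, expect T (b i) :=
  tsum_expect_comm (basis H) b hT

lemma enorm_sq_le_tsum_of_hilbertBasis {ι : Type*} (b : HilbertBasis ι ℂ H) {S : H →L[ℂ] H}
    (v : H) (hS : S.IsSymmetric) :
    ‖S v‖ₑ ^ 2 ≤ (∑' i, ‖S (b i)‖ₑ ^ 2) * ‖v‖ₑ ^ 2 := by
  rw [← tsum_enorm_inner_sq b (S v), ← ENNReal.tsum_mul_right]
  refine ENNReal.tsum_le_tsum fun i => ?_
  have : ⟪b i, S v⟫_ℂ = ⟪S (b i), v⟫_ℂ := (hS (b i) v).symm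
  rw [this, ← mul_pow]
  exact pow_le_pow_left' (by
    rw [← ofReal_norm, ← ofReal_norm, ← ofReal_norm, ← ENNReal.ofReal_mul (norm_nonneg _)]
    exact ENNReal.ofReal_le_ofReal (norm_inner_le_norm _ _)) 2

lemma expect_le_trace_mul {T : H →L[ℂ] H} (hT : T.IsPositive) (v : H) :
    expect T v ≤ trace T * ‖v‖ₑ ^ 2 := by
  rw [trace_eq_tsum (basis H) hT]
  simp_rw [expect_eq_enorm_sqrt hT]
  exact enorm_sq_le_tsum_of_hilbertBasis _ _ (sqrt_isSymmetric T)

/-- A positive operator is determined by its expectation values. -/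
lemma eq_of_expect_eq {S T : H →L[ℂ] H} (hS : S.IsPositive) (hT : T.IsPositive)
    (h : ∀ v, expect S v = expect T v) : S = T := by
  have hre : ∀ v, RCLike.re ⟪v, S v⟫_ℂ = RCLike.re ⟪v, T v⟫_ℂ := fun v =>
    (ENNReal.ofReal_eq_ofReal_iff (hS.re_inner_nonneg_right v) (hT.re_inner_nonneg_right v)).1 (h v)
  have : (S : H →ₗ[ℂ] H) = T := by
    rw [← ext_inner_map]
    intro v
    have hs := hS.inner_nonneg_left v
    have ht := hT.inner_nonneg_left v
    have h1 := hre v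
    have e1 : ⟪S v, v⟫_ℂ = (RCLike.re ⟪v, S v⟫_ℂ : ℝ) := by
      rw [inner_re_symm]
      exact Complex.ext (by simp) (by simpa using (Complex.le_def.1 hs).2.symm)
    have e2 : ⟪T v, v⟫_ℂ = (RCLike.re ⟪v, T v⟫_ℂ : ℝ) := by
      rw [inner_re_symm]
      exact Complex.ext (by simp) (by simpa using (Complex.le_def.1 ht).2.symm)
    show ⟪S v, v⟫_ℂ = ⟪T v, v⟫_ℂ
    rw [e1, e2, h1]
  exact ContinuousLinearMap.coe_inj.1 this

/-- A positive operator of finite trace is compact: its square root is a Hilbert–Schmidt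
operator, hence a limit of finite-rank truncations. -/
lemma isCompactOperator_of_trace {T : H →L[ℂ] H} (hT : T.IsPositive) (h : trace T ≠ ∞) :
    IsCompactOperator T := by
  classical
  set b := basis H
  set S := CFC.sqrt T with hSdef
  have hS := sqrt_isSymmetric T
  have hsum : ∑' i, ‖S (b i)‖ₑ ^ 2 ≠ ∞ := by
    rw [trace_eq_tsum b hT] at h
    simpa only [expect_eq_enorm_sqrt hT] using h
  let A : Finset (basisIndex H) → H →L[ℂ] H := fun F =>
    ∑ i ∈ F, InnerProductSpace.rankOne ℂ (b i) (S (b i))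
  have hA : ∀ F, IsCompactOperator (A F) := by
    intro F
    induction F using Finset.cons_induction with
    | empty => simpa [A] using isCompactOperator_zero
    | cons i F hi ih =>
      have : A (Finset.cons i F hi) = InnerProductSpace.rankOne ℂ (b i) (S (b i)) + A F := by
        exact Finset.sum_cons hi
      rw [this]
      refine IsCompactOperator.add ?_ ih
      rw [InnerProductSpace.rankOne_def']
      have : IsCompactOperator (ContinuousLinearMap.toSpanSingleton ℂ (b i) : ℂ →L[ℂ] H) :=
        (isCompactOperator_id (E := ℂ)).clm_comp _
      exact this.comp_clm _
  have htail := ENNReal.tendsto_tsum_compl_atTop_zero hsum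
  have hbound : ∀ F, ‖S - A F‖ₑ ≤ (∑' i : { i // i ∉ F }, ‖S (b i)‖ₑ ^ 2) ^ (1 / 2 : ℝ) := by
    intro F
    refine ContinuousLinearMap.opENorm_le_bound _ fun v => ?_
    have key : ‖(S - A F) v‖ₑ ^ 2 ≤ (∑' i : { i // i ∉ F }, ‖S (b i)‖ₑ ^ 2) * ‖v‖ₑ ^ 2 := by
      rw [← tsum_enorm_inner_sq b, ← ENNReal.tsum_mul_right]
      have hin : ∀ i, ⟪b i, (S - A F) v⟫_ℂ = if i ∈ F then 0 else ⟪S (b i), v⟫_ℂ := by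
        intro i
        have h1 : ⟪b i, S v⟫_ℂ = ⟪S (b i), v⟫_ℂ := (hS (b i) v).symm
        have hb := orthonormal_iff_ite.1 b.orthonormal
        simp only [A, _root_.sub_apply, _root_.sum_apply,
          InnerProductSpace.rankOne_apply, inner_sub_right, inner_sum, inner_smul_right, hb, h1]
        simp only [mul_ite, mul_one, mul_zero, Finset.sum_ite_eq]
        split_ifs <;> simp
      have hsupp : (Function.support fun i => ‖⟪b i, (S - A F) v⟫_ℂ‖ₑ ^ 2) ⊆ {i | i ∉ F} := by
        intro i hi
        by_contra hiF
        simp only [Set.mem_ofPred_eq, not_not] at hiF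
        exact hi (by simp only [hin, if_pos hiF]; simp)
      rw [← tsum_subtype_eq_of_support_subset hsupp]
      refine ENNReal.tsum_le_tsum fun i => ?_
      rw [hin, if_neg i.2, ← mul_pow]
      exact pow_le_pow_left' (by
        rw [← ofReal_norm, ← ofReal_norm, ← ofReal_norm, ← ENNReal.ofReal_mul (norm_nonneg _)]
        exact ENNReal.ofReal_le_ofReal (norm_inner_le_norm _ _)) 2
    have := ENNReal.rpow_le_rpow key (z := 1 / 2) (by norm_num)
    rw [ENNReal.mul_rpow_of_nonneg _ _ (by norm_num), ← ENNReal.rpow_natCast,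
      ← ENNReal.rpow_natCast, ← ENNReal.rpow_mul, ← ENNReal.rpow_mul] at this
    simpa using this
  have hlim : Tendsto A atTop (𝓝 S) := by
    rw [tendsto_iff_edist_tendsto_0]
    have hz : Tendsto (fun F : Finset (basisIndex H) =>
        (∑' i : { i // i ∉ F }, ‖S (b i)‖ₑ ^ 2) ^ (1 / 2 : ℝ)) atTop (𝓝 0) := by
      have := (ENNReal.continuous_rpow_const (y := 1 / 2)).tendsto (0 : ℝ≥0∞)
      rw [ENNReal.zero_rpow_of_pos (by norm_num)] at this
      exact this.comp htail
    refine tendsto_of_tendsto_of_tendsto_of_le_of_le tendsto_const_nhds hz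
      (fun _ => zero_le) fun F => ?_
    rw [edist_comm, edist_eq_enorm_sub]
    exact hbound F
  have hSc : IsCompactOperator S := isCompactOperator_of_tendsto hlim (.of_forall hA)
  have : (T : H → H) = S ∘ S := by
    have h0 : 0 ≤ T := (ContinuousLinearMap.nonneg_iff_isPositive T).2 hT
    conv_lhs => rw [← CFC.sqrt_mul_sqrt_self T h0]
    rfl
  rw [this]
  exact hSc.comp_clm S

/-- The operator `T` is diagonal in the Hilbert basis `b`, with real eigenvalues `lam`. -/
def IsDiag {ι : Type*} (b : HilbertBasis ι ℂ H) (lam : ι → ℝ) (T : H →L[ℂ] H) : Prop :=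
  ∀ i, T (b i) = (lam i : ℂ) • b i

/-- The spectral theorem for positive operators of finite trace. -/
lemma exists_isDiag {H : Type u} [NormedAddCommGroup H] [InnerProductSpace ℂ H] [CompleteSpace H]
    {T : H →L[ℂ] H} (hT : T.IsPositive) (h : trace T ≠ ∞) :
    ∃ (ι : Type u) (b : HilbertBasis ι ℂ H) (lam : ι → ℝ), IsDiag b lam T := by
  have hs : T.IsSymmetric := hT.isSymmetric
  have hbot := ContinuousLinearMap.orthogonalComplement_iSup_eigenspaces_eq_bot
    (isCompactOperator_of_trace hT h) hs
  have hclosed : ∀ μ : ℂ,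
      IsClosed (Module.End.eigenspace (T : Module.End ℂ H) μ : Set H) := fun μ => by
    have : (Module.End.eigenspace (T : Module.End ℂ H) μ : Set H)
        = {x | T x = μ • x} := by
      ext x; simp
    rw [this]
    exact isClosed_eq T.continuous (continuous_const_smul μ)
  have hcomp : ∀ μ : ℂ, CompleteSpace (Module.End.eigenspace (T : Module.End ℂ H) μ) := fun μ =>
    (hclosed μ).completeSpace_coe
  -- Hilbert bases of all eigenspaces together are total, by the spectral theorem
  choose w b hb using fun μ : ℂ =>
    exists_hilbertBasis ℂ (Module.End.eigenspace (T : Module.End ℂ H) μ)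
  have hfam := hs.orthogonalFamily_eigenspaces
  have hon := hfam.orthonormal_sigma_orthonormal (fun μ => (b μ).orthonormal)
  have hspan : (Submodule.span ℂ (Set.range fun a : Σ μ : ℂ, w μ => ((b a.1 a.2 :
      Module.End.eigenspace (T : Module.End ℂ H) a.1) : H)))ᗮ = ⊥ := by
    rw [eq_bot_iff, ← hbot]
    intro v hv
    rw [Submodule.mem_orthogonal] at hv ⊢
    intro u hu
    refine Submodule.iSup_induction _ (motive := fun u => ⟪u, v⟫_ℂ = 0) hu (fun μ x hx => ?_)
      (by simp) (fun x y hx hy => by rw [inner_add_left, hx, hy, add_zero])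
    have hsum := (b μ).hasSum_repr ⟨x, hx⟩
    have hsum' := (hsum.mapL (Module.End.eigenspace (T : Module.End ℂ H) μ).subtypeL)
    have h2 := hsum'.mapL ((innerSL ℂ).flip v)
    have h3 := h2.tsum_eq
    have h4 : ∀ i, ((innerSL ℂ).flip v) ((Module.End.eigenspace (T : Module.End ℂ H) μ).subtypeL
        ((b μ).repr ⟨x, hx⟩ i • (b μ i))) = 0 := fun i => by
      have := hv _ (Submodule.subset_span ⟨⟨μ, i⟩, rfl⟩)
      simp [this]
    simp_rw [h4] at h3
    simpa using h3.symm
  -- the eigenvalues of a symmetric operator are real, so taking real parts loses nothing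
  refine ⟨_, HilbertBasis.mkOfOrthogonalEqBot hon hspan, fun a => a.1.re, fun a => ?_⟩
  have hmem := (b a.1 a.2).2
  rw [Module.End.mem_eigenspace_iff] at hmem
  have hne : Module.End.HasEigenvalue (T : Module.End ℂ H) a.1 := by
    refine Module.End.hasEigenvalue_of_hasEigenvector (x := (b a.1 a.2 : H)) ⟨(b a.1 a.2).2, ?_⟩
    have := (b a.1).orthonormal.ne_zero a.2
    simpa using this
  have hre : ((a.1.re : ℝ) : ℂ) = a.1 := by
    have := hs.conj_eigenvalue_eq_self hne
    exact Complex.conj_eq_iff_re.1 this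
  rw [hre, congrFun (HilbertBasis.coe_mkOfOrthogonalEqBot hon hspan) a]
  exact hmem

end Trace

/-! ### Operators that are diagonal in a Hilbert basis -/

section Diag

variable {H : Type*} [NormedAddCommGroup H] [InnerProductSpace ℂ H] [CompleteSpace H]
  {ι : Type*} {b : HilbertBasis ι ℂ H} {lam : ι → ℝ} {T : H →L[ℂ] H}

lemma IsDiag.inner_apply (h : IsDiag b lam T) (hT : T.IsSymmetric) (i : ι) (v : H) :
    ⟪b i, T v⟫_ℂ = (lam i : ℂ) * ⟪b i, v⟫_ℂ := by
  have : ⟪b i, T v⟫_ℂ = ⟪T (b i), v⟫_ℂ := (hT (b i) v).symm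
  rw [this, h i, inner_smul_left, Complex.conj_ofReal]

lemma IsDiag.hasSum_inner (h : IsDiag b lam T) (hT : T.IsSymmetric) (u v : H) :
    HasSum (fun i => (lam i : ℂ) * (⟪u, b i⟫_ℂ * ⟪b i, v⟫_ℂ)) ⟪u, T v⟫_ℂ := by
  have := b.hasSum_inner_mul_inner u (T v)
  simp_rw [h.inner_apply hT] at this
  have e : (fun i => (lam i : ℂ) * (⟪u, b i⟫_ℂ * ⟪b i, v⟫_ℂ)) =
      fun i => ⟪u, b i⟫_ℂ * ((lam i : ℂ) * ⟪b i, v⟫_ℂ) := by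
    funext i; ring
  rwa [e]

lemma IsDiag.nonneg (h : IsDiag b lam T) (hT : T.IsPositive) (i : ι) : 0 ≤ lam i := by
  have h1 := hT.re_inner_nonneg_right (b i)
  rw [h i, inner_smul_right, inner_self_eq_norm_sq_to_K, b.orthonormal.1 i] at h1
  simpa using h1

lemma IsDiag.expect_eq_tsum (h : IsDiag b lam T) (hT : T.IsSymmetric) (h0 : ∀ i, 0 ≤ lam i)
    (v : H) : expect T v = ∑' i, ENNReal.ofReal (lam i) * ‖⟪b i, v⟫_ℂ‖ₑ ^ 2 := by
  have h1 := Complex.hasSum_re (h.hasSum_inner hT v v)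
  have h2 : ∀ i, ((lam i : ℂ) * (⟪v, b i⟫_ℂ * ⟪b i, v⟫_ℂ)).re = lam i * ‖⟪b i, v⟫_ℂ‖ ^ 2 :=
    fun i => by
      rw [Complex.re_ofReal_mul, ← inner_conj_symm, ← Complex.normSq_eq_conj_mul_self,
        Complex.normSq_eq_norm_sq, Complex.ofReal_re]
  simp_rw [h2] at h1
  rw [expect, show RCLike.re ⟪v, T v⟫_ℂ = (⟪v, T v⟫_ℂ).re from rfl, ← h1.tsum_eq,
    ENNReal.ofReal_tsum_of_nonneg (fun i => mul_nonneg (h0 i) (sq_nonneg _)) h1.summable]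
  exact tsum_congr fun i => by rw [ENNReal.ofReal_mul (h0 i), ofReal_norm_sq]

lemma enorm_hilbertBasis (b : HilbertBasis ι ℂ H) (i : ι) : ‖b i‖ₑ = 1 := by
  rw [← ofReal_norm, b.orthonormal.1 i, ENNReal.ofReal_one]

lemma IsDiag.expect_self (h : IsDiag b lam T) (i : ι) :
    expect T (b i) = ENNReal.ofReal (lam i) := by
  rw [expect, h i, inner_smul_right, inner_self_eq_norm_sq_to_K, b.orthonormal.1 i]
  simp

lemma IsDiag.isPositive (h : IsDiag b lam T) (hT : T.IsSymmetric) (h0 : ∀ i, 0 ≤ lam i) :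
    T.IsPositive := by
  refine ⟨hT, fun v => ?_⟩
  have h1 := Complex.hasSum_re (h.hasSum_inner hT v v)
  have h2 : RCLike.re ⟪T v, v⟫_ℂ = (⟪v, T v⟫_ℂ).re := by rw [inner_re_symm]; rfl
  rw [ContinuousLinearMap.reApplyInnerSelf_apply, h2, ← h1.tsum_eq]
  refine tsum_nonneg fun i => ?_
  rw [Complex.re_ofReal_mul, ← inner_conj_symm, ← Complex.normSq_eq_conj_mul_self,
        Complex.ofReal_re]
  exact mul_nonneg (h0 i) (Complex.normSq_nonneg _)

lemma IsDiag.trace_eq (h : IsDiag b lam T) (hT : T.IsPositive) :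
    trace T = ∑' i, ENNReal.ofReal (lam i) := by
  rw [trace_eq_tsum b hT]
  exact tsum_congr h.expect_self

/-- The functional calculus acts on the eigenvalues of a diagonal operator. -/
lemma IsDiag.cfc (h : IsDiag b lam T) (hT : T.IsSymmetric) {f : ℝ → ℝ} (hf : Continuous f) :
    IsDiag b (fun i => f (lam i)) (cfc f T) := by
  intro i
  have hsa : IsSelfAdjoint T := ContinuousLinearMap.isSelfAdjoint_iff_isSymmetric.2 hT
  -- an eigenvalue lies in the spectrum
  have hmem : lam i ∈ spectrum ℝ T := by
    rw [spectrum.mem_iff]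
    intro hu
    obtain ⟨u, hu⟩ := hu
    have h1 : (algebraMap ℝ (H →L[ℂ] H) (lam i) - T) (b i) = 0 := by
      rw [_root_.sub_apply, h i, Algebra.algebraMap_eq_smul_one]
      simp
    have h2 : (u⁻¹.1 * u.1) (b i) = 0 := by
      show u⁻¹.1 (u.1 (b i)) = 0
      rw [hu, h1, map_zero]
    rw [Units.inv_mul] at h2
    exact b.orthonormal.ne_zero i h2
  rw [cfc_apply f T hsa hf.continuousOn]
  set x : spectrum ℝ T := ⟨lam i, hmem⟩
  -- both sides are multiplicative and continuous in `g`, so Stone–Weierstrass applies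
  have key : ∀ g : C(spectrum ℝ T, ℝ), cfcHom hsa g (b i) = ((g x : ℝ) : ℂ) • b i := by
    intro g
    induction g using ContinuousMap.induction_on_of_compact with
    | const r =>
      have : (ContinuousMap.const (spectrum ℝ T) r) = algebraMap ℝ _ r := rfl
      rw [this, AlgHomClass.commutes, Algebra.algebraMap_eq_smul_one]
      simp
    | id =>
      rw [cfcHom_id hsa, h i]; rfl
    | star_id =>
      rw [map_star, cfcHom_id hsa, hsa.star_eq, h i]; rfl
    | add f g hf hg =>
      rw [map_add, _root_.add_apply, hf, hg, ← add_smul]; simp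
    | mul f g hf hg =>
      rw [map_mul, mul_apply_eq_comp, hg, map_smul, hf, smul_smul]
      simp [mul_comm]
    | frequently g hg =>
      refine hg.mem_of_closed (isClosed_eq ?_ ?_)
      · exact (ContinuousLinearMap.apply ℂ H (b i)).continuous.comp (cfcHom_continuous hsa)
      · exact (Complex.continuous_ofReal.comp (continuous_eval_const x)).smul
          continuous_const
  exact key _

lemma cfc_isSymmetric (f : ℝ → ℝ) (T : H →L[ℂ] H) : (cfc f T).IsSymmetric :=
  ContinuousLinearMap.isSelfAdjoint_iff_isSymmetric.1 (cfc_predicate f T)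

lemma IsDiag.trace_cfc (h : IsDiag b lam T) (hT : T.IsSymmetric) {f : ℝ → ℝ} (hf : Continuous f)
    (h0 : ∀ i, 0 ≤ f (lam i)) :
    trace (_root_.cfc f T) = ∑' i, ENNReal.ofReal (f (lam i)) :=
  (h.cfc hT hf).trace_eq ((h.cfc hT hf).isPositive (cfc_isSymmetric f T) h0)

lemma IsDiag.tsum_eq_one (h : IsDiag b lam T) (hT : IsState T) :
    ∑' i, ENNReal.ofReal (lam i) = 1 := by
  rw [← h.trace_eq hT.pos, hT.trace_eq_one]

lemma IsDiag.le_one (h : IsDiag b lam T) (hT : IsState T) (i : ι) : lam i ≤ 1 := by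
  have := ENNReal.le_tsum (f := fun i => ENNReal.ofReal (lam i)) i
  rw [h.tsum_eq_one hT] at this
  simpa using this

lemma IsDiag.entropy_eq (h : IsDiag b lam T) (hT : IsState T) :
    entropy T = ∑' i, ENNReal.ofReal (Real.negMulLog (lam i)) :=
  h.trace_cfc hT.pos.isSymmetric Real.continuous_negMulLog fun i =>
    Real.negMulLog_nonneg (h.nonneg hT.pos i) (h.le_one hT i)

end Diag

/-! ### The relative entropy of two numbers -/

section Scalar

/-- `-ln y ∈ [0, ∞]` for `0 ≤ y ≤ 1`, with the value `∞` at `y = 0`. -/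
def negLog (y : ℝ) : ℝ≥0∞ := if y = 0 then ∞ else ENNReal.ofReal (-Real.log y)

/-- The scalar relative entropy `x ln (x / y) - x + y ∈ [0, ∞]` of `x, y ≥ 0`, as a mixture of the
rational functions `(x - y)² / (x + s y)`. -/
def scalarRelEntropy (x y : ℝ) : ℝ≥0∞ :=
  ∫⁻ s in Set.Ioi (0 : ℝ), ENNReal.ofReal (s / (1 + s) ^ 2) *
    ENNReal.ofReal ((x - y) ^ 2 / (x + s * y))

/-- The fundamental theorem of calculus on `(0, ∞)` for a nonnegative derivative. -/
lemma lintegral_Ioi_of_hasDerivAt {F F' : ℝ → ℝ} {l : ℝ}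
    (hc : ContinuousWithinAt F (Set.Ici 0) 0)
    (hd : ∀ s ∈ Set.Ioi (0 : ℝ), HasDerivAt F (F' s) s) (hp : ∀ s ∈ Set.Ioi (0 : ℝ), 0 ≤ F' s)
    (hl : Tendsto F atTop (𝓝 l)) :
    ∫⁻ s in Set.Ioi (0 : ℝ), ENNReal.ofReal (F' s) = ENNReal.ofReal (l - F 0) := by
  have hi := integrableOn_Ioi_deriv_of_nonneg hc hd hp hl
  rw [← integral_Ioi_of_hasDerivAt_of_nonneg hc hd hp hl,
    ofReal_integral_eq_lintegral_ofReal hi]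
  exact (ae_restrict_iff' measurableSet_Ioi).2 (ae_of_all _ hp)

/-- The integral is evaluated by partial fractions: the integrand has the primitive
`-(y - x) / (1 + s) + x ln ((1 + s) / (x + s y))`. -/
lemma scalarRelEntropy_of_pos {x y : ℝ} (hx : 0 ≤ x) (hy : 0 < y) :
    scalarRelEntropy x y = ENNReal.ofReal (x * Real.log x - x * Real.log y + y - x) := by
  have hpos : ∀ s ∈ Set.Ioi (0 : ℝ), 0 < x + s * y := fun s hs => by
    have := mul_pos (Set.mem_Ioi.1 hs) hy
    linarith
  have h1 : scalarRelEntropy x y = ∫⁻ s in Set.Ioi (0 : ℝ),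
      ENNReal.ofReal ((y - x) / (1 + s) ^ 2 + x / (1 + s) - x * y / (x + s * y)) := by
    refine setLIntegral_congr_fun measurableSet_Ioi fun s hs => ?_
    have hs' := Set.mem_Ioi.1 hs
    rw [← ENNReal.ofReal_mul (by positivity)]
    congr 1
    have := (hpos s hs).ne'
    field_simp
    ring
  rw [h1]
  set F : ℝ → ℝ := fun s => -(y - x) / (1 + s) + x * Real.log (1 + s) - x * Real.log (x + s * y)
  have hF0 : F 0 = -(y - x) - x * Real.log x := by simp [F]
  have hl : Tendsto F atTop (𝓝 (-(x * Real.log y))) := by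
    have a1 : Tendsto (fun s : ℝ => -(y - x) / (1 + s)) atTop (𝓝 0) :=
      tendsto_const_nhds.div_atTop (tendsto_atTop_add_const_left _ _ tendsto_id)
    have a2 : Tendsto (fun s : ℝ => (x + s * y) / (1 + s)) atTop (𝓝 y) := by
      have : Tendsto (fun s : ℝ => y + (x - y) / (1 + s)) atTop (𝓝 (y + 0)) :=
        tendsto_const_nhds.add
          (tendsto_const_nhds.div_atTop (tendsto_atTop_add_const_left _ _ tendsto_id))
      rw [add_zero] at this
      refine this.congr' ?_
      filter_upwards [eventually_gt_atTop 0] with s hs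
      field_simp
      ring
    have a3 := a1.sub ((a2.log hy.ne').const_mul x)
    rw [zero_sub] at a3
    refine a3.congr' ?_
    filter_upwards [eventually_gt_atTop 0] with s hs
    have h2 := (hpos s hs).ne'
    rw [Real.log_div h2 (by positivity)]
    simp only [F]
    ring
  rw [lintegral_Ioi_of_hasDerivAt (F := F)
    (F' := fun s => (y - x) / (1 + s) ^ 2 + x / (1 + s) - x * y / (x + s * y)) ?_ ?_ ?_ hl, hF0]
  · congr 1; ring
  · rcases hx.eq_or_lt with rfl | hx
    · have : F = fun s => -(y - 0) / (1 + s) := by funext s; simp [F]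
      rw [this]
      exact ContinuousAt.continuousWithinAt (ContinuousAt.div (by fun_prop) (by fun_prop) (by simp))
    · refine ContinuousAt.continuousWithinAt ?_
      refine ContinuousAt.sub (ContinuousAt.add ?_ ?_) ?_
      · exact ContinuousAt.div (by fun_prop) (by fun_prop) (by simp)
      · exact continuousAt_const.mul (ContinuousAt.log (by fun_prop) (by simp))
      · exact continuousAt_const.mul (ContinuousAt.log (by fun_prop) (by simpa using hx.ne'))
  · intro s hs
    have hs' := Set.mem_Ioi.1 hs
    have b1 : HasDerivAt (fun s : ℝ => 1 + s) 1 s := by simpa using (hasDerivAt_id s).const_add 1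
    have b2 : HasDerivAt (fun s : ℝ => x + s * y) y s := by
      simpa using ((hasDerivAt_id s).mul_const y).const_add x
    have c1 := (hasDerivAt_const s (-(y - x))).div b1 (by positivity : (1 : ℝ) + s ≠ 0)
    have c2 := (b1.log (by positivity)).const_mul x
    have c3 := (b2.log (hpos s hs).ne').const_mul x
    convert! (c1.add c2).sub c3 using 1
    have := (hpos s hs).ne'
    field_simp
    ring
  · intro s hs
    have hs' := Set.mem_Ioi.1 hs
    have hp := hpos s hs
    have : (y - x) / (1 + s) ^ 2 + x / (1 + s) - x * y / (x + s * y)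
        = s / (1 + s) ^ 2 * ((x - y) ^ 2 / (x + s * y)) := by
      field_simp
      ring
    rw [this]
    positivity

/-- The relative entropy is infinite outside the support of the second argument: for `y = 0` the
integrand is `x s / (1 + s)²`, which is not integrable at infinity. -/
lemma scalarRelEntropy_zero_right {x : ℝ} (hx : 0 < x) : scalarRelEntropy x 0 = ∞ := by
  by_contra hne
  have h1 : ∫⁻ s in Set.Ioi (1 : ℝ), ENNReal.ofReal (s⁻¹) ≠ ∞ := by
    have : ∫⁻ s in Set.Ioi (1 : ℝ), ENNReal.ofReal (s⁻¹) ≤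
        ENNReal.ofReal (4 / x) * scalarRelEntropy x 0 := by
      rw [scalarRelEntropy, ← lintegral_const_mul' _ _ ENNReal.ofReal_ne_top]
      calc _ ≤ ∫⁻ s in Set.Ioi (1 : ℝ), ENNReal.ofReal (4 / x) *
            (ENNReal.ofReal (s / (1 + s) ^ 2) * ENNReal.ofReal ((x - 0) ^ 2 / (x + s * 0))) := by
            refine setLIntegral_mono' measurableSet_Ioi fun s hs => ?_
            have hs' := Set.mem_Ioi.1 hs
            rw [← ENNReal.ofReal_mul (by positivity), ← ENNReal.ofReal_mul (by positivity)]
            refine ENNReal.ofReal_le_ofReal ?_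
            have : 4 / x * (s / (1 + s) ^ 2 * ((x - 0) ^ 2 / (x + s * 0)))
              = 4 * s / (1 + s) ^ 2 := by
              field_simp
              ring
            rw [this, inv_eq_one_div, div_le_div_iff₀ (by positivity) (by positivity)]
            nlinarith
        _ ≤ _ := lintegral_mono_set (Set.Ioi_subset_Ioi zero_le_one)
    exact ne_top_of_le_ne_top (ENNReal.mul_ne_top ENNReal.ofReal_ne_top hne) this
  refine not_integrableOn_Ioi_inv (a := 1) ⟨measurable_inv.aestronglyMeasurable, ?_⟩
  rw [hasFiniteIntegral_iff_ofReal]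
  · exact h1.lt_top
  · exact (ae_restrict_iff' measurableSet_Ioi).2 (ae_of_all _ fun s hs =>
      inv_nonneg.2 (zero_le_one.trans (Set.mem_Ioi.1 hs).le))

/-- The definition `D(x‖y) = x ln x - x ln y - x + y` for two numbers in `[0, 1]`, written without
subtractions in `[0, ∞]`, so that it holds also for `y = 0`. -/
lemma scalarRelEntropy_add {x y : ℝ} (hx : 0 ≤ x) (hx1 : x ≤ 1) (hy : 0 ≤ y) (hy1 : y ≤ 1) :
    scalarRelEntropy x y + ENNReal.ofReal (Real.negMulLog x) + ENNReal.ofReal x =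
      ENNReal.ofReal x * negLog y + ENNReal.ofReal y := by
  rcases hy.eq_or_lt with rfl | hy
  · rcases hx.eq_or_lt with rfl | hx
    · simp [scalarRelEntropy]
    · rw [scalarRelEntropy_zero_right hx, negLog, if_pos rfl, ENNReal.mul_top]
      · simp
      · simpa using hx
  · have h0 : 0 ≤ x * Real.log x - x * Real.log y + y - x := by
      rcases hx.eq_or_lt with rfl | hx
      · simpa using hy.le
      · have := Real.add_one_le_exp (Real.log (y / x))
        rw [Real.exp_log (by positivity), Real.log_div hy.ne' hx.ne'] at this
        have h2 := mul_le_mul_of_nonneg_left this hx.le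
        rw [mul_div_cancel₀ _ hx.ne'] at h2
        linarith
    have hl : 0 ≤ -Real.log y := by
      have := Real.log_nonpos hy.le hy1
      linarith
    rw [scalarRelEntropy_of_pos hx hy, negLog, if_neg hy.ne', ← ENNReal.ofReal_mul hx,
      ← ENNReal.ofReal_add h0 (Real.negMulLog_nonneg hx hx1),
      ← ENNReal.ofReal_add (add_nonneg h0 (Real.negMulLog_nonneg hx hx1)) hx,
      ← ENNReal.ofReal_add (mul_nonneg hx hl) hy.le]
    congr 1
    rw [Real.negMulLog]
    ring

end Scalar

/-! ### Quantum relative entropy and data processing -/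

section RelEntropy

variable {H : Type*} [NormedAddCommGroup H] [InnerProductSpace ℂ H] [CompleteSpace H]

/-- The functional `2 Re Tr[X†(α - β)] - Tr[X†αX] - s Tr[XβX†]` of a finite-rank operator
`X = ∑ₚ |aₚ⟩⟨bₚ|`, expanded in terms of the vectors `aₚ` and `bₚ`. -/
def relFunctional {ι : Type*} [Fintype ι] (s : ℝ) (α β : H →L[ℂ] H) (a b : ι → H) : ℝ :=
  2 * ∑ p, RCLike.re (⟪a p, α (b p)⟫_ℂ - ⟪a p, β (b p)⟫_ℂ)
    - ∑ p, ∑ q, RCLike.re (⟪b p, b q⟫_ℂ * ⟪a q, α (a p)⟫_ℂ)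
    - s * ∑ p, ∑ q, RCLike.re (⟪a p, a q⟫_ℂ * ⟪b q, β (b p)⟫_ℂ)

/-- The supremum of `relFunctional` over all finite-rank operators `X`. -/
def relQuad (s : ℝ) (α β : H →L[ℂ] H) : ℝ≥0∞ :=
  ⨆ (m : ℕ) (a : Fin m → H) (b : Fin m → H), ENNReal.ofReal (relFunctional s α β a b)

/-- The relative entropy `D(α‖β) = Tr[α (ln α - ln β)] ∈ [0, ∞]` of two quantum states, given by a
variational formula. For commuting states with eigenvalues `λ` and `μ`, the supremum `relQuad s`
is `∑ (λ - μ)² / (λ + s μ)`, whose integral with the weight `s / (1 + s)²` is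
`∑ (λ ln (λ / μ) - λ + μ)`. -/
def relEntropy (α β : H →L[ℂ] H) : ℝ≥0∞ :=
  ∫⁻ s in Set.Ioi (0 : ℝ), ENNReal.ofReal (s / (1 + s) ^ 2) * relQuad s α β

/-- The vectors in the supremum may be indexed by any finite type. -/
lemma ofReal_relFunctional_le {ι : Type*} [Fintype ι] (s : ℝ) (α β : H →L[ℂ] H) (a b : ι → H) :
    ENNReal.ofReal (relFunctional s α β a b) ≤ relQuad s α β := by
  let e := (Fintype.equivFin ι).symm
  have : relFunctional s α β a b = relFunctional s α β (a ∘ e) (b ∘ e) := by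
    unfold relFunctional
    simp only [Function.comp_apply]
    rw [← e.sum_comp (fun p => RCLike.re (⟪a p, α (b p)⟫_ℂ - ⟪a p, β (b p)⟫_ℂ)),
      ← e.sum_comp (fun p => ∑ q, RCLike.re (⟪b p, b q⟫_ℂ * ⟪a q, α (a p)⟫_ℂ)),
      ← e.sum_comp (fun p => ∑ q, RCLike.re (⟪a p, a q⟫_ℂ * ⟪b q, β (b p)⟫_ℂ))]
    congr 2
    · refine congrArg _ (funext fun p => ?_)
      exact (e.sum_comp (fun q => RCLike.re (⟪b (e p), b q⟫_ℂ * ⟪a q, α (a (e p))⟫_ℂ))).symm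
    · refine Finset.sum_congr rfl fun p _ => ?_
      exact (e.sum_comp (fun q => RCLike.re (⟪a (e p), a q⟫_ℂ * ⟪b q, β (b (e p))⟫_ℂ))).symm
  rw [this]
  exact le_iSup_of_le _ (le_iSup_of_le _ (le_iSup_of_le _ le_rfl))

/-- The operator `α'` is the mixture, with respect to the measure `ν`, of the operators
`W(x)† α W(x)`. -/
def IsMixture {X : Type*} [MeasurableSpace X] (ν : Measure X) (W : X → H → H)
    (α α' : H →L[ℂ] H) : Prop :=
  ∀ u v, Integrable (fun x => ⟪W x u, α (W x v)⟫_ℂ) ν ∧ ⟪u, α' v⟫_ℂ = ∫ x, ⟪W x u, α (W x v)⟫_ℂ ∂ν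

/-- The functional is affine in `(α, β)` and covariant under unitaries, so that its supremum
decreases under mixtures of unitary conjugations. -/
lemma relQuad_le_of_isMixture {X : Type*} [MeasurableSpace X] {ν : Measure X}
    [IsProbabilityMeasure ν] {W : X → H → H} (hW : ∀ x u v, ⟪W x u, W x v⟫_ℂ = ⟪u, v⟫_ℂ)
    {α α' β β' : H →L[ℂ] H} (hα : IsMixture ν W α α') (hβ : IsMixture ν W β β') (s : ℝ) :
    relQuad s α' β' ≤ relQuad s α β := by
  refine iSup_le fun m => iSup_le fun a => iSup_le fun b => ?_
  by_cases htop : relQuad s α β = ∞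
  · rw [htop]; exact le_top
  have hre : ∀ {γ γ' : H →L[ℂ] H}, IsMixture ν W γ γ' → ∀ (c : ℂ) (u v : H),
      Integrable (fun x => RCLike.re (c * ⟪W x u, γ (W x v)⟫_ℂ)) ν ∧
      RCLike.re (c * ⟪u, γ' v⟫_ℂ) = ∫ x, RCLike.re (c * ⟪W x u, γ (W x v)⟫_ℂ) ∂ν := by
    intro γ γ' hγ c u v
    have hi := ((hγ u v).1.const_mul c)
    refine ⟨hi.re, ?_⟩
    rw [(hγ u v).2, ← integral_const_mul, integral_re hi]
  have key : relFunctional s α' β' a b =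
      ∫ x, relFunctional s α β (fun p => W x (a p)) (fun p => W x (b p)) ∂ν := by
    have i1 : ∀ p, Integrable (fun x => RCLike.re (⟪W x (a p), α (W x (b p))⟫_ℂ
        - ⟪W x (a p), β (W x (b p))⟫_ℂ)) ν := fun p => ((hα _ _).1.sub (hβ _ _).1).re
    have i2 : ∀ p q, Integrable (fun x => RCLike.re (⟪b p, b q⟫_ℂ *
        ⟪W x (a q), α (W x (a p))⟫_ℂ)) ν := fun p q => (hre hα _ _ _).1
    have i3 : ∀ p q, Integrable (fun x => RCLike.re (⟪a p, a q⟫_ℂ *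
        ⟪W x (b q), β (W x (b p))⟫_ℂ)) ν := fun p q => (hre hβ _ _ _).1
    unfold relFunctional
    simp_rw [hW]
    rw [integral_sub, integral_sub, integral_const_mul, integral_const_mul,
      integral_finsetSum _ (fun p _ => i1 p), integral_finsetSum _
        (fun p _ => integrable_finsetSum _ fun q _ => i2 p q),
      integral_finsetSum _ (fun p _ => integrable_finsetSum _ fun q _ => i3 p q)]
    · congr 2
      · congr 1
        refine Finset.sum_congr rfl fun p _ => ?_
        rw [(hα _ _).2, (hβ _ _).2, ← integral_sub (hα _ _).1 (hβ _ _).1]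
        exact (integral_re ((hα _ _).1.sub (hβ _ _).1)).symm
      · refine Finset.sum_congr rfl fun p _ => ?_
        rw [integral_finsetSum _ fun q _ => i2 p q]
        exact Finset.sum_congr rfl fun q _ => (hre hα _ _ _).2
      · refine Finset.sum_congr rfl fun p _ => ?_
        rw [integral_finsetSum _ fun q _ => i3 p q]
        exact Finset.sum_congr rfl fun q _ => (hre hβ _ _ _).2
    · exact (integrable_finsetSum _ fun p _ => i1 p).const_mul 2
    · exact integrable_finsetSum _ fun p _ => integrable_finsetSum _ fun q _ => i2 p q
    · exact ((integrable_finsetSum _ fun p _ => i1 p).const_mul 2).sub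
        (integrable_finsetSum _ fun p _ => integrable_finsetSum _ fun q _ => i2 p q)
    · exact (integrable_finsetSum _ fun p _ =>
        integrable_finsetSum _ fun q _ => i3 p q).const_mul s
  rw [key]
  refine ENNReal.ofReal_le_of_le_toReal ?_
  have hle : ∀ x, relFunctional s α β (fun p => W x (a p)) (fun p => W x (b p)) ≤
      (relQuad s α β).toReal := fun x =>
    (ENNReal.ofReal_le_iff_le_toReal htop).1 (ofReal_relFunctional_le s α β _ _)
  by_cases hi : Integrable
      (fun x => relFunctional s α β (fun p => W x (a p)) (fun p => W x (b p))) ν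
  · calc _ ≤ ∫ _, (relQuad s α β).toReal ∂ν := integral_mono hi (integrable_const _) hle
      _ = _ := by simp
  -- a nonintegrable function has integral `0` by convention, which is also a lower bound
  · rw [integral_undef hi]; exact ENNReal.toReal_nonneg

/-- Data processing: mixtures of unitary conjugations do not increase the relative entropy. -/
lemma relEntropy_le_of_isMixture {X : Type*} [MeasurableSpace X] {ν : Measure X}
    [IsProbabilityMeasure ν] {W : X → H → H} (hW : ∀ x u v, ⟪W x u, W x v⟫_ℂ = ⟪u, v⟫_ℂ)
    {α α' β β' : H →L[ℂ] H} (hα : IsMixture ν W α α') (hβ : IsMixture ν W β β') :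
    relEntropy α' β' ≤ relEntropy α β :=
  lintegral_mono fun s => by
    gcongr
    exact relQuad_le_of_isMixture hW hα hβ s

end RelEntropy

/-! ### Quantum relative entropy in eigenbases -/

section RelEntropyDiag

variable {H : Type*} [NormedAddCommGroup H] [InnerProductSpace ℂ H] [CompleteSpace H]
  {J K : Type*} {e : HilbertBasis J ℂ H} {f : HilbertBasis K ℂ H} {lam : J → ℝ} {mu : K → ℝ}
  {α β : H →L[ℂ] H}

lemma ofReal_le_tsum_of_hasSum {ι : Type*} {G : ι → ℝ} {g : ℝ} (h : HasSum G g) :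
    ENNReal.ofReal g ≤ ∑' i, ENNReal.ofReal (G i) := by
  refine le_of_tendsto ((ENNReal.continuous_ofReal.tendsto g).comp h) (.of_forall fun F => ?_)
  calc ENNReal.ofReal (∑ i ∈ F, G i) ≤ ∑ i ∈ F, ENNReal.ofReal (G i) := by
        classical
        induction F using Finset.induction_on with
        | empty => simp
        | insert i F hi ih =>
          rw [Finset.sum_insert hi, Finset.sum_insert hi]
          exact ENNReal.ofReal_add_le.trans (by gcongr)
    _ ≤ _ := ENNReal.sum_le_tsum F

/-- The inequality between a sum of integrals and the integral of the sum that holds for index sets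
of any cardinality. -/
lemma tsum_lintegral_le {ι X : Type*} [MeasurableSpace X] {ν : Measure X} {g : ι → X → ℝ≥0∞}
    (hg : ∀ i, AEMeasurable (g i) ν) : ∑' i, ∫⁻ x, g i x ∂ν ≤ ∫⁻ x, ∑' i, g i x ∂ν := by
  rw [ENNReal.tsum_eq_iSup_sum]
  refine iSup_le fun F => ?_
  rw [← lintegral_finsetSum' _ fun i _ => hg i]
  exact lintegral_mono fun x => ENNReal.sum_le_tsum F

lemma lintegral_tsum_of_countable {ι X : Type*} [MeasurableSpace X] {ν : Measure X}
    {g : ι → X → ℝ≥0∞} (hg : ∀ i, AEMeasurable (g i) ν) {S : Set ι} (hS : S.Countable)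
    (h0 : ∀ i ∉ S, ∀ x, g i x = 0) :
    ∫⁻ x, ∑' i, g i x ∂ν = ∑' i, ∫⁻ x, g i x ∂ν := by
  have := hS.to_subtype
  have h1 : ∀ x, ∑' i, g i x = ∑' i : S, g i x := fun x =>
    (tsum_subtype_eq_of_support_subset (f := fun i => g i x) fun i hi => by
      by_contra h; exact hi (h0 i h x)).symm
  have h2 : ∑' i, ∫⁻ x, g i x ∂ν = ∑' i : S, ∫⁻ x, g i x ∂ν :=
    (tsum_subtype_eq_of_support_subset (f := fun i => ∫⁻ x, g i x ∂ν) fun i hi => by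
      by_contra h; exact hi (by simp [h0 i h])).symm
  simp_rw [h1, h2]
  exact lintegral_tsum fun i => hg i

/-- A sum of continuous functions that converges at every point has a countable support, so that
it can be integrated term by term. -/
lemma lintegral_tsum_of_continuous {ι X : Type*} [TopologicalSpace X]
    [SecondCountableTopology X] [MeasurableSpace X] [OpensMeasurableSpace X] {ν : Measure X}
    {g : ι → X → ℝ≥0∞} (hg : ∀ i, Continuous (g i)) (hfin : ∀ x, ∑' i, g i x ≠ ∞) :
    ∫⁻ x, ∑' i, g i x ∂ν = ∑' i, ∫⁻ x, g i x ∂ν := by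
  obtain ⟨D, hD, hDd⟩ := TopologicalSpace.exists_countable_dense X
  refine lintegral_tsum_of_countable (fun i => (hg i).measurable.aemeasurable)
    (S := ⋃ x ∈ D, Function.support fun i => g i x)
    (hD.biUnion fun x _ => Summable.countable_support_ennreal (hfin x)) fun i hi x => ?_
  have hz : ∀ x ∈ D, g i x = 0 := fun x hx => by
    by_contra h
    exact hi (Set.mem_biUnion hx h)
  have : g i = fun _ => 0 :=
    Continuous.ext_on hDd (hg i) continuous_const fun x hx => hz x hx
  rw [this]

lemma IsDiag.summable (h : IsDiag e lam α) (hα : IsState α) : Summable lam := by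
  have h1 : ∑' i, ENNReal.ofReal (lam i) ≠ ∞ := by rw [h.tsum_eq_one hα]; simp
  have := ENNReal.summable_toReal h1
  simpa only [ENNReal.toReal_ofReal (h.nonneg hα.pos _)] using this

lemma hasSum_mul_prod {F : J → ℂ} {G : K → ℂ} {x y : ℂ} (hF : HasSum F x) (hG : HasSum G y) :
    HasSum (fun p : J × K => F p.1 * G p.2) (x * y) :=
  hF.mul hG (summable_mul_of_summable_norm hF.summable.norm hG.summable.norm)

lemma hasSum_norm_inner_sq (f : HilbertBasis K ℂ H) (v : H) :
    HasSum (fun k => ‖⟪f k, v⟫_ℂ‖ ^ 2) (‖v‖ ^ 2) := by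
  have h := Complex.hasSum_re (f.hasSum_inner_mul_inner v v)
  have h2 : ∀ i, (⟪v, f i⟫_ℂ * ⟪f i, v⟫_ℂ).re = ‖⟪f i, v⟫_ℂ‖ ^ 2 := fun i => by
    rw [← inner_conj_symm, ← Complex.normSq_eq_conj_mul_self, Complex.normSq_eq_norm_sq,
      Complex.ofReal_re]
  simp_rw [h2] at h
  convert h using 1
  rw [inner_self_eq_norm_sq_to_K]; norm_cast

/-- `Tr[X†α]` as a double sum over two bases, for `X = |a⟩⟨b|`. -/
lemma IsDiag.hasSum_inner_prod (h : IsDiag e lam α) (hα : IsState α) (f : HilbertBasis K ℂ H)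
    (a b : H) :
    HasSum (fun p : J × K => (lam p.1 : ℂ) *
      (⟪a, e p.1⟫_ℂ * ⟪e p.1, f p.2⟫_ℂ * ⟪f p.2, b⟫_ℂ)) ⟪a, α b⟫_ℂ := by
  have hin : ∀ j, HasSum (fun k => (lam j : ℂ) *
      (⟪a, e j⟫_ℂ * ⟪e j, f k⟫_ℂ * ⟪f k, b⟫_ℂ)) ((lam j : ℂ) * (⟪a, e j⟫_ℂ * ⟪e j, b⟫_ℂ)) := by
    intro j
    have := (f.hasSum_inner_mul_inner (e j) b).mul_left ((lam j : ℂ) * ⟪a, e j⟫_ℂ)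
    simpa only [mul_assoc] using this
  have hout := h.hasSum_inner hα.pos.isSymmetric a b
  have hs : Summable (fun p : J × K => (lam p.1 : ℂ) *
      (⟪a, e p.1⟫_ℂ * ⟪e p.1, f p.2⟫_ℂ * ⟪f p.2, b⟫_ℂ)) := by
    have hb := fun v : H => hasSum_norm_inner_sq f v
    have hl := h.summable hα
    have h0 := fun j => h.nonneg hα.pos j
    -- by `x y ≤ (x² + y²) / 2` and Parseval's identity, summable over `K` uniformly in `J`
    have hsum : Summable (fun p : J × K => lam p.1 * ‖a‖ *
        ((‖⟪f p.2, e p.1⟫_ℂ‖ ^ 2 + ‖⟪f p.2, b⟫_ℂ‖ ^ 2) / 2)) := by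
      have hnn : ∀ p : J × K, 0 ≤ lam p.1 * ‖a‖ *
          ((‖⟪f p.2, e p.1⟫_ℂ‖ ^ 2 + ‖⟪f p.2, b⟫_ℂ‖ ^ 2) / 2) := fun p =>
        mul_nonneg (mul_nonneg (h0 _) (norm_nonneg _))
          (div_nonneg (add_nonneg (sq_nonneg _) (sq_nonneg _)) zero_le_two)
      refine (summable_prod_of_nonneg hnn).2 ⟨fun j => ?_, ?_⟩
      · exact (((hb (e j)).add (hb b)).div_const 2).summable.mul_left (lam j * ‖a‖)
      · have : ∀ j, ∑' k, lam j * ‖a‖ * ((‖⟪f k, e j⟫_ℂ‖ ^ 2 + ‖⟪f k, b⟫_ℂ‖ ^ 2) / 2) =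
            lam j * (‖a‖ * ((1 + ‖b‖ ^ 2) / 2)) := fun j => by
          rw [((((hb (e j)).add (hb b)).div_const 2).mul_left (lam j * ‖a‖)).tsum_eq,
            e.orthonormal.1 j]
          ring
        simp only [this]
        exact hl.mul_right _
    refine Summable.of_norm_bounded hsum fun p => ?_
    · rw [norm_mul, norm_mul, norm_mul, Complex.norm_real, Real.norm_of_nonneg (h0 _), mul_assoc,
        mul_assoc]
      refine mul_le_mul_of_nonneg_left ?_ (h0 _)
      have h1 : ‖⟪a, e p.1⟫_ℂ‖ ≤ ‖a‖ := by
        simpa [e.orthonormal.1 p.1] using norm_inner_le_norm (𝕜 := ℂ) a (e p.1)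
      have h2 : ‖⟪e p.1, f p.2⟫_ℂ‖ = ‖⟪f p.2, e p.1⟫_ℂ‖ := norm_inner_symm _ _
      rw [h2]
      refine mul_le_mul h1 ?_ (by positivity) (norm_nonneg _)
      nlinarith [sq_nonneg (‖⟪f p.2, e p.1⟫_ℂ‖ - ‖⟪f p.2, b⟫_ℂ‖)]
  have h2 := (hs.hasSum.prod_fiberwise hin).unique hout
  rw [← h2]
  exact hs.hasSum

/-- The maximum over `x` of the quadratic polynomial on the left, by completing the square. If
`y + s z = 0` then `y = z = 0`, and the quotient is `0` as it should be. -/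
lemma two_mul_re_sub_le {x w : ℂ} {y z s : ℝ} (hy : 0 ≤ y) (hz : 0 ≤ z) (hs : 0 < s) :
    2 * ((y - z) * (starRingEnd ℂ x * w).re) - (y + s * z) * ‖x‖ ^ 2 ≤
      ‖w‖ ^ 2 * ((y - z) ^ 2 / (y + s * z)) := by
  have hsz := mul_nonneg hs.le hz
  rcases (add_nonneg hy hsz).eq_or_lt with h | h
  · have h1 : y = 0 := by linarith
    have h2 : z = 0 := by
      have : s * z = 0 := by linarith
      exact (mul_eq_zero.1 this).resolve_left hs.ne'
    simp [h1, h2]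
  · have h1 : (y - z) * (starRingEnd ℂ x * w).re ≤ |y - z| * (‖x‖ * ‖w‖) := by
      refine (le_abs_self _).trans ?_
      rw [abs_mul]
      refine mul_le_mul_of_nonneg_left ((Complex.abs_re_le_norm _).trans ?_) (abs_nonneg _)
      rw [norm_mul, RCLike.norm_conj]
    have h2 : ‖w‖ ^ 2 * ((y - z) ^ 2 / (y + s * z)) + (y + s * z) * ‖x‖ ^ 2
        - 2 * (|y - z| * (‖x‖ * ‖w‖)) =
        (‖w‖ * |y - z| - (y + s * z) * ‖x‖) ^ 2 / (y + s * z) := by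
      rw [← sq_abs (y - z)]
      have hne := h.ne'
      generalize y + s * z = d at hne
      field_simp
      ring
    have h3 : 0 ≤ (‖w‖ * |y - z| - (y + s * z) * ‖x‖) ^ 2 / (y + s * z) := by positivity
    linarith

/-- With `X` and `1` expanded in matrix elements between the two eigenbases, the functional is a sum
of independent quadratic polynomials in the matrix elements of `X`, and each is bounded by its
maximum. -/
lemma relFunctional_le_tsum (he : IsDiag e lam α) (hα : IsState α) (hf : IsDiag f mu β)
    (hβ : IsState β) {s : ℝ} (hs : 0 < s) {ι : Type*} [Fintype ι] (a b : ι → H) :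
    ENNReal.ofReal (relFunctional s α β a b) ≤ ∑' p : J × K, ‖⟪e p.1, f p.2⟫_ℂ‖ₑ ^ 2 *
      ENNReal.ofReal ((lam p.1 - mu p.2) ^ 2 / (lam p.1 + s * mu p.2)) := by
  -- matrix elements of the summands of the finite-rank operator, and of the identity
  let X : ι → J × K → ℂ := fun i p => ⟪e p.1, a i⟫_ℂ * ⟪b i, f p.2⟫_ℂ
  let W : J × K → ℂ := fun p => ⟪e p.1, f p.2⟫_ℂ
  have t1 : ∀ i, HasSum (fun p : J × K => lam p.1 * (starRingEnd ℂ (X i p) * W p).re)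
      (RCLike.re ⟪a i, α (b i)⟫_ℂ) := fun i => by
    have h := Complex.hasSum_re (he.hasSum_inner_prod hα f (a i) (b i))
    refine h.congr_fun fun p => ?_
    rw [Complex.re_ofReal_mul]
    congr 2
    simp only [X, W, map_mul, inner_conj_symm]
    ring
  have t1' : ∀ i, HasSum (fun p : J × K => mu p.2 * (starRingEnd ℂ (X i p) * W p).re)
      (RCLike.re ⟪a i, β (b i)⟫_ℂ) := fun i => by
    have h := Complex.hasSum_re (hf.hasSum_inner_prod hβ e (b i) (a i))
    have h' := (Equiv.prodComm J K).hasSum_iff.2 h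
    have hre : (⟪b i, β (a i)⟫_ℂ).re = RCLike.re ⟪a i, β (b i)⟫_ℂ := by
      have : ⟪b i, β (a i)⟫_ℂ = ⟪β (b i), a i⟫_ℂ := (hβ.pos.isSymmetric (b i) (a i)).symm
      rw [this]
      exact inner_re_symm (𝕜 := ℂ) _ _
    rw [hre] at h'
    refine h'.congr_fun fun p => ?_
    simp only [Function.comp_apply, Equiv.prodComm_apply, Prod.fst_swap, Prod.snd_swap]
    rw [Complex.re_ofReal_mul, ← Complex.conj_re]
    congr 2
    simp only [X, W, map_mul, inner_conj_symm]
    ring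
  have t2 : ∀ i j, HasSum (fun p : J × K => lam p.1 * (X i p * starRingEnd ℂ (X j p)).re)
      (RCLike.re (⟪b i, b j⟫_ℂ * ⟪a j, α (a i)⟫_ℂ)) := fun i j => by
    have h := Complex.hasSum_re (hasSum_mul_prod
      (he.hasSum_inner hα.pos.isSymmetric (a j) (a i)) (f.hasSum_inner_mul_inner (b i) (b j)))
    rw [mul_comm ⟪b i, b j⟫_ℂ]
    refine h.congr_fun fun p => ?_
    rw [← Complex.re_ofReal_mul]
    congr 1
    simp only [X, map_mul, inner_conj_symm]
    ring
  have t3 : ∀ i j, HasSum (fun p : J × K => mu p.2 * (X i p * starRingEnd ℂ (X j p)).re)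
      (RCLike.re (⟪a j, a i⟫_ℂ * ⟪b i, β (b j)⟫_ℂ)) := fun i j => by
    have h := Complex.hasSum_re (hasSum_mul_prod (e.hasSum_inner_mul_inner (a j) (a i))
      (hf.hasSum_inner hβ.pos.isSymmetric (b i) (b j)))
    refine h.congr_fun fun p => ?_
    rw [← Complex.re_ofReal_mul]
    congr 1
    simp only [X, map_mul, inner_conj_symm]
    ring
  have hG : HasSum (fun p : J × K =>
      2 * ∑ i, (lam p.1 * (starRingEnd ℂ (X i p) * W p).re
        - mu p.2 * (starRingEnd ℂ (X i p) * W p).re)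
      - ∑ i, ∑ j, lam p.1 * (X i p * starRingEnd ℂ (X j p)).re
      - s * ∑ j, ∑ i, mu p.2 * (X i p * starRingEnd ℂ (X j p)).re) (relFunctional s α β a b) := by
    unfold relFunctional
    simp only [map_sub]
    exact (((hasSum_sum fun i _ => (t1 i).sub (t1' i)).mul_left 2).sub
      (hasSum_sum fun i _ => hasSum_sum fun j _ => t2 i j)).sub
      ((hasSum_sum fun j _ => hasSum_sum fun i _ => t3 i j).mul_left s)
  refine (ofReal_le_tsum_of_hasSum hG).trans (ENNReal.tsum_le_tsum fun p => ?_)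
  rw [← ofReal_norm_sq, ← ENNReal.ofReal_mul (sq_nonneg _)]
  refine ENNReal.ofReal_le_ofReal ?_
  have hl := he.nonneg hα.pos p.1
  have hm := hf.nonneg hβ.pos p.2
  refine le_trans (le_of_eq ?_) (two_mul_re_sub_le (x := ∑ i, X i p) (w := W p) hl hm hs)
  have e1 : ∑ i, ∑ j, (X i p * starRingEnd ℂ (X j p)).re = ‖∑ i, X i p‖ ^ 2 := by
    rw [← Complex.normSq_eq_norm_sq, ← Complex.ofReal_re (Complex.normSq _), ← Complex.mul_conj,
      map_sum, Finset.sum_mul_sum]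
    simp only [Complex.re_sum]
  have e2 : ∑ i, (starRingEnd ℂ (X i p) * W p).re = (starRingEnd ℂ (∑ i, X i p) * W p).re := by
    rw [map_sum, Finset.sum_mul, Complex.re_sum]
  rw [Finset.sum_comm (f := fun j i => mu p.2 * (X i p * starRingEnd ℂ (X j p)).re)]
  simp only [← Finset.mul_sum, Finset.sum_sub_distrib, e1, e2]
  ring

/-- The optimal matrix elements, truncated to a finite set of pairs of eigenvectors, define a
finite-rank operator that attains the partial sum. -/
lemma sum_le_relQuad (he : IsDiag e lam α) (hα : IsState α) (hf : IsDiag f mu β)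
    (hβ : IsState β) {s : ℝ} (hs : 0 < s) (F : Finset (J × K)) :
    ∑ p ∈ F, ‖⟪e p.1, f p.2⟫_ℂ‖ₑ ^ 2 *
      ENNReal.ofReal ((lam p.1 - mu p.2) ^ 2 / (lam p.1 + s * mu p.2)) ≤ relQuad s α β := by
  classical
  -- the optimal operator is `X = ∑ ⟨eⱼ|fₖ⟩ (λⱼ - μₖ) / (λⱼ + s μₖ) |eⱼ⟩⟨fₖ|`
  let c : F → ℂ := fun p => ⟪e p.1.1, f p.1.2⟫_ℂ *
    (((lam p.1.1 - mu p.1.2) / (lam p.1.1 + s * mu p.1.2) : ℝ) : ℂ)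
  refine le_trans (le_of_eq ?_) (ofReal_relFunctional_le s α β (fun p : F => c p • e p.1.1)
    fun p : F => f p.1.2)
  have h0 : ∀ p : J × K, 0 ≤ (lam p.1 - mu p.2) ^ 2 / (lam p.1 + s * mu p.2) := fun p =>
    div_nonneg (sq_nonneg _)
      (add_nonneg (he.nonneg hα.pos _) (mul_nonneg hs.le (hf.nonneg hβ.pos _)))
  simp_rw [← ofReal_norm_sq, ← ENNReal.ofReal_mul (sq_nonneg (‖_‖ : ℝ))]
  rw [← ENNReal.ofReal_sum_of_nonneg fun p _ => mul_nonneg (sq_nonneg _) (h0 p),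
    ← Finset.sum_coe_sort F]
  congr 1
  have hcn : ∀ p : F, ‖c p‖ ^ 2 = ‖⟪e p.1.1, f p.1.2⟫_ℂ‖ ^ 2 *
      ((lam p.1.1 - mu p.1.2) / (lam p.1.1 + s * mu p.1.2)) ^ 2 := fun p => by
    simp only [c, norm_mul, mul_pow, Complex.norm_real, Real.norm_eq_abs, sq_abs]
  have s1 : ∀ p : F, RCLike.re (⟪c p • e p.1.1, α (f p.1.2)⟫_ℂ - ⟪c p • e p.1.1, β (f p.1.2)⟫_ℂ) =
      ‖⟪e p.1.1, f p.1.2⟫_ℂ‖ ^ 2 *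
        ((lam p.1.1 - mu p.1.2) ^ 2 / (lam p.1.1 + s * mu p.1.2)) := fun p => by
    rw [hf, inner_smul_left, inner_smul_left, he.inner_apply hα.pos.isSymmetric, inner_smul_right]
    have : (starRingEnd ℂ) (c p) * ((lam p.1.1 : ℂ) * ⟪e p.1.1, f p.1.2⟫_ℂ) -
        (starRingEnd ℂ) (c p) * ((mu p.1.2 : ℂ) * ⟪e p.1.1, f p.1.2⟫_ℂ) =
        ((‖⟪e p.1.1, f p.1.2⟫_ℂ‖ ^ 2 *
        ((lam p.1.1 - mu p.1.2) ^ 2 / (lam p.1.1 + s * mu p.1.2)) : ℝ) : ℂ) := by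
      rw [← Complex.normSq_eq_norm_sq]
      push_cast
      rw [Complex.normSq_eq_conj_mul_self]
      simp only [c, map_mul, Complex.conj_ofReal]
      push_cast
      ring
    rw [this]
    exact Complex.ofReal_re _
  have horth : ∀ p q : F, p ≠ q → ⟪e p.1.1, e q.1.1⟫_ℂ = 0 ∨ ⟪f p.1.2, f q.1.2⟫_ℂ = 0 := by
    intro p q hpq
    by_contra! h
    apply hpq
    have h1 : p.1.1 = q.1.1 := by
      by_contra hne; exact h.1 (e.orthonormal.2 hne)
    have h2 : p.1.2 = q.1.2 := by
      by_contra hne; exact h.2 (f.orthonormal.2 hne)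
    exact Subtype.ext (Prod.ext h1 h2)
  have s2 : ∀ p : F, ∑ q : F, RCLike.re (⟪f p.1.2, f q.1.2⟫_ℂ *
      ⟪c q • e q.1.1, α (c p • e p.1.1)⟫_ℂ) = lam p.1.1 * ‖c p‖ ^ 2 := fun p => by
    rw [Finset.sum_eq_single p]
    · rw [map_smul, he, inner_smul_left, inner_smul_right, inner_smul_right,
        inner_self_eq_norm_sq_to_K, inner_self_eq_norm_sq_to_K, e.orthonormal.1, f.orthonormal.1]
      rw [← Complex.normSq_eq_norm_sq, ← Complex.ofReal_re (lam p.1.1 * _)]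
      push_cast
      rw [Complex.normSq_eq_conj_mul_self]
      simp
      ring
    · intro q _ hq
      rw [map_smul, he, inner_smul_left, inner_smul_right, inner_smul_right]
      rcases horth q p hq with h | h
      · simp [h]
      · have h' : ⟪f p.1.2, f q.1.2⟫_ℂ = 0 := by rw [← inner_conj_symm, h, map_zero]
        simp [h']
    · intro h; exact absurd (Finset.mem_univ p) h
  have s3 : ∀ p : F, ∑ q : F, RCLike.re (⟪c p • e p.1.1, c q • e q.1.1⟫_ℂ *
      ⟪f q.1.2, β (f p.1.2)⟫_ℂ) = mu p.1.2 * ‖c p‖ ^ 2 := fun p => by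
    rw [Finset.sum_eq_single p]
    · rw [hf, inner_smul_left, inner_smul_right, inner_smul_right,
        inner_self_eq_norm_sq_to_K, inner_self_eq_norm_sq_to_K, e.orthonormal.1, f.orthonormal.1]
      rw [← Complex.normSq_eq_norm_sq, ← Complex.ofReal_re (mu p.1.2 * _)]
      push_cast
      rw [Complex.normSq_eq_conj_mul_self]
      simp
      ring
    · intro q _ hq
      rw [hf, inner_smul_left, inner_smul_right, inner_smul_right]
      rcases horth p q hq.symm with h | h
      · simp [h]
      · have h' : ⟪f q.1.2, f p.1.2⟫_ℂ = 0 := by rw [← inner_conj_symm, h, map_zero]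
        simp [h']
    · intro h; exact absurd (Finset.mem_univ p) h
  unfold relFunctional
  simp only [s1, s2, s3]
  rw [Finset.mul_sum, Finset.mul_sum, ← Finset.sum_sub_distrib, ← Finset.sum_sub_distrib]
  refine Finset.sum_congr rfl fun p _ => ?_
  rw [hcn]
  rcases (add_nonneg (he.nonneg hα.pos p.1.1)
    (mul_nonneg hs.le (hf.nonneg hβ.pos p.1.2))).eq_or_lt with h | h
  · rw [← h]; simp
  · have hne := h.ne'
    have hl : lam p.1.1 = (lam p.1.1 + s * mu p.1.2) - s * mu p.1.2 := by ring
    generalize lam p.1.1 + s * mu p.1.2 = d at hne hl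
    generalize lam p.1.1 - mu p.1.2 = r
    rw [hl]
    field_simp
    ring

lemma relQuad_eq_tsum (he : IsDiag e lam α) (hα : IsState α) (hf : IsDiag f mu β)
    (hβ : IsState β) {s : ℝ} (hs : 0 < s) :
    relQuad s α β = ∑' p : J × K, ‖⟪e p.1, f p.2⟫_ℂ‖ₑ ^ 2 *
      ENNReal.ofReal ((lam p.1 - mu p.2) ^ 2 / (lam p.1 + s * mu p.2)) := by
  refine le_antisymm ?_ ?_
  · exact iSup_le fun m => iSup_le fun a => iSup_le fun b =>
      relFunctional_le_tsum he hα hf hβ hs a b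
  · rw [ENNReal.tsum_eq_iSup_sum]
    exact iSup_le fun F => sum_le_relQuad he hα hf hβ hs F

/-- Each vector has only countably many nonzero coefficients in a Hilbert basis, separable or not. -/
lemma countable_support_prod {I L : Type*} (u : HilbertBasis L ℂ H) (v : I → H) {w : I → ℝ}
    (hw : Summable w) : {p : I × L | w p.1 ≠ 0 ∧ ⟪u p.2, v p.1⟫_ℂ ≠ 0}.Countable := by
  have h2 : ∀ i, (Function.support fun k => ‖⟪u k, v i⟫_ℂ‖ ^ 2).Countable := fun i =>
    (hasSum_norm_inner_sq u (v i)).summable.countable_support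
  refine Set.Countable.mono ?_
    (hw.countable_support.biUnion fun i _ => (h2 i).image fun k => (i, k))
  rintro ⟨i, k⟩ ⟨hi, hk⟩
  refine Set.mem_biUnion (x := i) hi ⟨k, ?_, rfl⟩
  simpa using hk

/-- The relative entropy is the classical one of the joint weights `|⟨eⱼ|fₖ⟩|² λⱼ` and
`|⟨eⱼ|fₖ⟩|² μₖ`. -/
lemma relEntropy_eq_tsum (he : IsDiag e lam α) (hα : IsState α) (hf : IsDiag f mu β)
    (hβ : IsState β) :
    relEntropy α β = ∑' j, ∑' k, ‖⟪e j, f k⟫_ℂ‖ₑ ^ 2 * scalarRelEntropy (lam j) (mu k) := by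
  have h1 : relEntropy α β = ∫⁻ s in Set.Ioi (0 : ℝ), ∑' p : J × K,
      ENNReal.ofReal (s / (1 + s) ^ 2) * (‖⟪e p.1, f p.2⟫_ℂ‖ₑ ^ 2 *
      ENNReal.ofReal ((lam p.1 - mu p.2) ^ 2 / (lam p.1 + s * mu p.2))) := by
    refine setLIntegral_congr_fun measurableSet_Ioi fun s hs => ?_
    simp only [relQuad_eq_tsum he hα hf hβ hs, ENNReal.tsum_mul_left]
  -- a pair contributes only if its overlap and one of its eigenvalues are nonzero
  have hS : ({p : J × K | lam p.1 ≠ 0 ∧ ⟪f p.2, e p.1⟫_ℂ ≠ 0} ∪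
      Prod.swap '' {p : K × J | mu p.1 ≠ 0 ∧ ⟪e p.2, f p.1⟫_ℂ ≠ 0}).Countable :=
    (countable_support_prod f e (he.summable hα)).union
      ((countable_support_prod e f (hf.summable hβ)).image _)
  rw [h1, lintegral_tsum_of_countable _ hS, ENNReal.tsum_prod']
  · refine tsum_congr fun j => tsum_congr fun k => ?_
    rw [scalarRelEntropy, ← lintegral_const_mul' _ _ (by simp)]
    exact lintegral_congr fun s => by ring
  · rintro ⟨j, k⟩ hp s
    simp only [Set.mem_union, Set.mem_image, Set.mem_ofPred_eq, not_or, not_and, not_exists,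
      not_not] at hp
    by_cases hW : ⟪e j, f k⟫_ℂ = 0
    · simp [hW]
    · have h3 : lam j = 0 := by
        by_contra h
        apply hW
        rw [← inner_conj_symm, hp.1 h, map_zero]
      have h4 : mu k = 0 := by
        by_contra h
        exact hp.2 (k, j) ⟨h, hW⟩ rfl
      simp [h3, h4]
  · intro p
    exact Measurable.aemeasurable (by fun_prop)

/-- The identity `D(α‖β) = -S(α) - Tr[α ln β]` of two states, written without subtractions in
`[0, ∞]`. -/
lemma relEntropy_add_entropy (he : IsDiag e lam α) (hα : IsState α) (hf : IsDiag f mu β)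
    (hβ : IsState β) :
    relEntropy α β + entropy α = ∑' k, expect α (f k) * negLog (mu k) := by
  have hone : ∀ j, ∑' k, ‖⟪e j, f k⟫_ℂ‖ₑ ^ 2 = 1 := fun j => by
    rw [tsum_enorm_inner_sq' f, enorm_hilbertBasis]; simp
  have hone' : ∀ k, ∑' j, ‖⟪e j, f k⟫_ℂ‖ₑ ^ 2 = 1 := fun k => by
    rw [tsum_enorm_inner_sq e, enorm_hilbertBasis]; simp
  -- the traces of both states enter the scalar identity and cancel
  have h1 : relEntropy α β + entropy α + 1 = (∑' k, expect α (f k) * negLog (mu k)) + 1 := by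
    have b1 : relEntropy α β + entropy α + 1 = ∑' j, ∑' k, ‖⟪e j, f k⟫_ℂ‖ₑ ^ 2 *
        (scalarRelEntropy (lam j) (mu k) + ENNReal.ofReal (Real.negMulLog (lam j)) +
          ENNReal.ofReal (lam j)) := by
      simp only [mul_add, ENNReal.tsum_add, ENNReal.tsum_mul_right, hone, one_mul]
      rw [← relEntropy_eq_tsum he hα hf hβ, ← he.entropy_eq hα, he.tsum_eq_one hα]
    have b2 : (∑' k, expect α (f k) * negLog (mu k)) + 1 = ∑' j, ∑' k, ‖⟪e j, f k⟫_ℂ‖ₑ ^ 2 *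
        (ENNReal.ofReal (lam j) * negLog (mu k) + ENNReal.ofReal (mu k)) := by
      rw [ENNReal.tsum_comm]
      simp only [mul_add, ENNReal.tsum_add, ENNReal.tsum_mul_right, hone', one_mul,
        hf.tsum_eq_one hβ]
      congr 1
      refine tsum_congr fun k => ?_
      rw [he.expect_eq_tsum hα.pos.isSymmetric (fun j => he.nonneg hα.pos j),
        ← ENNReal.tsum_mul_right]
      exact tsum_congr fun j => by ring
    rw [b1, b2]
    refine tsum_congr fun j => tsum_congr fun k => ?_
    rw [scalarRelEntropy_add (he.nonneg hα.pos j) (he.le_one hα j) (hf.nonneg hβ.pos k)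
      (hf.le_one hβ k)]
  exact (ENNReal.add_left_inj ENNReal.one_ne_top).1 h1

lemma IsDiag.entropy_eq_tsum_negLog (hf : IsDiag f mu β) (hβ : IsState β) :
    entropy β = ∑' k, ENNReal.ofReal (mu k) * negLog (mu k) := by
  rw [hf.entropy_eq hβ]
  refine tsum_congr fun k => ?_
  rw [negLog]
  split_ifs with h
  · simp [h]
  · rw [← ENNReal.ofReal_mul (hf.nonneg hβ.pos k), Real.negMulLog]
    congr 1
    ring

end RelEntropyDiag

/-! ### Mixtures of unitary conjugates of a state -/

section Mixture

universe u

variable {H : Type*} [NormedAddCommGroup H] [InnerProductSpace ℂ H] [CompleteSpace H]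

/-- The image of a Hilbert basis under a unitary operator. -/
def mapBasis {ι : Type*} (U : H ≃ₗᵢ[ℂ] H) (b : HilbertBasis ι ℂ H) : HilbertBasis ι ℂ H :=
  HilbertBasis.ofRepr (U.symm.trans b.repr)

lemma mapBasis_apply {ι : Type*} (U : H ≃ₗᵢ[ℂ] H) (b : HilbertBasis ι ℂ H) (i : ι) :
    mapBasis U b i = U (b i) := by
  classical
  rw [← HilbertBasis.repr_symm_single (mapBasis U b) i, ← HilbertBasis.repr_symm_single b i]
  rfl

/-- The conjugation `U α U†` by a unitary operator `U`. -/
def conjBy (U : H ≃ₗᵢ[ℂ] H) (α : H →L[ℂ] H) : H →L[ℂ] H :=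
  (U : H →L[ℂ] H) ∘L α ∘L (U.symm : H →L[ℂ] H)

variable {α α' : H →L[ℂ] H} {U : H ≃ₗᵢ[ℂ] H}

lemma conjBy_apply (v : H) : conjBy U α v = U (α (U.symm v)) := rfl

lemma inner_conjBy (u v : H) : ⟪u, conjBy U α v⟫_ℂ = ⟪U.symm u, α (U.symm v)⟫_ℂ := by
  rw [conjBy_apply, ← U.inner_map_map (U.symm u), U.apply_symm_apply]

lemma expect_conjBy (v : H) : expect (conjBy U α) v = expect α (U.symm v) := by
  rw [expect, inner_conjBy, expect]

lemma norm_conjBy_le : ‖conjBy U α‖ ≤ ‖α‖ := by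
  refine ContinuousLinearMap.opNorm_le_bound _ (norm_nonneg _) fun v => ?_
  rw [conjBy_apply, U.norm_map]
  simpa using α.le_opNorm (U.symm v)

lemma IsPositive.conjBy (hα : α.IsPositive) : (conjBy U α).IsPositive := by
  refine ⟨fun u v => ?_, fun v => ?_⟩
  · show ⟪Bosonic.conjBy U α u, v⟫_ℂ = ⟪u, Bosonic.conjBy U α v⟫_ℂ
    rw [← inner_conj_symm, inner_conjBy, inner_conjBy, inner_conj_symm]
    exact hα.isSymmetric _ _
  · rw [ContinuousLinearMap.reApplyInnerSelf_apply, inner_re_symm, inner_conjBy]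
    exact hα.re_inner_nonneg_right _

lemma trace_conjBy (hα : α.IsPositive) : trace (conjBy U α) = trace α := by
  rw [trace_eq_tsum (mapBasis U (basis H)) (IsPositive.conjBy hα), trace_eq_tsum (basis H) hα]
  simp only [expect_conjBy, mapBasis_apply, LinearIsometryEquiv.symm_apply_apply]

lemma IsState.conjBy (hα : IsState α) : IsState (conjBy U α) :=
  ⟨IsPositive.conjBy hα.pos, by rw [trace_conjBy hα.pos, hα.trace_eq_one]⟩

lemma IsDiag.conjBy {ι : Type*} {b : HilbertBasis ι ℂ H} {lam : ι → ℝ} (h : IsDiag b lam α) :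
    IsDiag (mapBasis U b) lam (conjBy U α) := fun i => by
  rw [conjBy_apply, mapBasis_apply, U.symm_apply_apply, h i, map_smul]

lemma IsState.exists_isDiag {H : Type u} [NormedAddCommGroup H] [InnerProductSpace ℂ H]
    [CompleteSpace H] {α : H →L[ℂ] H} (hα : IsState α) :
    ∃ (ι : Type u) (b : HilbertBasis ι ℂ H) (lam : ι → ℝ), IsDiag b lam α :=
  Bosonic.exists_isDiag hα.pos (by rw [hα.trace_eq_one]; exact ENNReal.one_ne_top)

lemma entropy_conjBy (hα : IsState α) : entropy (conjBy U α) = entropy α := by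
  obtain ⟨ι, b, lam, h⟩ := hα.exists_isDiag
  rw [h.entropy_eq hα, (h.conjBy (U := U)).entropy_eq hα.conjBy]

/-- The spectral decomposition `α = ∑ⱼ λⱼ |eⱼ⟩⟨eⱼ|` of a state, in operator norm. -/
lemma IsDiag.conjBy_eq_tsum {ι : Type*} {b : HilbertBasis ι ℂ H} {lam : ι → ℝ}
    (h : IsDiag b lam α) (hα : IsState α) (U : H ≃ₗᵢ[ℂ] H) :
    Bosonic.conjBy U α =
      ∑' j, (lam j : ℂ) • InnerProductSpace.rankOne ℂ (U (b j)) (U (b j)) := by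
  have hs : Summable fun j => (lam j : ℂ) • InnerProductSpace.rankOne ℂ (U (b j)) (U (b j)) := by
    refine Summable.of_norm_bounded (h.summable hα) fun j => ?_
    rw [norm_smul, InnerProductSpace.norm_rankOne, U.norm_map, b.orthonormal.1 j, Complex.norm_real,
      Real.norm_of_nonneg (h.nonneg hα.pos j)]
    simp
  ext v
  refine ext_inner_left ℂ fun u => ?_
  have h1 := (hs.hasSum.mapL (ContinuousLinearMap.apply ℂ H v)).mapL (innerSL ℂ u)
  have h2 := (h.conjBy (U := U)).hasSum_inner (IsPositive.conjBy hα.pos).isSymmetric u v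
  refine h2.unique (h1.congr_fun fun j => ?_)
  simp only [mapBasis_apply, ContinuousLinearMap.apply_apply, innerSL_apply_apply,
    _root_.smul_apply, InnerProductSpace.rankOne_apply, inner_smul_right]
  ring

variable {X : Type*} [TopologicalSpace X] [SecondCountableTopology X]
  {V : X → H ≃ₗᵢ[ℂ] H}

/-- Strong continuity of the unitary operators suffices for continuity in operator norm, because the
spectral decomposition of a state converges uniformly. -/
lemma continuous_conjBy (hα : IsState α) (hV : ∀ v, Continuous fun x => V x v) :
    Continuous fun x => conjBy (V x) α := by
  obtain ⟨ι, b, lam, h⟩ := hα.exists_isDiag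
  simp_rw [h.conjBy_eq_tsum hα]
  refine continuous_tsum (u := lam) (fun j => ?_) (h.summable hα) fun j x => ?_
  · have hr : Continuous fun x => InnerProductSpace.rankOne ℂ (V x (b j)) (V x (b j)) :=
      ((ContinuousLinearMap.smulRightL ℂ H H).continuous.comp
        ((innerSL ℂ).continuous.comp (hV (b j)))).clm_apply (hV (b j))
    exact hr.const_smul (lam j : ℂ)
  · rw [norm_smul, InnerProductSpace.norm_rankOne, (V x).norm_map, b.orthonormal.1 j,
      Complex.norm_real, Real.norm_of_nonneg (h.nonneg hα.pos j)]
    simp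

variable [MeasurableSpace X] [BorelSpace X] {ν : Measure X} [IsProbabilityMeasure ν]

lemma integrable_conjBy (hα : IsState α) (hV : ∀ v, Continuous fun x => V x v) :
    Integrable (fun x => conjBy (V x) α) ν :=
  Integrable.of_bound (continuous_conjBy hα hV).aestronglyMeasurable ‖α‖
    (ae_of_all _ fun _ => norm_conjBy_le)

/-- Matrix elements of a Bochner integral of operators are integrals of matrix elements. -/
lemma isMixture_integral (hα : IsState α) (hV : ∀ v, Continuous fun x => V x v) :
    IsMixture ν (fun x v => (V x).symm v) α (∫ x, conjBy (V x) α ∂ν) := by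
  intro u v
  have hi := integrable_conjBy (ν := ν) hα hV
  have h1 := ((innerSL ℂ u).comp (ContinuousLinearMap.apply ℂ H v)).integral_comp_comm hi
  have h2 := ((innerSL ℂ u).comp (ContinuousLinearMap.apply ℂ H v)).integrable_comp hi
  simp only [ContinuousLinearMap.comp_apply, ContinuousLinearMap.apply_apply,
    innerSL_apply_apply, inner_conjBy] at h1 h2
  exact ⟨h2, h1.symm⟩

lemma continuous_expect (α : H →L[ℂ] H) : Continuous (expect α) :=
  ENNReal.continuous_ofReal.comp (RCLike.continuous_re.comp
    (Continuous.inner continuous_id α.continuous))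

lemma IsMixture.expect_eq {W : X → H → H} (h : IsMixture ν W α α') (hα : α.IsPositive) (v : H) :
    expect α' v = ∫⁻ x, expect α (W x v) ∂ν := by
  have h1 := (h v v).1.re
  rw [expect, (h v v).2]
  have h2 := integral_re (h v v).1
  rw [← h2, ofReal_integral_eq_lintegral_ofReal h1]
  · rfl
  · exact ae_of_all _ fun x => hα.re_inner_nonneg_right _

lemma IsMixture.isPositive {W : X → H → H} (h : IsMixture ν W α α') (hα : α.IsPositive) :
    α'.IsPositive := by
  refine ⟨fun u v => ?_, fun v => ?_⟩
  · show ⟪α' u, v⟫_ℂ = ⟪u, α' v⟫_ℂ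
    rw [← inner_conj_symm, (h v u).2, (h u v).2, ← integral_conj]
    refine integral_congr_ae (ae_of_all _ fun x => ?_)
    show (starRingEnd ℂ) ⟪W x v, α (W x u)⟫_ℂ = _
    rw [inner_conj_symm]
    exact hα.isSymmetric _ _
  · rw [ContinuousLinearMap.reApplyInnerSelf_apply, inner_re_symm, (h v v).2,
      ← integral_re (h v v).1]
    exact integral_nonneg fun x => hα.re_inner_nonneg_right _

variable (hVs : ∀ v, Continuous fun x => (V x).symm v)
include hVs

/-- A weighted trace of a mixture is the average of the weighted traces. The weights `c` may be
infinite, and the index set uncountable: off a countable set of indices, all terms vanish on a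
dense set, hence everywhere. -/
lemma IsMixture.tsum_expect {ι : Type*} (h : IsMixture ν (fun x v => (V x).symm v) α α')
    (hα : IsState α) (b : HilbertBasis ι ℂ H) (c : ι → ℝ≥0∞) :
    ∑' i, expect α' (b i) * c i = ∫⁻ x, ∑' i, expect α ((V x).symm (b i)) * c i ∂ν := by
  have hfin : ∀ x, ∑' i, expect α ((V x).symm (b i)) ≠ ∞ := fun x => by
    have h1 := trace_eq_tsum b (hα.conjBy (U := V x)).pos
    rw [(hα.conjBy (U := V x)).trace_eq_one] at h1
    simp only [expect_conjBy] at h1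
    rw [← h1]; exact ENNReal.one_ne_top
  have hcont : ∀ i, Continuous fun x => expect α ((V x).symm (b i)) := fun i =>
    (continuous_expect α).comp (hVs _)
  obtain ⟨D, hD, hDd⟩ := TopologicalSpace.exists_countable_dense X
  have hz : ∀ i ∉ ⋃ x ∈ D, Function.support fun i => expect α ((V x).symm (b i)),
      ∀ x, expect α ((V x).symm (b i)) = 0 := fun i hi x => by
    have : (fun x => expect α ((V x).symm (b i))) = fun _ => 0 :=
      Continuous.ext_on hDd (hcont i) continuous_const fun x hx => by
        by_contra h
        exact hi (Set.mem_biUnion hx h)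
    exact congrFun this x
  rw [lintegral_tsum_of_countable (fun i => ((hcont i).measurable.mul_const _).aemeasurable)
    (hD.biUnion fun x _ => Summable.countable_support_ennreal (hfin x))
    (fun i hi x => by rw [hz i hi, zero_mul])]
  refine tsum_congr fun i => ?_
  rw [h.expect_eq hα.pos, lintegral_mul_const _ (hcont i).measurable]

lemma IsMixture.isState (h : IsMixture ν (fun x v => (V x).symm v) α α') (hα : IsState α) :
    IsState α' := by
  refine ⟨h.isPositive hα.pos, ?_⟩
  have h1 := h.tsum_expect hVs hα (basis H) fun _ => 1
  simp only [mul_one] at h1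
  rw [trace_eq_tsum (basis H) (h.isPositive hα.pos), h1]
  have h2 : ∀ x, ∑' i, expect α ((V x).symm (basis H i)) = 1 := fun x => by
    have h1 := trace_eq_tsum (basis H) (hα.conjBy (U := V x)).pos
    rw [(hα.conjBy (U := V x)).trace_eq_one] at h1
    simpa only [expect_conjBy] using h1.symm
  simp [h2]

/-- The entropy gained by a mixture of unitary conjugations is the Holevo information of the
ensemble. -/
lemma IsMixture.lintegral_relEntropy_add (h : IsMixture ν (fun x v => (V x).symm v) α α')
    (hα : IsState α) :
    ∫⁻ x, relEntropy (conjBy (V x) α) α' ∂ν + entropy α = entropy α' := by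
  have hα' := h.isState hVs hα
  obtain ⟨J, e, lam, he⟩ := hα.exists_isDiag
  obtain ⟨K, f, mu, hf⟩ := hα'.exists_isDiag
  calc ∫⁻ x, relEntropy (conjBy (V x) α) α' ∂ν + entropy α
      = ∫⁻ x, relEntropy (conjBy (V x) α) α' ∂ν + ∫⁻ _, entropy α ∂ν := by simp
    _ = ∫⁻ x, (relEntropy (conjBy (V x) α) α' + entropy (conjBy (V x) α)) ∂ν := by
        rw [← lintegral_add_right _ measurable_const]
        simp only [entropy_conjBy hα]
    _ = ∫⁻ x, ∑' k, expect α ((V x).symm (f k)) * negLog (mu k) ∂ν := by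
        refine lintegral_congr fun x => ?_
        rw [relEntropy_add_entropy (he.conjBy (U := V x)) hα.conjBy hf hα']
        simp only [expect_conjBy]
    _ = ∑' k, expect α' (f k) * negLog (mu k) := (h.tsum_expect hVs hα f _).symm
    _ = entropy α' := by
        rw [hf.entropy_eq_tsum_negLog hα']
        exact tsum_congr fun k => by rw [hf.expect_self]

end Mixture

/-! ### Partial traces -/

section PartialTrace

variable {E F G : Type*} [NormedAddCommGroup E] [InnerProductSpace ℂ E] [CompleteSpace E]
  [NormedAddCommGroup F] [InnerProductSpace ℂ F] [CompleteSpace F]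
  [NormedAddCommGroup G] [InnerProductSpace ℂ G] [CompleteSpace G]

lemma tensorLeft_apply (e : E) (f : F) :
    tensorLeft e f = ((e ⊗ₜ[ℂ] f : E ⊗[ℂ] F) : HilbertTensor E F) := rfl

lemma tensorRight_apply (e : E) (f : F) : tensorRight f e = tensorLeft e f := rfl

lemma inner_tensorLeft (e e' : E) (f f' : F) :
    ⟪tensorLeft e f, tensorLeft e' f'⟫_ℂ = ⟪e, e'⟫_ℂ * ⟪f, f'⟫_ℂ := by
  rw [tensorLeft_apply, tensorLeft_apply, UniformSpace.Completion.inner_coe,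
    TensorProduct.inner_tmul]

lemma enorm_tensorLeft (e : E) (f : F) : ‖tensorLeft e f‖ₑ = ‖e‖ₑ * ‖f‖ₑ := by
  rw [tensorLeft_apply, ← TensorProduct.enorm_tmul (𝕜 := ℂ), ← ofReal_norm,
    UniformSpace.Completion.norm_coe, ofReal_norm]

/-- Simple tensors are total in the Hilbert space tensor product. -/
lemma span_tensorLeft_dense :
    Dense (Submodule.span ℂ (Set.range fun p : E × F => tensorLeft p.1 p.2) :
      Set (HilbertTensor E F)) := by
  refine (UniformSpace.Completion.denseRange_coe (α := E ⊗[ℂ] F)).mono ?_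
  rintro _ ⟨x, rfl⟩
  induction x using TensorProduct.induction_on with
  | zero =>
    rw [UniformSpace.Completion.coe_zero]
    exact Submodule.zero_mem _
  | tmul e f => exact Submodule.subset_span ⟨(e, f), rfl⟩
  | add x y hx hy =>
    rw [UniformSpace.Completion.coe_add]
    exact Submodule.add_mem _ hx hy

lemma eq_zero_of_inner_hilbertBasis {ι : Type*} (b : HilbertBasis ι ℂ E) {v : E}
    (h : ∀ i, ⟪b i, v⟫_ℂ = 0) : v = 0 := by
  have := tsum_enorm_inner_sq b v
  simp only [h, enorm_zero, ne_eq, OfNat.ofNat_ne_zero, not_false_eq_true, zero_pow,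
    tsum_zero] at this
  simpa using this.symm

/-- The Hilbert basis of product vectors. -/
def productBasis {ι κ : Type*} (b : HilbertBasis ι ℂ E) (c : HilbertBasis κ ℂ F) :
    HilbertBasis (ι × κ) ℂ (HilbertTensor E F) := by
  classical
  refine HilbertBasis.mkOfOrthogonalEqBot (v := fun p : ι × κ => tensorLeft (b p.1) (c p.2)) ?_ ?_
  · rw [orthonormal_iff_ite]
    intro p q
    have hb := orthonormal_iff_ite.1 b.orthonormal
    have hc := orthonormal_iff_ite.1 c.orthonormal
    rw [inner_tensorLeft, hb, hc]
    by_cases h1 : p.1 = q.1 <;> by_cases h2 : p.2 = q.2 <;> simp [h1, h2, Prod.ext_iff]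
  · rw [eq_bot_iff]
    intro Ψ hΨ
    rw [Submodule.mem_orthogonal] at hΨ
    have h0 : ∀ i j, ⟪tensorLeft (b i) (c j), Ψ⟫_ℂ = 0 := fun i j =>
      hΨ _ (Submodule.subset_span ⟨(i, j), rfl⟩)
    have h1 : ∀ i f, ⟪tensorLeft (b i) f, Ψ⟫_ℂ = 0 := fun i f => by
      have : (tensorLeft (F := F) (b i)).adjoint Ψ = 0 :=
        eq_zero_of_inner_hilbertBasis c fun j => by
          rw [ContinuousLinearMap.adjoint_inner_right, h0]
      rw [← ContinuousLinearMap.adjoint_inner_right, this, inner_zero_right]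
    have h2 : ∀ (e : E) (f : F), ⟪tensorLeft e f, Ψ⟫_ℂ = 0 := fun e f => by
      have : (tensorRight (E := E) f).adjoint Ψ = 0 :=
        eq_zero_of_inner_hilbertBasis b fun i => by
          rw [ContinuousLinearMap.adjoint_inner_right, tensorRight_apply, h1]
      rw [← tensorRight_apply, ← ContinuousLinearMap.adjoint_inner_right, this, inner_zero_right]
    have h3 : Ψ ∈ (Submodule.span ℂ (Set.range fun p : E × F => tensorLeft p.1 p.2))ᗮ := by
      rw [Submodule.mem_orthogonal]
      intro u hu
      induction hu using Submodule.span_induction with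
      | mem x hx => obtain ⟨p, rfl⟩ := hx; exact h2 _ _
      | zero => simp
      | add x y _ _ hx hy => rw [inner_add_left, hx, hy, add_zero]
      | smul c x _ hx => rw [inner_smul_left, hx, mul_zero]
    rwa [Submodule.topologicalClosure_eq_top_iff.1
      (Submodule.dense_iff_topologicalClosure_eq_top.1 span_tensorLeft_dense)] at h3

lemma productBasis_apply {ι κ : Type*} (b : HilbertBasis ι ℂ E) (c : HilbertBasis κ ℂ F)
    (p : ι × κ) : productBasis b c p = tensorLeft (b p.1) (c p.2) := by
  rw [productBasis, HilbertBasis.coe_mkOfOrthogonalEqBot]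

/-- The Hilbert–Schmidt norms of an operator and of its adjoint agree. -/
lemma tsum_enorm_apply_sq_adjoint {ι κ : Type*} (b : HilbertBasis ι ℂ E)
    (c : HilbertBasis κ ℂ G) (T : E →L[ℂ] G) :
    ∑' i, ‖T (b i)‖ₑ ^ 2 = ∑' j, ‖T.adjoint (c j)‖ₑ ^ 2 := by
  simp_rw [← tsum_enorm_inner_sq c (T (b _)), ← tsum_enorm_inner_sq' b (T.adjoint (c _))]
  rw [ENNReal.tsum_comm]
  exact tsum_congr fun j => tsum_congr fun i => by rw [ContinuousLinearMap.adjoint_inner_left]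

/-- The trace of the compression `V† T V` does not depend on the basis. -/
lemma tsum_expect_comp_comm {ι κ : Type*} {T : G →L[ℂ] G} (hT : T.IsPositive) (V : E →L[ℂ] G)
    (b : HilbertBasis ι ℂ E) (c : HilbertBasis κ ℂ E) :
    ∑' i, expect T (V (b i)) = ∑' j, expect T (V (c j)) := by
  simp_rw [expect_eq_enorm_sqrt hT]
  exact (tsum_enorm_apply_sq_adjoint b (basis G) (CFC.sqrt T ∘L V)).trans
    (tsum_enorm_apply_sq_adjoint c (basis G) (CFC.sqrt T ∘L V)).symm

/-- The operator norm is bounded by the trace norm. -/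
lemma enorm_le_trace {T : E →L[ℂ] E} (hT : T.IsPositive) : ‖T‖ₑ ≤ trace T := by
  by_cases htop : trace T = ∞
  · rw [htop]; exact le_top
  have hS : ∀ v, ‖CFC.sqrt T v‖ ^ 2 ≤ (trace T).toReal * ‖v‖ ^ 2 := fun v => by
    have h := expect_le_trace_mul hT v
    rw [expect_eq_enorm_sqrt hT, ← ofReal_norm, ← ofReal_norm, ← ENNReal.ofReal_pow (norm_nonneg _),
      ← ENNReal.ofReal_pow (norm_nonneg _), ← ENNReal.ofReal_toReal htop,
      ← ENNReal.ofReal_mul ENNReal.toReal_nonneg] at h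
    exact (ENNReal.ofReal_le_ofReal_iff (by positivity)).1 h
  have hn : ‖CFC.sqrt T‖ ≤ √(trace T).toReal := by
    refine ContinuousLinearMap.opNorm_le_bound _ (Real.sqrt_nonneg _) fun v => ?_
    refine abs_le_of_sq_le_sq' ?_ (by positivity) |>.2
    rw [mul_pow, Real.sq_sqrt ENNReal.toReal_nonneg]
    exact hS v
  have h0 : 0 ≤ T := (ContinuousLinearMap.nonneg_iff_isPositive T).2 hT
  rw [← ofReal_norm]
  refine ENNReal.ofReal_le_of_le_toReal ?_
  calc ‖T‖ = ‖CFC.sqrt T * CFC.sqrt T‖ := by rw [CFC.sqrt_mul_sqrt_self T h0]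
    _ ≤ ‖CFC.sqrt T‖ * ‖CFC.sqrt T‖ := norm_mul_le _ _
    _ ≤ √(trace T).toReal * √(trace T).toReal := by gcongr
    _ = (trace T).toReal := Real.mul_self_sqrt ENNReal.toReal_nonneg

/-- The compression `V† ρ V`. -/
def compress (V : F →L[ℂ] G) (ρ : G →L[ℂ] G) : F →L[ℂ] F := V.adjoint ∘L ρ ∘L V

lemma expect_compress (V : F →L[ℂ] G) (ρ : G →L[ℂ] G) (v : F) :
    expect (compress V ρ) v = expect ρ (V v) := by
  rw [expect, expect, compress, ContinuousLinearMap.comp_apply,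
    ContinuousLinearMap.adjoint_inner_right, ContinuousLinearMap.comp_apply]

lemma compress_isPositive (V : F →L[ℂ] G) {ρ : G →L[ℂ] G} (hρ : ρ.IsPositive) :
    (compress V ρ).IsPositive := hρ.adjoint_conj V

/-- A family of compressions of finite total trace is summable in operator norm, so that the sums in
the definition of the partial traces converge. -/
lemma hasSum_compress {ι κ : Type*} {V : ι → F →L[ℂ] G} {ρ : G →L[ℂ] G} (hρ : ρ.IsPositive)
    (c : HilbertBasis κ ℂ F) (h : ∑' i, ∑' j, expect ρ (V i (c j)) ≠ ∞) :
    HasSum (fun i => compress (V i) ρ) (∑' i, compress (V i) ρ) := by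
  refine Summable.hasSum ?_
  refine Summable.of_norm_bounded (ENNReal.summable_toReal h) fun i => ?_
  have h1 := enorm_le_trace (compress_isPositive (V i) hρ)
  rw [trace_eq_tsum c (compress_isPositive (V i) hρ)] at h1
  simp only [expect_compress] at h1
  rw [← ofReal_norm] at h1
  exact (ENNReal.ofReal_le_iff_le_toReal (ENNReal.ne_top_of_tsum_ne_top h i)).1 h1

lemma tsum_compress {ι κ : Type*} {V : ι → F →L[ℂ] G} {ρ : G →L[ℂ] G} (hρ : ρ.IsPositive)
    (c : HilbertBasis κ ℂ F) (h : ∑' i, ∑' j, expect ρ (V i (c j)) ≠ ∞) :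
    (∑' i, compress (V i) ρ).IsPositive ∧
      ∀ v, expect (∑' i, compress (V i) ρ) v = ∑' i, expect ρ (V i v) := by
  have hs := hasSum_compress hρ c h
  have hin : ∀ u v, HasSum (fun i => ⟪u, compress (V i) ρ v⟫_ℂ)
      ⟪u, (∑' i, compress (V i) ρ) v⟫_ℂ := fun u v =>
    (hs.mapL (ContinuousLinearMap.apply ℂ F v)).mapL (innerSL ℂ u)
  have hre : ∀ v, HasSum (fun i => RCLike.re ⟪v, compress (V i) ρ v⟫_ℂ)
      (RCLike.re ⟪v, (∑' i, compress (V i) ρ) v⟫_ℂ) := fun v => Complex.hasSum_re (hin v v)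
  refine ⟨⟨fun u v => ?_, fun v => ?_⟩, fun v => ?_⟩
  · show ⟪(∑' i, compress (V i) ρ) u, v⟫_ℂ = ⟪u, (∑' i, compress (V i) ρ) v⟫_ℂ
    rw [← inner_conj_symm]
    have h1 := Complex.hasSum_conj'.2 (hin v u)
    refine HasSum.unique (h1.congr_fun fun i => ?_) (hin u v)
    rw [inner_conj_symm]
    exact ((compress_isPositive (V i) hρ).isSymmetric u v).symm
  · rw [ContinuousLinearMap.reApplyInnerSelf_apply, inner_re_symm, ← (hre v).tsum_eq]
    exact tsum_nonneg fun i => (compress_isPositive (V i) hρ).re_inner_nonneg_right v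
  · rw [expect, ← (hre v).tsum_eq, ENNReal.ofReal_tsum_of_nonneg
      (fun i => (compress_isPositive (V i) hρ).re_inner_nonneg_right v) (hre v).summable]
    exact tsum_congr fun i => expect_compress _ _ _

variable {ρ : HilbertTensor E F →L[ℂ] HilbertTensor E F}

lemma tsum_expect_tensor (hρ : ρ.IsPositive) {ι κ : Type*} (b : HilbertBasis ι ℂ E)
    (c : HilbertBasis κ ℂ F) : ∑' i, ∑' j, expect ρ (tensorLeft (b i) (c j)) = trace ρ := by
  rw [trace_eq_tsum (productBasis b c) hρ, ENNReal.tsum_prod']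
  simp only [productBasis_apply]

lemma traceFst_isPositive (hρ : IsState ρ) : (traceFst ρ).IsPositive :=
  (tsum_compress hρ.pos (basis F) (V := fun i => tensorLeft (basis E i)) (by
    rw [tsum_expect_tensor hρ.pos, hρ.trace_eq_one]; exact ENNReal.one_ne_top)).1

lemma traceSnd_isPositive (hρ : IsState ρ) : (traceSnd ρ).IsPositive :=
  (tsum_compress hρ.pos (basis E) (V := fun j => tensorRight (basis F j)) (by
    simp only [tensorRight_apply]
    rw [ENNReal.tsum_comm, tsum_expect_tensor hρ.pos, hρ.trace_eq_one]
    exact ENNReal.one_ne_top)).1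

/-- The partial trace over the first factor can be computed in any Hilbert basis. -/
lemma expect_traceFst (hρ : IsState ρ) {ι : Type*} (b : HilbertBasis ι ℂ E) (f : F) :
    expect (traceFst ρ) f = ∑' i, expect ρ (tensorLeft (b i) f) := by
  have h := (tsum_compress hρ.pos (basis F) (V := fun i => tensorLeft (basis E i)) (by
    rw [tsum_expect_tensor hρ.pos, hρ.trace_eq_one]; exact ENNReal.one_ne_top)).2 f
  refine h.trans ?_
  simp_rw [← tensorRight_apply]
  exact tsum_expect_comp_comm hρ.pos (tensorRight f) (basis E) b

lemma expect_traceSnd (hρ : IsState ρ) {κ : Type*} (c : HilbertBasis κ ℂ F) (e : E) :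
    expect (traceSnd ρ) e = ∑' j, expect ρ (tensorLeft e (c j)) := by
  have h := (tsum_compress hρ.pos (basis E) (V := fun j => tensorRight (basis F j)) (by
    simp only [tensorRight_apply]
    rw [ENNReal.tsum_comm, tsum_expect_tensor hρ.pos, hρ.trace_eq_one]
    exact ENNReal.one_ne_top)).2 e
  refine h.trans ?_
  exact tsum_expect_comp_comm hρ.pos (tensorLeft e) (basis F) c

lemma traceFst_isState (hρ : IsState ρ) : IsState (traceFst ρ) := by
  refine ⟨traceFst_isPositive hρ, ?_⟩
  rw [trace_eq_tsum (basis F) (traceFst_isPositive hρ)]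
  simp_rw [expect_traceFst hρ (basis E)]
  rw [ENNReal.tsum_comm, tsum_expect_tensor hρ.pos, hρ.trace_eq_one]

lemma traceSnd_isState (hρ : IsState ρ) : IsState (traceSnd ρ) := by
  refine ⟨traceSnd_isPositive hρ, ?_⟩
  rw [trace_eq_tsum (basis E) (traceSnd_isPositive hρ)]
  simp_rw [expect_traceSnd hρ (basis F)]
  rw [tsum_expect_tensor hρ.pos, hρ.trace_eq_one]

end PartialTrace

/-! ### Displacement operators and Weyl relations -/

section Displacement

variable {n : ℕ}

lemma position_add (x y : PhaseSpace n) : position (x + y) = position x + position y := rfl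

lemma momentum_add (x y : PhaseSpace n) : momentum (x + y) = momentum x + momentum y := rfl

lemma position_neg (x : PhaseSpace n) : position (-x) = -position x := rfl

lemma momentum_neg (x : PhaseSpace n) : momentum (-x) = -momentum x := rfl

lemma continuous_position : Continuous (position : PhaseSpace n → Config n) := by
  unfold position
  fun_prop

lemma continuous_momentum : Continuous (momentum : PhaseSpace n → Config n) := by
  unfold momentum
  fun_prop

/-- The phase `exp(i σ(x, y) / 2)` of the Weyl relations, with the symplectic form `σ`. -/
def weylPhase (x y : PhaseSpace n) : ℂ :=
  Complex.exp ((((⟪momentum x, position y⟫_ℝ - ⟪momentum y, position x⟫_ℝ) / 2 : ℝ) : ℂ) *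
    Complex.I)

lemma norm_weylPhase (x y : PhaseSpace n) : ‖weylPhase x y‖ = 1 :=
  Complex.norm_exp_ofReal_mul_I _

/-- The Weyl form of the canonical commutation relations. -/
lemma displacement_displacement (x y : PhaseSpace n) (ψ : Mode n) :
    displacement x (displacement y ψ) = weylPhase x y • displacement (x + y) ψ := by
  apply Lp.ext
  have h1 := displacement_apply_ae x (displacement y ψ)
  have h2 := (measurePreserving_sub_right (volume : Measure (Config n))
    (position x)).quasiMeasurePreserving.ae_eq_comp (displacement_apply_ae y ψ)
  have h3 := displacement_apply_ae (x + y) ψ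
  have h4 := Lp.coeFn_smul (weylPhase x y) (displacement (x + y) ψ)
  filter_upwards [h1, h2, h3, h4] with z h1 h2 h3 h4
  simp only [Function.comp_apply] at h2
  rw [h1, h2, h4, Pi.smul_apply, h3, smul_eq_mul, ← mul_assoc, ← mul_assoc, weylPhase,
    ← Complex.exp_add, ← Complex.exp_add, ← add_mul, ← add_mul, position_add, momentum_add,
    sub_sub, ← Complex.ofReal_add, ← Complex.ofReal_add]
  have hre : ⟪momentum x, z⟫_ℝ - ⟪momentum x, position x⟫_ℝ / 2 +
      (⟪momentum y, z - position x⟫_ℝ - ⟪momentum y, position y⟫_ℝ / 2) =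
      (⟪momentum x, position y⟫_ℝ - ⟪momentum y, position x⟫_ℝ) / 2 +
      (⟪momentum x + momentum y, z⟫_ℝ -
        ⟪momentum x + momentum y, position x + position y⟫_ℝ / 2) := by
    rw [inner_sub_right, inner_add_left, inner_add_left, inner_add_right, inner_add_right]
    ring
  rw [hre]

lemma displacement_zero (ψ : Mode n) : displacement (0 : PhaseSpace n) ψ = ψ := by
  apply Lp.ext
  filter_upwards [displacement_apply_ae (0 : PhaseSpace n) ψ] with y hy
  have h1 : position (0 : PhaseSpace n) = 0 := rfl
  have h2 : momentum (0 : PhaseSpace n) = 0 := rfl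
  rw [hy, h1, h2]
  simp

lemma displacement_neg (x : PhaseSpace n) (ψ : Mode n) :
    displacement x (displacement (-x) ψ) = ψ := by
  rw [displacement_displacement, add_neg_cancel, displacement_zero, weylPhase, position_neg,
    momentum_neg, inner_neg_left, inner_neg_right, sub_self]
  simp

lemma continuous_displacementPhase_left (y : Config n) :
    Continuous fun x : PhaseSpace n => displacementPhase x y := by
  unfold displacementPhase
  have := continuous_position (n := n)
  have := continuous_momentum (n := n)
  fun_prop

/-- Multiplication by phases is strongly continuous, by dominated convergence. -/
lemma tendsto_phaseMul (x : PhaseSpace n) (ψ : Mode n) :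
    Tendsto (fun z => phaseMul z ψ) (𝓝 x) (𝓝 (phaseMul x ψ)) := by
  have hψ : ∫⁻ y, ‖ψ y‖ₑ ^ 2 < ∞ := by
    have := (Lp.memLp ψ).2
    rw [eLpNorm_lt_top_iff_lintegral_rpow_enorm_lt_top (by simp) (by simp)] at this
    simpa using this
  have h1 : ∀ z, edist (phaseMul z ψ) (phaseMul x ψ) =
      (∫⁻ y, ‖(displacementPhase z y - displacementPhase x y) * ψ y‖ₑ ^ 2) ^ (1 / 2 : ℝ) := by
    intro z
    rw [Lp.edist_def, eLpNorm_eq_lintegral_rpow_enorm_toReal (by simp) (by simp)]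
    have hz := MemLp.coeFn_toLp (memLp_displacementPhase_mul z ψ)
    have hx := MemLp.coeFn_toLp (memLp_displacementPhase_mul x ψ)
    simp only [ENNReal.toReal_ofNat, ENNReal.rpow_ofNat]
    congr 1
    refine lintegral_congr_ae ?_
    filter_upwards [hz, hx] with y hz hx
    have e1 : (phaseMul z ψ : Config n → ℂ) y = displacementPhase z y * ψ y := hz
    have e2 : (phaseMul x ψ : Config n → ℂ) y = displacementPhase x y * ψ y := hx
    rw [Pi.sub_apply, e1, e2, sub_mul]
  rw [tendsto_iff_edist_tendsto_0]
  simp_rw [h1]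
  have h2 : Tendsto (fun z : PhaseSpace n =>
      ∫⁻ y, ‖(displacementPhase z y - displacementPhase x y) * ψ y‖ₑ ^ 2) (𝓝 x) (𝓝 0) := by
    have := tendsto_lintegral_filter_of_dominated_convergence (l := 𝓝 x) (μ := volume)
      (F := fun z y => ‖(displacementPhase z y - displacementPhase x y) * ψ y‖ₑ ^ 2)
      (f := fun _ => 0) (fun y => 4 * ‖ψ y‖ₑ ^ 2) ?_ ?_ ?_ ?_
    · simpa using this
    · refine .of_forall fun z => ?_
      have a1 := (continuous_displacementPhase z).measurable
      have a2 := (continuous_displacementPhase x).measurable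
      have a3 := (Lp.stronglyMeasurable ψ).measurable
      fun_prop
    · refine .of_forall fun z => ae_of_all _ fun y => ?_
      rw [enorm_mul, mul_pow]
      gcongr
      have : ‖displacementPhase z y - displacementPhase x y‖ₑ ≤ 2 := by
        refine (enorm_sub_le).trans ?_
        rw [← ofReal_norm, ← ofReal_norm, norm_displacementPhase, norm_displacementPhase,
          ENNReal.ofReal_one]
        norm_num
      calc _ ≤ (2 : ℝ≥0∞) ^ 2 := pow_le_pow_left' this 2
        _ = 4 := by norm_num
    · rw [lintegral_const_mul' _ _ (by simp)]
      exact (ENNReal.mul_lt_top (by simp) hψ).ne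
    · refine ae_of_all _ fun y => ?_
      have hc : Continuous fun z : PhaseSpace n =>
          ‖(displacementPhase z y - displacementPhase x y) * ψ y‖ₑ ^ 2 := by
        have := continuous_displacementPhase_left y
        exact ENNReal.continuous_pow 2 |>.comp (by fun_prop)
      simpa using hc.tendsto x
  have := (ENNReal.continuous_rpow_const (y := 1 / 2)).tendsto (0 : ℝ≥0∞)
  rw [ENNReal.zero_rpow_of_pos (by norm_num)] at this
  exact this.comp h2

/-- The displacement operators are strongly continuous. -/
lemma continuous_displacement (ψ : Mode n) : Continuous fun x => displacement x ψ := by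
  rw [continuous_iff_continuousAt]
  intro x
  let τ : PhaseSpace n → Mode n := fun z =>
    Lp.compMeasurePreserving (fun y : Config n => y - position z)
      (measurePreserving_sub_right volume (position z)) ψ
  have hτ : Continuous τ := by
    have hg : Continuous fun z : PhaseSpace n =>
        (⟨fun y : Config n => y - position z, by fun_prop⟩ : C(Config n, Config n)) := by
      refine ContinuousMap.continuous_of_continuous_uncurry _ ?_
      have := continuous_position (n := n)
      simp only [Function.uncurry_def, ContinuousMap.coe_mk]
      fun_prop
    exact Continuous.compMeasurePreservingLp (continuous_const (y := ψ)) hg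
      (fun z => measurePreserving_sub_right volume (position z)) (by simp)
  have h1 : ∀ z, displacement z ψ = phaseMul z (τ z) := fun z => rfl
  rw [ContinuousAt, h1, tendsto_iff_dist_tendsto_zero]
  refine squeeze_zero (g := fun z => dist (τ z) (τ x) + dist (phaseMul z (τ x)) (phaseMul x (τ x)))
    (fun _ => dist_nonneg) (fun z => ?_) ?_
  · rw [h1]
    refine (dist_triangle _ (phaseMul z (τ x)) _).trans ?_
    rw [(phaseMul z).dist_map]
  · have := (tendsto_iff_dist_tendsto_zero.1 (hτ.tendsto x)).add
      (tendsto_iff_dist_tendsto_zero.1 (tendsto_phaseMul x (τ x)))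
    simpa using this

variable (M : Type*) [NormedAddCommGroup M] [InnerProductSpace ℂ M]

lemma displacementLeft_coe (x : PhaseSpace n) (u : Mode n ⊗[ℂ] M) :
    displacementLeft M x (u : HilbertTensor (Mode n) M) =
      (((displacement x).toContinuousLinearMap.rTensor M u : Mode n ⊗[ℂ] M) :
        HilbertTensor (Mode n) M) :=
  ContinuousLinearMap.completion_apply_coe _ _

/-- `D(x) ⊗ 1` is isometric on the algebraic tensor product, hence on its completion. -/
lemma norm_displacementLeft (x : PhaseSpace n) (Ψ : HilbertTensor (Mode n) M) :
    ‖displacementLeft M x Ψ‖ = ‖Ψ‖ := by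
  induction Ψ using UniformSpace.Completion.induction_on with
  | hp => exact isClosed_eq (by fun_prop) (by fun_prop)
  | ih u =>
    rw [displacementLeft_coe, UniformSpace.Completion.norm_coe, UniformSpace.Completion.norm_coe,
      ← LinearIsometry.toContinuousLinearMap_rTensor]
    exact ((displacement x).rTensor M).norm_map u

lemma displacementLeft_displacementLeft (x y : PhaseSpace n) (Ψ : HilbertTensor (Mode n) M) :
    displacementLeft M x (displacementLeft M y Ψ) =
      weylPhase x y • displacementLeft M (x + y) Ψ := by
  induction Ψ using UniformSpace.Completion.induction_on with
  | hp =>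
    exact isClosed_eq (displacementLeft M x ∘L displacementLeft M y).continuous
      (weylPhase x y • displacementLeft M (x + y)).continuous
  | ih u =>
    rw [displacementLeft_coe, displacementLeft_coe, displacementLeft_coe,
      ← UniformSpace.Completion.coe_smul]
    congr 1
    induction u using TensorProduct.induction_on with
    | zero => simp
    | tmul ψ m =>
      simp only [ContinuousLinearMap.rTensor_tmul, LinearIsometry.coe_toContinuousLinearMap,
        displacement_displacement, TensorProduct.smul_tmul']
    | add u v hu hv => rw [map_add, map_add, hu, hv, map_add, smul_add]

lemma displacementLeft_zero (Ψ : HilbertTensor (Mode n) M) :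
    displacementLeft M (0 : PhaseSpace n) Ψ = Ψ := by
  induction Ψ using UniformSpace.Completion.induction_on with
  | hp => exact isClosed_eq (by fun_prop) (by fun_prop)
  | ih u =>
    rw [displacementLeft_coe]
    congr 1
    induction u using TensorProduct.induction_on with
    | zero => simp
    | tmul ψ m =>
      simp only [ContinuousLinearMap.rTensor_tmul, LinearIsometry.coe_toContinuousLinearMap,
        displacement_zero]
    | add u v hu hv => rw [map_add, hu, hv]

lemma weylPhase_neg_right (x : PhaseSpace n) : weylPhase x (-x) = 1 := by
  simp [weylPhase, position_neg, momentum_neg]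

lemma weylPhase_neg_left (x : PhaseSpace n) : weylPhase (-x) x = 1 := by
  simp [weylPhase, position_neg, momentum_neg]

/-- The displacement operator `D(x) ⊗ 1` as a unitary operator. -/
def displacementUnitary (x : PhaseSpace n) :
    HilbertTensor (Mode n) M ≃ₗᵢ[ℂ] HilbertTensor (Mode n) M where
  toFun := displacementLeft M x
  invFun := displacementLeft M (-x)
  map_add' := map_add _
  map_smul' := map_smul _
  left_inv Ψ := by
    rw [displacementLeft_displacementLeft, weylPhase_neg_left, neg_add_cancel, one_smul,
      displacementLeft_zero]
  right_inv Ψ := by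
    rw [displacementLeft_displacementLeft, weylPhase_neg_right, add_neg_cancel, one_smul,
      displacementLeft_zero]
  norm_map' Ψ := norm_displacementLeft M x Ψ

lemma displacementUnitary_symm_apply (x : PhaseSpace n) (Ψ : HilbertTensor (Mode n) M) :
    (displacementUnitary M x).symm Ψ = displacementLeft M (-x) Ψ := rfl

lemma displacementLeft_tensorLeft [CompleteSpace M] (x : PhaseSpace n) (ψ : Mode n) (m : M) :
    displacementLeft M x (tensorLeft ψ m) = tensorLeft (displacement x ψ) m := by
  rw [tensorLeft_apply, displacementLeft_coe]; rfl

/-- Strong continuity passes from product vectors to their closed span, since the operators are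
isometric. -/
lemma continuous_displacementLeft [CompleteSpace M] (Ψ : HilbertTensor (Mode n) M) :
    Continuous fun x : PhaseSpace n => displacementLeft M x Ψ := by
  have hspan : ∀ Φ ∈ Submodule.span ℂ (Set.range fun p : Mode n × M => tensorLeft p.1 p.2),
      Continuous fun x : PhaseSpace n => displacementLeft M x Φ := by
    intro Φ hΦ
    induction hΦ using Submodule.span_induction with
    | mem Φ h =>
      obtain ⟨p, rfl⟩ := h
      have h1 : (fun x : PhaseSpace n => displacementLeft M x (tensorLeft p.1 p.2)) =
          fun x => tensorRight p.2 (displacement x p.1) := by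
        ext1 x
        rw [displacementLeft_tensorLeft, tensorRight_apply]
      rw [h1]
      exact (tensorRight p.2).continuous.comp (continuous_displacement p.1)
    | zero => simpa using continuous_const
    | add u v _ _ hu hv => exact (hu.add hv).congr fun x => (map_add (displacementLeft M x) u v).symm
    | smul c u _ hu => exact (hu.const_smul c).congr fun x => (map_smul (displacementLeft M x) c u).symm
  rw [continuous_iff_continuousAt]
  intro x
  rw [Metric.continuousAt_iff']
  intro ε hε
  obtain ⟨Φ, hΦ, hd⟩ := Metric.mem_closure_iff.1
    (span_tensorLeft_dense (E := Mode n) (F := M) Ψ) (ε / 3) (by positivity)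
  have h1 := Metric.continuousAt_iff'.1 ((hspan Φ hΦ).continuousAt (x := x)) (ε / 3)
    (by positivity)
  filter_upwards [h1] with z hz
  have hiso : ∀ w, dist (displacementLeft M w Ψ) (displacementLeft M w Φ) = dist Ψ Φ := fun w =>
    (displacementUnitary M w).dist_map Ψ Φ
  have h2 := dist_triangle4 (displacementLeft M z Ψ) (displacementLeft M z Φ)
    (displacementLeft M x Φ) (displacementLeft M x Ψ)
  rw [hiso, dist_comm (displacementLeft M x Φ), hiso] at h2
  linarith

end Displacement

/-! ### Gaussian measures on the phase space -/

section GaussianIntegrals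

variable {V : Type*} [NormedAddCommGroup V] [InnerProductSpace ℝ V] [FiniteDimensional ℝ V]
  [MeasurableSpace V] [BorelSpace V]

/-- Gaussian functions are integrable. -/
lemma integrable_exp_neg_mul_sq_norm {b : ℝ} (hb : 0 < b) :
    Integrable fun x : V => Real.exp (-b * ‖x‖ ^ 2) := by
  have h := (GaussianFourier.integrable_cexp_neg_mul_sq_norm_add (b := b)
    (by simpa using hb) 0 (0 : V)).re
  refine h.congr (ae_of_all _ fun x => ?_)
  have h1 : Complex.exp (-(b : ℂ) * ‖x‖ ^ 2 + 0 * ⟪(0 : V), x⟫_ℝ) =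
      ((Real.exp (-b * ‖x‖ ^ 2) : ℝ) : ℂ) := by
    rw [zero_mul, add_zero]; push_cast; rfl
  show (Complex.exp (-(b : ℂ) * ‖x‖ ^ 2 + 0 * ⟪(0 : V), x⟫_ℝ)).re = _
  rw [h1, Complex.ofReal_re]

/-- Gaussian functions have second moments. -/
lemma integrable_sq_norm_mul_exp {b : ℝ} (hb : 0 < b) :
    Integrable fun x : V => ‖x‖ ^ 2 * Real.exp (-b * ‖x‖ ^ 2) := by
  refine ((integrable_exp_neg_mul_sq_norm (V := V) (b := b / 2) (by positivity)).const_mul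
    (2 / b)).mono' (by fun_prop) (ae_of_all _ fun x => ?_)
  rw [Real.norm_of_nonneg (by positivity)]
  -- half of the exponent absorbs the square: `b / 2 * ‖x‖² ≤ exp (b / 2 * ‖x‖²)`
  have h1 := Real.add_one_le_exp (b / 2 * ‖x‖ ^ 2)
  have h2 : Real.exp (-b * ‖x‖ ^ 2) =
      Real.exp (-(b / 2 * ‖x‖ ^ 2)) * Real.exp (-(b / 2) * ‖x‖ ^ 2) := by
    rw [← Real.exp_add]; ring_nf
  rw [h2, ← mul_assoc]
  gcongr
  have h3 : ‖x‖ ^ 2 ≤ 2 / b * Real.exp (b / 2 * ‖x‖ ^ 2) := by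
    rw [div_mul_eq_mul_div, le_div_iff₀ hb]; linarith
  calc ‖x‖ ^ 2 * Real.exp (-(b / 2 * ‖x‖ ^ 2))
      ≤ 2 / b * Real.exp (b / 2 * ‖x‖ ^ 2) * Real.exp (-(b / 2 * ‖x‖ ^ 2)) := by gcongr
    _ = 2 / b := by rw [mul_assoc, ← Real.exp_add, add_neg_cancel, Real.exp_zero, mul_one]

end GaussianIntegrals

section Gaussian

variable {n : ℕ} {s t : ℝ}

lemma gaussianDensity_nonneg (ht : 0 < t) (x : PhaseSpace n) : 0 ≤ gaussianDensity n t x := by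
  unfold gaussianDensity
  positivity

lemma continuous_gaussianDensity : Continuous (gaussianDensity n t) := by
  unfold gaussianDensity
  fun_prop

/-- The Fourier transform of a Gaussian density. Its value at `0` is the normalization. -/
lemma integral_gaussianDensity_mul_cexp (ht : 0 < t) (w : PhaseSpace n) :
    ∫ x : PhaseSpace n, (gaussianDensity n t x : ℂ) * Complex.exp (⟪x, w⟫_ℝ * Complex.I) =
      Complex.exp (-(t * ‖w‖ ^ 2 / 2 : ℝ)) := by
  have hb : 0 < ((1 / (2 * t) : ℝ) : ℂ).re := by rw [Complex.ofReal_re]; positivity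
  have ht' : (t : ℂ) ≠ 0 := by exact_mod_cast ht.ne'
  have h := GaussianFourier.integral_cexp_neg_mul_sq_norm_add hb Complex.I w
  have hcard : (Module.finrank ℝ (PhaseSpace n) : ℂ) / 2 = (n : ℕ) := by
    rw [finrank_euclideanSpace, Fintype.card_prod, Fintype.card_fin, Fintype.card_fin]
    push_cast; ring
  have hpi : (Real.pi : ℂ) / ((1 / (2 * t) : ℝ) : ℂ) = 2 * Real.pi * t := by
    push_cast; field_simp
  rw [hcard, Complex.cpow_natCast, hpi] at h
  have hne : (2 * Real.pi * t : ℂ) ^ n ≠ 0 := by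
    refine pow_ne_zero _ (mul_ne_zero (mul_ne_zero two_ne_zero ?_) ht')
    exact_mod_cast Real.pi_ne_zero
  have e1 : ∀ x : PhaseSpace n,
      (gaussianDensity n t x : ℂ) * Complex.exp (⟪x, w⟫_ℝ * Complex.I) =
      ((2 * Real.pi * t : ℂ) ^ n)⁻¹ *
        Complex.exp (-((1 / (2 * t) : ℝ) : ℂ) * ‖x‖ ^ 2 + Complex.I * ⟪w, x⟫_ℝ) := fun x => by
    rw [gaussianDensity, Complex.exp_add, real_inner_comm, mul_comm Complex.I]
    push_cast
    rw [div_mul_eq_mul_div, div_eq_inv_mul]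
    congr 4
    field_simp
  simp_rw [e1]
  rw [integral_const_mul, h, inv_mul_cancel_left₀ hne]
  congr 1
  rw [Complex.I_sq]
  push_cast
  field_simp
  ring

lemma integrable_gaussianDensity (ht : 0 < t) : Integrable (gaussianDensity n t) := by
  have h := (integrable_exp_neg_mul_sq_norm (V := PhaseSpace n) (b := 1 / (2 * t)) (by positivity)).div_const
    ((2 * Real.pi * t) ^ n)
  refine h.congr (ae_of_all _ fun x => ?_)
  simp only [gaussianDensity]
  congr 2
  ring

lemma integral_gaussianDensity (ht : 0 < t) : ∫ x, gaussianDensity n t x = 1 := by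
  have h := integral_gaussianDensity_mul_cexp ht (0 : PhaseSpace n)
  simp only [inner_zero_right, Complex.ofReal_zero, zero_mul, Complex.exp_zero, mul_one,
    norm_zero] at h
  rw [integral_complex_ofReal] at h
  have h1 : ((∫ x, gaussianDensity n t x : ℝ) : ℂ) = ((1 : ℝ) : ℂ) := h.trans (by simp)
  exact_mod_cast h1

/-- The centered Gaussian measure on the phase space with covariance matrix `t I`. -/
def gaussianMeasure (n : ℕ) (t : ℝ) : Measure (PhaseSpace n) :=
  volume.withDensity fun x => ENNReal.ofReal (gaussianDensity n t x)

lemma lintegral_gaussianMeasure (f : PhaseSpace n → ℝ≥0∞) :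
    ∫⁻ x, f x ∂gaussianMeasure n t = ∫⁻ x, ENNReal.ofReal (gaussianDensity n t x) * f x :=
  lintegral_withDensity_eq_lintegral_mul_non_measurable _
    continuous_gaussianDensity.measurable.ennreal_ofReal (ae_of_all _ fun _ => by simp) f

lemma isProbabilityMeasure_gaussianMeasure (ht : 0 < t) :
    IsProbabilityMeasure (gaussianMeasure n t) := by
  constructor
  rw [← lintegral_one, lintegral_gaussianMeasure]
  simp only [mul_one]
  rw [← ofReal_integral_eq_lintegral_ofReal (integrable_gaussianDensity ht)
    (ae_of_all _ (gaussianDensity_nonneg ht)), integral_gaussianDensity ht, ENNReal.ofReal_one]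

lemma integral_gaussianMeasure {G : Type*} [NormedAddCommGroup G] [NormedSpace ℝ G] (ht : 0 < t)
    (f : PhaseSpace n → G) :
    ∫ x, f x ∂gaussianMeasure n t = ∫ x, gaussianDensity n t x • f x := by
  rw [gaussianMeasure, integral_withDensity_eq_integral_toReal_smul
    continuous_gaussianDensity.measurable.ennreal_ofReal (ae_of_all _ fun _ => by simp)]
  simp_rw [ENNReal.toReal_ofReal (gaussianDensity_nonneg ht _)]

lemma charFun_gaussianMeasure (ht : 0 < t) (w : PhaseSpace n) :
    charFun (gaussianMeasure n t) w = Complex.exp (-(t * ‖w‖ ^ 2 / 2 : ℝ)) := by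
  rw [charFun_apply, integral_gaussianMeasure ht, ← integral_gaussianDensity_mul_cexp ht]
  simp only [Complex.real_smul]

/-- Gaussian measures form a convolution semigroup, as their characteristic functions show. -/
lemma gaussianMeasure_conv (hs : 0 < s) (ht : 0 < t) :
    gaussianMeasure n s ∗ gaussianMeasure n t = gaussianMeasure n (s + t) := by
  have := isProbabilityMeasure_gaussianMeasure (n := n) hs
  have := isProbabilityMeasure_gaussianMeasure (n := n) ht
  have := isProbabilityMeasure_gaussianMeasure (n := n) (add_pos hs ht)
  apply Measure.ext_of_charFun
  ext w
  rw [charFun_conv, charFun_gaussianMeasure hs, charFun_gaussianMeasure ht,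
    charFun_gaussianMeasure (add_pos hs ht), ← Complex.exp_add]
  congr 1
  push_cast
  ring

lemma integrable_sq_norm_mul_gaussianDensity (ht : 0 < t) :
    Integrable fun x => ‖x‖ ^ 2 * gaussianDensity n t x := by
  have h := (integrable_sq_norm_mul_exp (V := PhaseSpace n) (b := 1 / (2 * t)) (by positivity)).div_const
    ((2 * Real.pi * t) ^ n)
  refine h.congr (ae_of_all _ fun x => ?_)
  simp only [gaussianDensity, mul_div_assoc]
  congr 3
  ring

lemma lintegral_sq_enorm_gaussianMeasure_lt_top (ht : 0 < t) :
    ∫⁻ x, ‖x‖ₑ ^ 2 ∂gaussianMeasure n t < ∞ := by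
  rw [lintegral_gaussianMeasure]
  refine lt_of_le_of_lt (lintegral_mono fun x => ?_)
    (integrable_sq_norm_mul_gaussianDensity (n := n) ht).lintegral_lt_top
  rw [← ofReal_norm, ← ENNReal.ofReal_pow (norm_nonneg _),
    ← ENNReal.ofReal_mul (gaussianDensity_nonneg ht x), mul_comm]

/-- The differential entropy of a Gaussian random variable is an absolutely convergent integral. -/
lemma integrable_negMulLog_gaussianDensity (ht : 0 < t) :
    Integrable fun x => Real.negMulLog (gaussianDensity n t x) := by
  have h1 := (integrable_sq_norm_mul_gaussianDensity (n := n) ht).const_mul (1 / (2 * t))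
  have h2 := (integrable_gaussianDensity (n := n) ht).const_mul (Real.log ((2 * Real.pi * t) ^ n))
  refine (h1.add h2).congr (ae_of_all _ fun x => ?_)
  have hp : (0 : ℝ) < (2 * Real.pi * t) ^ n := by positivity
  have hg : Real.log (gaussianDensity n t x) =
      -‖x‖ ^ 2 / (2 * t) - Real.log ((2 * Real.pi * t) ^ n) := by
    rw [gaussianDensity, Real.log_div (Real.exp_pos _).ne' hp.ne', Real.log_exp]
  simp only [Pi.add_apply, Real.negMulLog, hg]
  ring

end Gaussian

/-! ### The heat semigroup -/

section Heat

variable {n : ℕ} {s t : ℝ} {M : Type*} [NormedAddCommGroup M] [InnerProductSpace ℂ M]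
  [CompleteSpace M] {ρ : HilbertTensor (Mode n) M →L[ℂ] HilbertTensor (Mode n) M}

lemma displace_eq_conjBy (ρ : HilbertTensor (Mode n) M →L[ℂ] HilbertTensor (Mode n) M)
    (x : PhaseSpace n) : displace ρ x = conjBy (displacementUnitary M x) ρ := by
  have h1 : displacementLeft M x =
      ((displacementUnitary M x : HilbertTensor (Mode n) M ≃L[ℂ] HilbertTensor (Mode n) M) :
        HilbertTensor (Mode n) M →L[ℂ] HilbertTensor (Mode n) M) := by
    ext v; rfl
  have h2 : (displacementLeft M x).adjoint =
      (((displacementUnitary M x).symm :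
          HilbertTensor (Mode n) M ≃L[ℂ] HilbertTensor (Mode n) M) :
        HilbertTensor (Mode n) M →L[ℂ] HilbertTensor (Mode n) M) := by
    rw [h1]
    exact LinearIsometryEquiv.adjoint_eq_symm (displacementUnitary M x)
  rw [displace, h2]
  rfl

lemma continuous_displacementUnitary (v : HilbertTensor (Mode n) M) :
    Continuous fun x : PhaseSpace n => displacementUnitary M x v :=
  continuous_displacementLeft M v

lemma continuous_displacementUnitary_symm (v : HilbertTensor (Mode n) M) :
    Continuous fun x : PhaseSpace n => (displacementUnitary M x).symm v :=
  (continuous_displacementLeft M v).comp continuous_neg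

/-- The phases of the Weyl relations cancel in expectation values. -/
lemma inner_displacementUnitary_symm_symm (x y : PhaseSpace n)
    (α : HilbertTensor (Mode n) M →L[ℂ] HilbertTensor (Mode n) M)
    (u v : HilbertTensor (Mode n) M) :
    ⟪(displacementUnitary M y).symm ((displacementUnitary M x).symm u),
      α ((displacementUnitary M y).symm ((displacementUnitary M x).symm v))⟫_ℂ =
    ⟪(displacementUnitary M (x + y)).symm u, α ((displacementUnitary M (x + y)).symm v)⟫_ℂ := by
  simp only [displacementUnitary_symm_apply, displacementLeft_displacementLeft, map_smul,
    inner_smul_left, inner_smul_right]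
  rw [← neg_add_rev, mul_left_comm, ← mul_assoc, Complex.conj_mul',
    norm_weylPhase]
  simp

lemma heat_of_pos (ht : 0 < t)
    (ρ : HilbertTensor (Mode n) M →L[ℂ] HilbertTensor (Mode n) M) :
    heat t ρ = ∫ x, conjBy (displacementUnitary M x) ρ ∂gaussianMeasure n t := by
  rw [heat, if_pos ht, integral_gaussianMeasure ht]
  simp_rw [displace_eq_conjBy]

lemma heat_zero (ρ : HilbertTensor (Mode n) M →L[ℂ] HilbertTensor (Mode n) M) :
    heat 0 ρ = ρ := by simp [heat]

lemma isMixture_heat (ht : 0 < t) (hρ : IsState ρ) :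
    IsMixture (gaussianMeasure n t) (fun x v => (displacementUnitary M x).symm v) ρ
      (heat t ρ) := by
  have := isProbabilityMeasure_gaussianMeasure (n := n) ht
  rw [heat_of_pos ht]
  exact isMixture_integral hρ continuous_displacementUnitary

lemma isState_heat (ht : 0 < t) (hρ : IsState ρ) : IsState (heat t ρ) := by
  have := isProbabilityMeasure_gaussianMeasure (n := n) ht
  exact (isMixture_heat ht hρ).isState continuous_displacementUnitary_symm hρ

/-- The semigroup law, which follows from the Weyl relations and from the convolution of Gaussian
measures. -/
lemma heat_heat (hs : 0 < s) (ht : 0 < t) (hρ : IsState ρ) :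
    heat s (heat t ρ) = heat (s + t) ρ := by
  have := isProbabilityMeasure_gaussianMeasure (n := n) hs
  have := isProbabilityMeasure_gaussianMeasure (n := n) ht
  ext v
  refine ext_inner_left ℂ fun u => ?_
  have h1 := isMixture_heat (add_pos hs ht) hρ u v
  rw [(isMixture_heat hs (isState_heat ht hρ) u v).2, h1.2, ← gaussianMeasure_conv hs ht,
    integral_conv (by rw [gaussianMeasure_conv hs ht]; exact h1.1)]
  congr 1
  ext x
  rw [(isMixture_heat ht hρ _ _).2]
  simp_rw [inner_displacementUnitary_symm_symm]

/-- The entropy gained along the heat semigroup is the mean relative entropy of the displaced states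
with respect to their average. -/
lemma entropy_add_lintegral_relEntropy_heat (ht : 0 < t) (hρ : IsState ρ) :
    ∫⁻ x, relEntropy (conjBy (displacementUnitary M x) ρ) (heat t ρ) ∂gaussianMeasure n t +
      entropy ρ = entropy (heat t ρ) := by
  have := isProbabilityMeasure_gaussianMeasure (n := n) ht
  exact (isMixture_heat ht hρ).lintegral_relEntropy_add continuous_displacementUnitary_symm hρ

lemma entropy_le_entropy_heat (ht : 0 < t) (hρ : IsState ρ) :
    entropy ρ ≤ entropy (heat t ρ) := by
  rw [← entropy_add_lintegral_relEntropy_heat ht hρ]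
  exact le_add_self

/-- The data processing inequality for the heat semigroup, which commutes with displacements. -/
lemma relEntropy_heat_le (hs : 0 < s) (ht : 0 < t) (hρ : IsState ρ) (x : PhaseSpace n) :
    relEntropy (conjBy (displacementUnitary M x) (heat t ρ)) (heat (s + t) ρ) ≤
      relEntropy (conjBy (displacementUnitary M x) ρ) (heat s ρ) := by
  have := isProbabilityMeasure_gaussianMeasure (n := n) ht
  refine relEntropy_le_of_isMixture (ν := gaussianMeasure n t)
    (W := fun y v => (displacementUnitary M y).symm v)
    (fun y u v => (displacementUnitary M y).symm.inner_map_map u v) ?_ ?_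
  · intro u v
    have h1 := isMixture_heat ht hρ ((displacementUnitary M x).symm u)
      ((displacementUnitary M x).symm v)
    simp_rw [inner_conjBy]
    simp_rw [inner_displacementUnitary_symm_symm] at h1 ⊢
    simp_rw [add_comm _ x]
    exact h1
  · rw [add_comm, ← heat_heat ht hs hρ]
    exact isMixture_heat ht (isState_heat hs hρ)

/-- The increments of the entropy along the heat semigroup decrease with time. -/
lemma entropy_heat_add_le (hs : 0 < s) (ht : 0 < t) (hρ : IsState ρ) :
    entropy (heat (s + t) ρ) + entropy ρ ≤ entropy (heat s ρ) + entropy (heat t ρ) := by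
  rw [← heat_heat hs ht hρ, ← entropy_add_lintegral_relEntropy_heat hs (isState_heat ht hρ),
    ← entropy_add_lintegral_relEntropy_heat hs hρ, heat_heat hs ht hρ, add_assoc, add_assoc,
    add_comm (entropy ρ)]
  gcongr with x
  exact relEntropy_heat_le hs ht hρ x

/-- The displacement operator as a unitary operator on the modes. -/
def displacementEquiv (x : PhaseSpace n) : Mode n ≃ₗᵢ[ℂ] Mode n where
  toFun := displacement x
  invFun := displacement (-x)
  map_add' := map_add _
  map_smul' := map_smul _
  left_inv ψ := by simpa using displacement_neg (-x) ψ
  right_inv ψ := displacement_neg x ψ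
  norm_map' ψ := (displacement x).norm_map ψ

/-- The partial trace over the modes does not see a displacement, which only changes the basis in
which the trace is computed. -/
lemma tsum_expect_displacementUnitary_symm (hρ : IsState ρ) (x : PhaseSpace n) (m : M) :
    ∑' i, expect ρ ((displacementUnitary M x).symm (tensorLeft (basis (Mode n) i) m)) =
      expect (traceFst ρ) m := by
  rw [expect_traceFst hρ (mapBasis (displacementEquiv x).symm (basis (Mode n)))]
  simp only [displacementUnitary_symm_apply, displacementLeft_tensorLeft, mapBasis_apply]
  rfl

lemma traceFst_conjBy (hρ : IsState ρ) (x : PhaseSpace n) :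
    traceFst (conjBy (displacementUnitary M x) ρ) = traceFst ρ := by
  refine eq_of_expect_eq (traceFst_isPositive hρ.conjBy) (traceFst_isPositive hρ) fun m => ?_
  rw [expect_traceFst hρ.conjBy (basis (Mode n)), ← tsum_expect_displacementUnitary_symm hρ x]
  simp_rw [expect_conjBy]

/-- The heat semigroup acts on the modes only: it preserves the marginal on the other system. -/
lemma traceFst_heat (ht : 0 ≤ t) (hρ : IsState ρ) : traceFst (heat t ρ) = traceFst ρ := by
  obtain rfl | ht := ht.eq_or_lt
  · rw [heat_zero]
  have := isProbabilityMeasure_gaussianMeasure (n := n) ht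
  refine eq_of_expect_eq (traceFst_isPositive (isState_heat ht hρ)) (traceFst_isPositive hρ)
    fun m => ?_
  rw [expect_traceFst (isState_heat ht hρ) (basis (Mode n))]
  simp_rw [(isMixture_heat ht hρ).expect_eq hρ.pos]
  rw [← lintegral_tsum_of_continuous]
  · simp_rw [tsum_expect_displacementUnitary_symm hρ]
    simp
  · exact fun i => (continuous_expect ρ).comp (continuous_displacementUnitary_symm _)
  · intro x
    rw [tsum_expect_displacementUnitary_symm hρ]
    exact ENNReal.ofReal_ne_top

end Heat

/-! ### Entropy of classical-quantum states -/

section CqEntropy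

variable {H : Type*} [NormedAddCommGroup H] [InnerProductSpace ℂ H] [CompleteSpace H]

lemma continuous_max_negMulLog : Continuous fun y => max (Real.negMulLog y) 0 :=
  Real.continuous_negMulLog.max continuous_const

lemma continuous_max_neg_negMulLog : Continuous fun y => max (-Real.negMulLog y) 0 :=
  Real.continuous_negMulLog.neg.max continuous_const

lemma IsDiag.smul {ι : Type*} {b : HilbertBasis ι ℂ H} {lam : ι → ℝ} {α : H →L[ℂ] H}
    (h : IsDiag b lam α) (c : ℝ) : IsDiag b (fun i => c * lam i) (c • α) := fun i => by
  rw [_root_.smul_apply, h i, RCLike.real_smul_eq_coe_smul (K := ℂ), smul_smul]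
  push_cast
  rfl

lemma isSymmetric_smul {α : H →L[ℂ] H} (hα : α.IsPositive) (c : ℝ) :
    (c • α).IsSymmetric := fun u v => by
  have h : ⟪α u, v⟫_ℂ = ⟪u, α v⟫_ℂ := hα.isSymmetric u v
  show ⟪c • α u, v⟫_ℂ = ⟪u, c • α v⟫_ℂ
  rw [RCLike.real_smul_eq_coe_smul (K := ℂ), RCLike.real_smul_eq_coe_smul (K := ℂ),
    inner_smul_left, inner_smul_right, h]
  simp

/-- The identity `η(c λ) = λ η(c) + c η(λ)` for `η(y) = -y ln y`, summed over the spectrum of a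
state and written without subtractions. -/
lemma trace_cfc_smul_add {α : H →L[ℂ] H} (hα : IsState α) {c : ℝ} (hc : 0 ≤ c) :
    trace (cfc (fun y => max (Real.negMulLog y) 0) (c • α)) +
        ENNReal.ofReal (max (-Real.negMulLog c) 0) =
      trace (cfc (fun y => max (-Real.negMulLog y) 0) (c • α)) +
        (ENNReal.ofReal (max (Real.negMulLog c) 0) + ENNReal.ofReal c * entropy α) := by
  obtain ⟨ι, b, lam, h⟩ := hα.exists_isDiag
  have h1 : ∀ a : ℝ, ENNReal.ofReal a = ∑' i, ENNReal.ofReal (lam i) * ENNReal.ofReal a :=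
    fun a => by rw [ENNReal.tsum_mul_right, h.tsum_eq_one hα, one_mul]
  have hsym := isSymmetric_smul hα.pos c
  rw [(h.smul c).trace_cfc hsym continuous_max_negMulLog fun i => le_max_right _ _,
    (h.smul c).trace_cfc hsym continuous_max_neg_negMulLog fun i => le_max_right _ _,
    h.entropy_eq hα, h1 (max (-Real.negMulLog c) 0), h1 (max (Real.negMulLog c) 0),
    ← ENNReal.tsum_mul_left, ← ENNReal.tsum_add, ← ENNReal.tsum_add, ← ENNReal.tsum_add]
  refine tsum_congr fun i => ?_
  have h0 := h.nonneg hα.pos i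
  have hη := Real.negMulLog_nonneg h0 (h.le_one hα i)
  rw [← ENNReal.ofReal_mul h0, ← ENNReal.ofReal_mul h0, ← ENNReal.ofReal_mul hc,
    ← ENNReal.ofReal_add (le_max_right _ _) (mul_nonneg h0 (le_max_right _ _)),
    ← ENNReal.ofReal_add (mul_nonneg h0 (le_max_right _ _)) (mul_nonneg hc hη),
    ← ENNReal.ofReal_add (le_max_right _ _)
      (add_nonneg (mul_nonneg h0 (le_max_right _ _)) (mul_nonneg hc hη))]
  congr 1
  have hmax : ∀ a : ℝ, max a 0 - max (-a) 0 = a := fun a => by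
    rcases le_total 0 a with h | h
    · rw [max_eq_left h, max_eq_right (by linarith), sub_zero]
    · rw [max_eq_right h, max_eq_left (by linarith), zero_sub, neg_neg]
  have e1 := hmax (Real.negMulLog (c * lam i))
  have e2 := hmax (Real.negMulLog c)
  have e3 := Real.negMulLog_mul c (lam i)
  linear_combination e1 - lam i * e2 + e3

/-- The negative part of the entropy of `c α` is finite: for an eigenvalue `λ ∈ [0, 1]` one has
`-η(c λ) ≤ -λ η(c)`. -/
lemma trace_cfc_smul_le {α : H →L[ℂ] H} (hα : IsState α) {c : ℝ} (hc : 0 ≤ c) :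
    trace (cfc (fun y => max (-Real.negMulLog y) 0) (c • α)) ≤
      ENNReal.ofReal (max (-Real.negMulLog c) 0) := by
  obtain ⟨ι, b, lam, h⟩ := hα.exists_isDiag
  rw [(h.smul c).trace_cfc (isSymmetric_smul hα.pos c) continuous_max_neg_negMulLog
    fun i => le_max_right _ _]
  calc ∑' i, ENNReal.ofReal (max (-Real.negMulLog (c * lam i)) 0)
      ≤ ∑' i, ENNReal.ofReal (lam i) * ENNReal.ofReal (max (-Real.negMulLog c) 0) := by
        refine ENNReal.tsum_le_tsum fun i => ?_
        have h0 := h.nonneg hα.pos i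
        have hη := mul_nonneg hc (Real.negMulLog_nonneg h0 (h.le_one hα i))
        rw [← ENNReal.ofReal_mul h0]
        refine ENNReal.ofReal_le_ofReal (max_le ?_ (mul_nonneg h0 (le_max_right _ _)))
        have h1 := mul_le_mul_of_nonneg_left (le_max_left (-Real.negMulLog c) 0) h0
        rw [Real.negMulLog_mul]
        linarith
    _ = ENNReal.ofReal (max (-Real.negMulLog c) 0) := by
        rw [ENNReal.tsum_mul_right, h.tsum_eq_one hα, one_mul]

/-- The entropy of a classical-quantum state whose conditional states all have the same entropy
is the sum of that entropy and of the differential entropy of the classical variable. -/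
lemma cqEntropy_smul {X : Type*} [MeasureSpace X] {g : X → ℝ} (hgm : Measurable g)
    (hg : ∀ x, 0 ≤ g x) (hg1 : ∫⁻ x, ENNReal.ofReal (g x) = 1)
    (hgi : Integrable fun x => Real.negMulLog (g x)) {τ : X → H →L[ℂ] H}
    (hτ : ∀ x, IsState (τ x)) {S : ℝ} (hS0 : 0 ≤ S)
    (hS : ∀ x, entropy (τ x) = ENNReal.ofReal S) :
    cqEntropy (fun x => g x • τ x) = ((∫ x, Real.negMulLog (g x)) + S : ℝ) := by
  have hm1 : Measurable fun x => ENNReal.ofReal (max (Real.negMulLog (g x)) 0) :=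
    (continuous_max_negMulLog.measurable.comp hgm).ennreal_ofReal
  have hm2 : Measurable fun x => ENNReal.ofReal (max (-Real.negMulLog (g x)) 0) :=
    (continuous_max_neg_negMulLog.measurable.comp hgm).ennreal_ofReal
  have e1 : ∫⁻ x, ENNReal.ofReal (max (Real.negMulLog (g x)) 0) ≠ ∞ :=
    (hgi.sup (integrable_zero _ _ _)).lintegral_lt_top.ne
  have e2 : ∫⁻ x, ENNReal.ofReal (max (-Real.negMulLog (g x)) 0) ≠ ∞ :=
    (hgi.neg.sup (integrable_zero _ _ _)).lintegral_lt_top.ne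
  have key : (∫⁻ x, trace (cfc (fun y => max (Real.negMulLog y) 0) (g x • τ x))) +
      ∫⁻ x, ENNReal.ofReal (max (-Real.negMulLog (g x)) 0) =
      (∫⁻ x, trace (cfc (fun y => max (-Real.negMulLog y) 0) (g x • τ x))) +
      ((∫⁻ x, ENNReal.ofReal (max (Real.negMulLog (g x)) 0)) + ENNReal.ofReal S) := by
    have h3 : ENNReal.ofReal S = ∫⁻ x, ENNReal.ofReal (g x) * ENNReal.ofReal S := by
      rw [lintegral_mul_const _ hgm.ennreal_ofReal, hg1, one_mul]
    rw [h3, ← lintegral_add_right _ hm2, ← lintegral_add_left hm1,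
      ← lintegral_add_right _ (by fun_prop)]
    refine lintegral_congr fun x => ?_
    rw [trace_cfc_smul_add (hτ x) (hg x), hS]
  -- finiteness of both parts, which is what allows the subtraction in `EReal`
  have e3 : ∫⁻ x, trace (cfc (fun y => max (-Real.negMulLog y) 0) (g x • τ x)) ≠ ∞ :=
    ne_top_of_le_ne_top e2 (lintegral_mono fun x => trace_cfc_smul_le (hτ x) (hg x))
  have e4 : ∫⁻ x, trace (cfc (fun y => max (Real.negMulLog y) 0) (g x • τ x)) ≠ ∞ := by
    refine ne_top_of_le_ne_top ?_ (le_self_add.trans key.le)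
    exact ENNReal.add_ne_top.2 ⟨e3, ENNReal.add_ne_top.2 ⟨e1, ENNReal.ofReal_ne_top⟩⟩
  have hint : ∫ x, Real.negMulLog (g x) =
      (∫⁻ x, ENNReal.ofReal (max (Real.negMulLog (g x)) 0)).toReal -
      (∫⁻ x, ENNReal.ofReal (max (-Real.negMulLog (g x)) 0)).toReal := by
    rw [integral_eq_lintegral_pos_part_sub_lintegral_neg_part hgi]
    congr 2 <;>
    · refine lintegral_congr fun x => ?_
      simp [ENNReal.ofReal, Real.toNNReal]
  have key' := congrArg ENNReal.toReal key
  rw [ENNReal.toReal_add e4 e2, ENNReal.toReal_add e3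
    (ENNReal.add_ne_top.2 ⟨e1, ENNReal.ofReal_ne_top⟩),
    ENNReal.toReal_add e1 ENNReal.ofReal_ne_top, ENNReal.toReal_ofReal hS0] at key'
  rw [cqEntropy, ← EReal.coe_ennreal_toReal e4, ← EReal.coe_ennreal_toReal e3, ← EReal.coe_sub,
    EReal.coe_eq_coe_iff]
  linarith

end CqEntropy

/-! ### The integral conditional Fisher information -/

section FisherInfo

variable {n : ℕ} {t : ℝ} {M : Type*} [NormedAddCommGroup M] [InnerProductSpace ℂ M]
  [CompleteSpace M] {ρ : HilbertTensor (Mode n) M →L[ℂ] HilbertTensor (Mode n) M}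

lemma traceFst_smul {E F : Type*} [NormedAddCommGroup E] [InnerProductSpace ℂ E] [CompleteSpace E]
    [NormedAddCommGroup F] [InnerProductSpace ℂ F] [CompleteSpace F] (c : ℝ)
    (ρ : HilbertTensor E F →L[ℂ] HilbertTensor E F) : traceFst (c • ρ) = c • traceFst ρ := by
  rw [traceFst, traceFst, ← tsum_const_smul'']
  refine tsum_congr fun i => ?_
  ext v
  simp

lemma condEntropy_heat (ht : 0 ≤ t) (hρ : IsState ρ) (hM : entropy (traceFst ρ) ≠ ∞)
    (hS : entropy (heat t ρ) ≠ ∞) : condEntropy (heat t ρ) =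
      ((entropy (heat t ρ)).toReal - (entropy (traceFst ρ)).toReal : ℝ) := by
  rw [condEntropy, traceFst_heat ht hρ, ← EReal.coe_ennreal_toReal hM,
    ← EReal.coe_ennreal_toReal hS, ← EReal.coe_sub]

/-- The Gaussian displacement channel turns the conditional mutual information into the increment
of the entropy: the differential entropies of `X` cancel. -/
lemma integralFisherInfo_eq (ht : 0 < t) (hρ : IsState ρ) (hM : entropy (traceFst ρ) ≠ ∞)
    (h0 : entropy ρ ≠ ∞) (hS : entropy (heat t ρ) ≠ ∞) :
    integralFisherInfo ρ t = ((entropy (heat t ρ)).toReal - (entropy ρ).toReal : ℝ) := by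
  have hm := (continuous_gaussianDensity (n := n) (t := t)).measurable
  have h1 : ∫⁻ x, ENNReal.ofReal (gaussianDensity n t x) = 1 := by
    have := isProbabilityMeasure_gaussianMeasure (n := n) ht
    have h := lintegral_gaussianMeasure (n := n) (t := t) fun _ => 1
    simpa using h.symm
  have hint : ∫ x, displacedEnsemble ρ t x = heat t ρ := by
    rw [heat, if_pos ht]; rfl
  -- the entropies of the classical-quantum states of `A M X` and of `M X`
  have c1 : cqEntropy (displacedEnsemble ρ t) = ((∫ x, Real.negMulLog (gaussianDensity n t x)) +
      (entropy ρ).toReal : ℝ) := by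
    refine cqEntropy_smul hm (gaussianDensity_nonneg ht) h1
      (integrable_negMulLog_gaussianDensity ht) (τ := displace ρ) (fun x => ?_)
      ENNReal.toReal_nonneg fun x => ?_
    · rw [displace_eq_conjBy]; exact hρ.conjBy
    · rw [displace_eq_conjBy, entropy_conjBy hρ, ENNReal.ofReal_toReal h0]
  have c2 : cqEntropy (fun x => traceFst (displacedEnsemble ρ t x)) =
      ((∫ x, Real.negMulLog (gaussianDensity n t x)) + (entropy (traceFst ρ)).toReal : ℝ) := by
    simp_rw [displacedEnsemble, traceFst_smul, displace_eq_conjBy, traceFst_conjBy hρ]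
    exact cqEntropy_smul hm (gaussianDensity_nonneg ht) h1
      (integrable_negMulLog_gaussianDensity ht) (fun x => traceFst_isState hρ)
      ENNReal.toReal_nonneg fun x => (ENNReal.ofReal_toReal hM).symm
  rw [integralFisherInfo, if_pos ht, condMutualInfo, hint, c1, c2, condEntropy_heat ht.le hρ hM hS,
    traceFst_heat ht.le hρ, ← EReal.coe_ennreal_toReal hM, ← EReal.coe_sub, ← EReal.coe_sub,
    ← EReal.coe_add, ← EReal.coe_sub, EReal.coe_eq_coe_iff]
  ring

end FisherInfo

/-! ### Fourier integrals of square-integrable functions -/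

section Fourier

variable {n : ℕ}

lemma lintegral_enorm_sq_eq (ψ : Mode n) : ∫⁻ y, ‖ψ y‖ₑ ^ 2 = ‖ψ‖ₑ ^ 2 := by
  rw [Lp.enorm_def, eLpNorm_eq_lintegral_rpow_enorm_toReal (by simp) (by simp),
    ← ENNReal.rpow_natCast, ← ENNReal.rpow_mul]
  simp

/-- On integrable functions, the Fourier transform of `L²` is given by the Fourier integral: both
have the same pairing with every test function. -/
lemma fourier_toLp_ae {h : Config n → ℂ} (h1 : Integrable h) (h2 : MemLp h 2 volume) :
    ((𝓕 h2.toLp : Mode n) : Config n → ℂ) =ᵐ[volume] 𝓕 h := by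
  have hloc : LocallyIntegrable ((𝓕 h2.toLp : Mode n) : Config n → ℂ) volume :=
    (Lp.memLp _).locallyIntegrable (by norm_num)
  have hcont : Continuous (𝓕 h) :=
    VectorFourier.fourierIntegral_continuous Real.continuous_fourierChar
      (L := innerₗ (Config n)) continuous_inner h1
  refine ae_eq_of_integral_contDiff_smul_eq hloc hcont.locallyIntegrable fun g hg hgs => ?_
  have hg1 : HasCompactSupport (fun x => (g x : ℂ)) := hgs.comp_left Complex.ofReal_zero
  have hg2 : ContDiff ℝ ((⊤ : ℕ∞) : WithTop ℕ∞) (fun x => (g x : ℂ)) := Complex.ofRealCLM.contDiff.comp hg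
  let G : SchwartzMap (Config n) ℂ := hg1.toSchwartzMap hg2
  have e1 := congrArg (fun T => T G) (Lp.fourier_toTemperedDistribution_eq (h2.toLp : Mode n))
  simp only [TemperedDistribution.fourier_apply, Lp.toTemperedDistribution_apply] at e1
  have e2 : ∫ x, (𝓕 G : SchwartzMap (Config n) ℂ) x • (h2.toLp : Mode n) x =
      ∫ x, (𝓕 (G : Config n → ℂ)) x • h x := by
    refine integral_congr_ae ?_
    filter_upwards [h2.coeFn_toLp] with x hx
    rw [hx, SchwartzMap.fourier_coe]
  have e3 := VectorFourier.integral_fourierIntegral_smul_eq_flip (L := innerₗ (Config n))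
    Real.continuous_fourierChar continuous_inner (G.integrable (μ := volume)) h1
  rw [e2] at e1
  have e4 : ∀ x, g x • (𝓕 h2.toLp : Mode n) x = G x • (𝓕 h2.toLp : Mode n) x := fun x => rfl
  have e5 : ∀ x, g x • 𝓕 h x = G x • 𝓕 h x := fun x => rfl
  simp_rw [e4, e5]
  rw [← e1]
  refine e3.trans ?_
  rw [flip_innerₗ]
  rfl

/-- Plancherel's theorem for Fourier integrals. -/
lemma lintegral_enorm_sq_fourier {h : Config n → ℂ} (h1 : Integrable h)
    (h2 : MemLp h 2 volume) : ∫⁻ ξ, ‖𝓕 h ξ‖ₑ ^ 2 = ∫⁻ y, ‖h y‖ₑ ^ 2 := by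
  have e1 : ∫⁻ ξ, ‖𝓕 h ξ‖ₑ ^ 2 = ∫⁻ ξ, ‖(𝓕 h2.toLp : Mode n) ξ‖ₑ ^ 2 := by
    refine lintegral_congr_ae ?_
    filter_upwards [fourier_toLp_ae h1 h2] with ξ hξ
    rw [hξ]
  have e2 : ∫⁻ y, ‖h y‖ₑ ^ 2 = ∫⁻ y, ‖(h2.toLp : Mode n) y‖ₑ ^ 2 := by
    refine lintegral_congr_ae ?_
    filter_upwards [h2.coeFn_toLp] with ξ hξ
    rw [hξ]
  rw [e1, e2, lintegral_enorm_sq_eq, lintegral_enorm_sq_eq, ← ofReal_norm, ← ofReal_norm,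
    Lp.norm_fourier_eq]

end Fourier

/-! ### Coherent states and the short-time Fourier transform -/

section Gabor

variable {n : ℕ}

/-- The Gaussian `exp(-π |y|²)`, which is its own Fourier transform: up to normalization,
a coherent state. -/
def gaussianWave (y : Config n) : ℝ := Real.exp (-Real.pi * ‖y‖ ^ 2)

lemma continuous_gaussianWave : Continuous (gaussianWave (n := n)) := by
  unfold gaussianWave
  fun_prop

lemma gaussianWave_nonneg (y : Config n) : 0 ≤ gaussianWave y := (Real.exp_pos _).le

lemma gaussianWave_le_one (y : Config n) : gaussianWave y ≤ 1 := by
  rw [gaussianWave, Real.exp_le_one_iff]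
  have := Real.pi_pos
  have : 0 ≤ Real.pi * ‖y‖ ^ 2 := by positivity
  linarith

lemma memLp_gaussianWave : MemLp (fun y : Config n => (gaussianWave y : ℂ)) 2 volume := by
  have hc : Continuous fun y : Config n => (gaussianWave y : ℂ) :=
    Complex.continuous_ofReal.comp continuous_gaussianWave
  rw [memLp_two_iff_integrable_sq_norm hc.aestronglyMeasurable]
  refine (integrable_exp_neg_mul_sq_norm (V := Config n) (b := 2 * Real.pi)
    (by positivity)).congr (ae_of_all _ fun y => ?_)
  show Real.exp (-(2 * Real.pi) * ‖y‖ ^ 2) = ‖(gaussianWave y : ℂ)‖ ^ 2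
  rw [Complex.norm_real, Real.norm_of_nonneg (gaussianWave_nonneg y), gaussianWave,
    ← Real.exp_nat_mul]
  congr 1
  push_cast
  ring

/-- The Gaussian wave function as a vector of the space of the modes. -/
def coherent (n : ℕ) : Mode n := memLp_gaussianWave.toLp

lemma coherent_ae : (coherent n : Config n → ℂ) =ᵐ[volume] fun y => (gaussianWave y : ℂ) :=
  memLp_gaussianWave.coeFn_toLp

/-- The window `y ↦ exp(-π |y - a|²) ψ(y)` at `a`. -/
def windowed (ψ : Mode n) (a y : Config n) : ℂ := (gaussianWave (y - a) : ℂ) * ψ y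

lemma memLp_windowed (ψ : Mode n) (a : Config n) : MemLp (windowed ψ a) 2 volume := by
  have hc : Continuous fun y : Config n => (gaussianWave (y - a) : ℂ) :=
    Complex.continuous_ofReal.comp (continuous_gaussianWave.comp (continuous_sub_right a))
  refine (Lp.memLp ψ).of_le (hc.aestronglyMeasurable.mul (Lp.aestronglyMeasurable ψ))
    (ae_of_all _ fun y => ?_)
  rw [windowed, norm_mul, Complex.norm_real, Real.norm_of_nonneg (gaussianWave_nonneg _)]
  exact mul_le_of_le_one_left (norm_nonneg _) (gaussianWave_le_one _)

lemma integrable_windowed (ψ : Mode n) (a : Config n) : Integrable (windowed ψ a) :=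
  (memLp_gaussianWave.comp_measurePreserving
    (measurePreserving_sub_right volume a)).integrable_mul (Lp.memLp ψ)

/-- The modulus of the overlap with a coherent state is the modulus of a short-time Fourier
transform. -/
lemma enorm_inner_displacement (x : PhaseSpace n) (ψ : Mode n) :
    ‖⟪displacement x (coherent n), ψ⟫_ℂ‖ₑ =
      ‖𝓕 (windowed ψ (position x)) ((2 * Real.pi)⁻¹ • momentum x)‖ₑ := by
  have e1 : ⟪displacement x (coherent n), ψ⟫_ℂ =
      Complex.exp ((⟪momentum x, position x⟫_ℝ / 2 : ℝ) * Complex.I) *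
        𝓕 (windowed ψ (position x)) ((2 * Real.pi)⁻¹ • momentum x) := by
    rw [L2.inner_def, Real.fourier_eq', ← integral_const_mul]
    refine integral_congr_ae ?_
    filter_upwards [displacement_apply_ae x (coherent n),
      (measurePreserving_sub_right (volume : Measure (Config n))
        (position x)).quasiMeasurePreserving.ae_eq_comp coherent_ae] with y h1 h2
    simp only [Function.comp_apply] at h2
    rw [RCLike.inner_apply, h1, h2, windowed, map_mul, Complex.conj_ofReal, ← Complex.exp_conj,
      map_mul, Complex.conj_ofReal, Complex.conj_I, smul_eq_mul, inner_smul_right,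
      real_inner_comm (momentum x) y]
    rw [← mul_assoc (Complex.exp _) (Complex.exp _), ← Complex.exp_add]
    have e2 : ((⟪momentum x, position x⟫_ℝ / 2 : ℝ) : ℂ) * Complex.I +
        ((-2 * Real.pi * ((2 * Real.pi)⁻¹ * ⟪momentum x, y⟫_ℝ) : ℝ) : ℂ) * Complex.I =
        ((⟪momentum x, y⟫_ℝ - ⟪momentum x, position x⟫_ℝ / 2 : ℝ) : ℂ) * -Complex.I := by
      have : (Real.pi : ℂ) ≠ 0 := by exact_mod_cast Real.pi_ne_zero
      push_cast
      field_simp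
      ring
    rw [e2]
    ring
  rw [e1, enorm_mul, ← ofReal_norm (Complex.exp _), Complex.norm_exp_ofReal_mul_I,
    ENNReal.ofReal_one, one_mul]

lemma integrable_gaussianWave : Integrable fun y : Config n => (gaussianWave y : ℂ) :=
  (integrable_exp_neg_mul_sq_norm (V := Config n) Real.pi_pos).ofReal

/-- The Fourier transform exchanges the roles of the positions and of the momenta. -/
lemma fourier_displacement_coherent_ae (x : PhaseSpace n) :
    ((𝓕 (displacement x (coherent n)) : Mode n) : Config n → ℂ) =ᵐ[volume] fun ξ =>
      Complex.exp ((⟪momentum x, position x⟫_ℝ / 2 - 2 * Real.pi * ⟪ξ, position x⟫_ℝ : ℝ) *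
        Complex.I) * gaussianWave (ξ - (2 * Real.pi)⁻¹ • momentum x) := by
  let f : Config n → ℂ := fun y => displacementPhase x y * gaussianWave (y - position x)
  have hf : (displacement x (coherent n) : Config n → ℂ) =ᵐ[volume] f := by
    filter_upwards [displacement_apply_ae x (coherent n),
      (measurePreserving_sub_right (volume : Measure (Config n))
        (position x)).quasiMeasurePreserving.ae_eq_comp coherent_ae] with y h1 h2
    simp only [Function.comp_apply] at h2
    rw [h1, h2]
    rfl
  have hf2 : MemLp f 2 volume := (memLp_congr_ae hf).1 (Lp.memLp _)
  have hf1 : Integrable f := by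
    refine (integrable_gaussianWave.comp_sub_right (position x)).mono hf2.aestronglyMeasurable
      (ae_of_all _ fun y => ?_)
    rw [norm_mul, norm_displacementPhase, one_mul]
  have hfL : displacement x (coherent n) = hf2.toLp := Lp.ext (hf.trans hf2.coeFn_toLp.symm)
  rw [hfL]
  filter_upwards [fourier_toLp_ae hf1 hf2] with ξ hξ
  rw [hξ, Real.fourier_eq', ← integral_add_right_eq_self _ (position x)]
  have hpi : (Real.pi : ℂ) ≠ 0 := by exact_mod_cast Real.pi_ne_zero
  have hG := fourier_gaussian_innerProductSpace' (b := Real.pi)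
    (by simpa using Real.pi_pos) ((2 * Real.pi)⁻¹ • momentum x) ξ
  rw [Real.fourier_eq', div_self hpi, Complex.one_cpow, one_mul] at hG
  have e1 : ∀ y : Config n,
      Complex.exp (((-2 * Real.pi * ⟪y + position x, ξ⟫_ℝ : ℝ) : ℂ) * Complex.I) •
        f (y + position x) =
      Complex.exp ((⟪momentum x, position x⟫_ℝ / 2 - 2 * Real.pi * ⟪ξ, position x⟫_ℝ : ℝ) *
        Complex.I) * (Complex.exp (((-2 * Real.pi * ⟪y, ξ⟫_ℝ : ℝ) : ℂ) * Complex.I) •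
          Complex.exp (-(Real.pi : ℂ) * ‖y‖ ^ 2 + 2 * Real.pi * Complex.I *
            ⟪(2 * Real.pi)⁻¹ • momentum x, y⟫_ℝ)) := by
    intro y
    simp only [f, displacementPhase, gaussianWave, add_sub_cancel_right, smul_eq_mul,
      Complex.ofReal_exp, ← Complex.exp_add]
    congr 1
    rw [real_inner_smul_left, inner_add_left, inner_add_right, real_inner_comm ξ (position x)]
    push_cast
    field_simp
    ring
  simp_rw [e1]
  rw [integral_const_mul, hG]
  congr 1
  rw [gaussianWave, Complex.ofReal_exp, norm_sub_rev]
  congr 1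
  push_cast
  field_simp

/-- The overlap with a coherent state in terms of the Fourier transform of the wave function. -/
lemma enorm_inner_displacement_fourier (x : PhaseSpace n) (ψ : Mode n) :
    ‖⟪displacement x (coherent n), ψ⟫_ℂ‖ₑ =
      ‖𝓕 (windowed (𝓕 ψ) ((2 * Real.pi)⁻¹ • momentum x)) (-position x)‖ₑ := by
  have e1 : ⟪displacement x (coherent n), ψ⟫_ℂ =
      Complex.exp ((-(⟪momentum x, position x⟫_ℝ / 2) : ℝ) * Complex.I) *
        𝓕 (windowed (𝓕 ψ) ((2 * Real.pi)⁻¹ • momentum x)) (-position x) := by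
    rw [← Lp.inner_fourier_eq, L2.inner_def, Real.fourier_eq', ← integral_const_mul]
    refine integral_congr_ae ?_
    filter_upwards [fourier_displacement_coherent_ae x] with ξ h1
    rw [RCLike.inner_apply, h1, windowed, map_mul, Complex.conj_ofReal, ← Complex.exp_conj,
      map_mul, Complex.conj_ofReal, Complex.conj_I, smul_eq_mul, inner_neg_right,
      ← mul_assoc (Complex.exp _) (Complex.exp _), ← Complex.exp_add]
    have e2 : ((-(⟪momentum x, position x⟫_ℝ / 2) : ℝ) : ℂ) * Complex.I +
        ((-2 * Real.pi * -⟪ξ, position x⟫_ℝ : ℝ) : ℂ) * Complex.I =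
        ((⟪momentum x, position x⟫_ℝ / 2 - 2 * Real.pi * ⟪ξ, position x⟫_ℝ : ℝ) : ℂ) *
          -Complex.I := by
      push_cast
      ring
    rw [e2]
    ring
  rw [e1, enorm_mul, ← ofReal_norm (Complex.exp _), Complex.norm_exp_ofReal_mul_I,
    ENNReal.ofReal_one, one_mul]

end Gabor

/-! ### Moyal's identity and second moments -/

section Moyal

variable {n : ℕ}

/-- The mass `∫ exp(-2π |y|²) dy` of the window. -/
def windowMass (n : ℕ) : ℝ≥0∞ := ∫⁻ y : Config n, ENNReal.ofReal (gaussianWave y) ^ 2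

/-- The second moment `∫ |y|² exp(-2π |y|²) dy` of the window. -/
def windowMoment (n : ℕ) : ℝ≥0∞ :=
  ∫⁻ y : Config n, ‖y‖ₑ ^ 2 * ENNReal.ofReal (gaussianWave y) ^ 2

lemma ofReal_gaussianWave_sq (y : Config n) :
    ENNReal.ofReal (gaussianWave y) ^ 2 = ENNReal.ofReal (Real.exp (-(2 * Real.pi) * ‖y‖ ^ 2)) := by
  rw [← ENNReal.ofReal_pow (gaussianWave_nonneg y), gaussianWave, ← Real.exp_nat_mul]
  congr 2
  push_cast
  ring

lemma windowMass_ne_top : windowMass n ≠ ∞ := by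
  simp_rw [windowMass, ofReal_gaussianWave_sq]
  exact (integrable_exp_neg_mul_sq_norm (V := Config n) (by positivity)).lintegral_lt_top.ne

lemma windowMass_ne_zero : windowMass n ≠ 0 := by
  have hc : Continuous fun y : Config n => ENNReal.ofReal (gaussianWave y) ^ 2 :=
    (ENNReal.continuous_pow 2).comp (ENNReal.continuous_ofReal.comp continuous_gaussianWave)
  rw [windowMass, Ne, lintegral_eq_zero_iff hc.measurable, hc.ae_eq_iff_eq _ continuous_zero]
  intro h
  have h0 := congrFun h 0
  simp [gaussianWave] at h0

lemma windowMoment_ne_top : windowMoment n ≠ ∞ := by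
  refine ne_top_of_le_ne_top (integrable_sq_norm_mul_exp (V := Config n) (b := 2 * Real.pi)
    (by positivity)).lintegral_lt_top.ne (lintegral_mono fun y => ?_)
  rw [ofReal_gaussianWave_sq, ENNReal.ofReal_mul (by positivity), ENNReal.ofReal_pow (norm_nonneg _),
    ofReal_norm]

lemma enorm_windowed (ψ : Mode n) (a y : Config n) :
    ‖windowed ψ a y‖ₑ ^ 2 = ENNReal.ofReal (gaussianWave (y - a)) ^ 2 * ‖ψ y‖ₑ ^ 2 := by
  rw [windowed, enorm_mul, mul_pow, ← ofReal_norm, Complex.norm_real,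
    Real.norm_of_nonneg (gaussianWave_nonneg _)]

/-- Plancherel's theorem for the short-time Fourier transform, with a weight in the position of the
window. -/
lemma lintegral_gabor (ψ : Mode n) {W : Config n → ℝ≥0∞} (hW : Measurable W) :
    ∫⁻ a, W a * ∫⁻ b, ‖𝓕 (windowed ψ a) b‖ₑ ^ 2 =
      ∫⁻ y, (∫⁻ a, W a * ENNReal.ofReal (gaussianWave (y - a)) ^ 2) * ‖ψ y‖ₑ ^ 2 := by
  have hG := (continuous_gaussianWave (n := n)).measurable
  have hψ := (Lp.stronglyMeasurable ψ).measurable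
  have e1 : ∀ a, W a * ∫⁻ b, ‖𝓕 (windowed ψ a) b‖ₑ ^ 2 =
      ∫⁻ y, W a * (ENNReal.ofReal (gaussianWave (y - a)) ^ 2 * ‖ψ y‖ₑ ^ 2) := fun a => by
    rw [lintegral_enorm_sq_fourier (integrable_windowed ψ a) (memLp_windowed ψ a),
      lintegral_const_mul _ (by fun_prop)]
    simp_rw [enorm_windowed]
  simp_rw [e1]
  rw [lintegral_lintegral_swap (by fun_prop)]
  refine lintegral_congr fun y => ?_
  rw [← lintegral_mul_const _ (by fun_prop)]
  simp_rw [mul_assoc]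

/-- The short-time Fourier transform is isometric up to a constant. -/
lemma lintegral_gabor_one (ψ : Mode n) :
    ∫⁻ a, ∫⁻ b, ‖𝓕 (windowed ψ a) b‖ₑ ^ 2 = windowMass n * ‖ψ‖ₑ ^ 2 := by
  have h := lintegral_gabor ψ (W := fun _ => 1) measurable_const
  simp only [one_mul] at h
  have e1 : ∀ y : Config n, ∫⁻ a, ENNReal.ofReal (gaussianWave (y - a)) ^ 2 = windowMass n :=
    fun y => lintegral_sub_left_eq_self (fun a => ENNReal.ofReal (gaussianWave a) ^ 2) y
  rw [h]
  simp_rw [e1]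
  rw [lintegral_const_mul' _ _ windowMass_ne_top, lintegral_enorm_sq_eq]

lemma enorm_sq_le_two_mul {V : Type*} [NormedAddCommGroup V] (a y : V) :
    ‖a‖ₑ ^ 2 ≤ 2 * ‖y‖ₑ ^ 2 + 2 * ‖y - a‖ₑ ^ 2 := by
  have h : ‖a‖ ^ 2 ≤ 2 * ‖y‖ ^ 2 + 2 * ‖y - a‖ ^ 2 := by
    have h1 : ‖a‖ ≤ ‖y‖ + ‖y - a‖ := by
      have := norm_sub_le y (y - a)
      rwa [sub_sub_cancel] at this
    calc ‖a‖ ^ 2 ≤ (‖y‖ + ‖y - a‖) ^ 2 := by gcongr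
      _ ≤ 2 * ‖y‖ ^ 2 + 2 * ‖y - a‖ ^ 2 := by nlinarith [sq_nonneg (‖y‖ - ‖y - a‖)]
  simp only [← ofReal_norm]
  have h2 := ENNReal.ofReal_le_ofReal h
  rw [ENNReal.ofReal_add (by positivity) (by positivity), ENNReal.ofReal_mul (by norm_num),
    ENNReal.ofReal_mul (by norm_num), ENNReal.ofReal_pow (norm_nonneg _),
    ENNReal.ofReal_pow (norm_nonneg _), ENNReal.ofReal_pow (norm_nonneg _)] at h2
  simpa using h2

/-- The second moment in the position of the window, by `|a|² ≤ 2 |y|² + 2 |y - a|²`. -/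
lemma lintegral_gabor_sq_le (ψ : Mode n) :
    ∫⁻ a, ‖a‖ₑ ^ 2 * ∫⁻ b, ‖𝓕 (windowed ψ a) b‖ₑ ^ 2 ≤
      2 * windowMass n * (∫⁻ y, ‖y‖ₑ ^ 2 * ‖ψ y‖ₑ ^ 2) + 2 * windowMoment n * ‖ψ‖ₑ ^ 2 := by
  have hG := (continuous_gaussianWave (n := n)).measurable
  have hψ := (Lp.stronglyMeasurable ψ).measurable
  have e1 : ∀ y : Config n, ∫⁻ a, ‖a‖ₑ ^ 2 * ENNReal.ofReal (gaussianWave (y - a)) ^ 2 ≤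
      2 * windowMass n * ‖y‖ₑ ^ 2 + 2 * windowMoment n := fun y => by
    calc ∫⁻ a, ‖a‖ₑ ^ 2 * ENNReal.ofReal (gaussianWave (y - a)) ^ 2
        ≤ ∫⁻ a, (2 * ‖y‖ₑ ^ 2 * ENNReal.ofReal (gaussianWave (y - a)) ^ 2 +
            2 * (‖y - a‖ₑ ^ 2 * ENNReal.ofReal (gaussianWave (y - a)) ^ 2)) := by
          refine lintegral_mono fun a => ?_
          rw [← mul_assoc, ← add_mul]
          gcongr
          exact enorm_sq_le_two_mul a y
      _ = 2 * windowMass n * ‖y‖ₑ ^ 2 + 2 * windowMoment n := by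
          rw [lintegral_add_left (by fun_prop), lintegral_const_mul _ (by fun_prop),
            lintegral_const_mul _ (by fun_prop),
            lintegral_sub_left_eq_self (fun a => ENNReal.ofReal (gaussianWave a) ^ 2) y,
            lintegral_sub_left_eq_self
              (fun a => ‖a‖ₑ ^ 2 * ENNReal.ofReal (gaussianWave a) ^ 2) y,
            ← windowMass, ← windowMoment]
          ring
  rw [lintegral_gabor ψ (by fun_prop)]
  calc _ ≤ ∫⁻ y, (2 * windowMass n * (‖y‖ₑ ^ 2 * ‖ψ y‖ₑ ^ 2) +
        2 * windowMoment n * ‖ψ y‖ₑ ^ 2) := by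
        refine lintegral_mono fun y => ?_
        rw [← mul_assoc, ← add_mul]
        gcongr
        exact e1 y
    _ = _ := by
        rw [lintegral_add_left (by fun_prop), lintegral_const_mul _ (by fun_prop),
          lintegral_const_mul _ (by fun_prop), lintegral_enorm_sq_eq]

/-- The coordinates `(q, p / 2π)` of the phase space. -/
def phaseCoordinates (n : ℕ) : PhaseSpace n ≃L[ℝ] Config n × Config n :=
  LinearEquiv.toContinuousLinearEquiv
    { toFun := fun x => (position x, (2 * Real.pi)⁻¹ • momentum x)
      invFun := fun z => WithLp.toLp 2 fun i => if i.2 = 0 then z.1 i.1 else 2 * Real.pi * z.2 i.1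
      map_add' := fun x y => by rw [position_add, momentum_add, smul_add]; rfl
      map_smul' := fun c x => by
        have h1 : position (c • x) = c • position x := rfl
        have h2 : momentum (c • x) = c • momentum x := rfl
        rw [h1, h2, smul_comm]
        rfl
      left_inv := fun x => by
        have := Real.pi_ne_zero
        ext ⟨k, j⟩
        fin_cases j
        · simp [position]
        · simp [momentum]
          field_simp
      right_inv := fun z => by
        have := Real.pi_ne_zero
        ext k
        · simp [position]
        · simp [momentum]
          field_simp }

lemma phaseCoordinates_apply (x : PhaseSpace n) :
    phaseCoordinates n x = (position x, (2 * Real.pi)⁻¹ • momentum x) := rfl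

/-- The change of variables from the phase space to pairs of configurations. Uniqueness of Haar
measure provides the constant, whose value does not matter. -/
lemma exists_lintegral_phaseSpace (n : ℕ) : ∃ c : ℝ≥0∞, c ≠ 0 ∧ c ≠ ∞ ∧
    ∀ F : Config n → Config n → ℝ≥0∞, Measurable (Function.uncurry F) →
      ∫⁻ x : PhaseSpace n, F (position x) ((2 * Real.pi)⁻¹ • momentum x) =
        c * ∫⁻ a, ∫⁻ b, F a b := by
  let e := phaseCoordinates n
  let ν : Measure (Config n × Config n) := volume.prod volume
  have hm : (volume.map e : Measure (Config n × Config n)).IsAddHaarMeasure :=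
    e.isAddHaarMeasure_map _
  refine ⟨Measure.addHaarScalarFactor (volume.map e) ν, ?_, ENNReal.coe_ne_top, fun F hF => ?_⟩
  · exact_mod_cast (Measure.addHaarScalarFactor_pos_of_isAddHaarMeasure _ _).ne'
  · have h1 := Measure.isAddLeftInvariant_eq_smul (volume.map e) ν
    have h2 := lintegral_map (μ := volume) hF e.continuous.measurable
    rw [h1, lintegral_smul_measure, lintegral_prod _ hF.aemeasurable] at h2
    exact h2.symm

lemma continuous_inner_displacement (ψ : Mode n) :
    Continuous fun x : PhaseSpace n => ‖⟪displacement x (coherent n), ψ⟫_ℂ‖ₑ ^ 2 :=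
  (ENNReal.continuous_pow 2).comp
    (Continuous.inner (continuous_displacement _) continuous_const).enorm

/-- The modulus of the short-time Fourier transform inherits its continuity from the strong continuity
of the displacement operators. -/
lemma continuous_gabor (ψ : Mode n) :
    Continuous fun z : Config n × Config n => ‖𝓕 (windowed ψ z.1) z.2‖ₑ ^ 2 := by
  refine ((continuous_inner_displacement ψ).comp (phaseCoordinates n).symm.continuous).congr
    fun z => ?_
  have h := (phaseCoordinates n).apply_symm_apply z
  rw [phaseCoordinates_apply, Prod.ext_iff] at h
  have h1 : position ((phaseCoordinates n).symm z) = z.1 := h.1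
  have h2 : (2 * Real.pi)⁻¹ • momentum ((phaseCoordinates n).symm z) = z.2 := h.2
  rw [Function.comp_apply, enorm_inner_displacement, h1, h2]

lemma enorm_sq_eq_position_add (x : PhaseSpace n) :
    ‖x‖ₑ ^ 2 = ‖position x‖ₑ ^ 2 + ‖momentum x‖ₑ ^ 2 := by
  have h : ‖x‖ ^ 2 = ‖position x‖ ^ 2 + ‖momentum x‖ ^ 2 := by
    rw [EuclideanSpace.norm_sq_eq, EuclideanSpace.norm_sq_eq, EuclideanSpace.norm_sq_eq,
      Fintype.sum_prod_type, ← Finset.sum_add_distrib]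
    refine Finset.sum_congr rfl fun k _ => ?_
    rw [Fin.sum_univ_two]
    rfl
  simp only [← ofReal_norm, ← ENNReal.ofReal_pow (norm_nonneg _)]
  rw [h, ENNReal.ofReal_add (by positivity) (by positivity)]

lemma enorm_sq_momentum (x : PhaseSpace n) : ‖momentum x‖ₑ ^ 2 =
    ENNReal.ofReal (2 * Real.pi) ^ 2 * ‖(2 * Real.pi)⁻¹ • momentum x‖ₑ ^ 2 := by
  have h0 : (0 : ℝ) < 2 * Real.pi := by positivity
  rw [enorm_smul, ← mul_pow, ← mul_assoc, ← Real.enorm_of_nonneg h0.le, ← enorm_mul,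
    mul_inv_cancel₀ h0.ne', enorm_one, one_mul]

lemma sum_lintegral_coord_eq (φ : Mode n) (c : ℝ) :
    ∑ k : Fin n, ∫⁻ y : Config n, ‖((c * y k : ℝ) : ℂ) * φ y‖ₑ ^ 2 =
      ‖c‖ₑ ^ 2 * ∫⁻ y, ‖y‖ₑ ^ 2 * ‖φ y‖ₑ ^ 2 := by
  have hφ := (Lp.stronglyMeasurable φ).measurable
  rw [← lintegral_finsetSum _ (fun k _ => by fun_prop), ← lintegral_const_mul _ (by fun_prop)]
  refine lintegral_congr fun y => ?_
  have e1 : ∀ k : Fin n, ‖((c * y k : ℝ) : ℂ) * φ y‖ₑ ^ 2 =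
      ‖c‖ₑ ^ 2 * (ENNReal.ofReal (‖y k‖ ^ 2) * ‖φ y‖ₑ ^ 2) := fun k => by
    rw [enorm_mul, mul_pow, ← ofReal_norm ((_ : ℝ) : ℂ), Complex.norm_real, ofReal_norm,
      enorm_mul, mul_pow, mul_assoc, ENNReal.ofReal_pow (norm_nonneg _), ofReal_norm (y k)]
  simp_rw [e1]
  rw [← Finset.mul_sum, ← Finset.sum_mul, ← ENNReal.ofReal_sum_of_nonneg fun k _ => by positivity,
    ← EuclideanSpace.norm_sq_eq, ENNReal.ofReal_pow (norm_nonneg _), ofReal_norm]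

/-- The second moments of position and momentum are controlled by the energy. -/
lemma moments_le_hamiltonianForm (ψ : Mode n) :
    (∫⁻ y, ‖y‖ₑ ^ 2 * ‖ψ y‖ₑ ^ 2) +
      ENNReal.ofReal (2 * Real.pi) ^ 2 * (∫⁻ ξ, ‖ξ‖ₑ ^ 2 * ‖(𝓕 ψ : Mode n) ξ‖ₑ ^ 2) ≤
      2 * hamiltonianForm ψ + n * ‖ψ‖ₑ ^ 2 := by
  have h1 := sum_lintegral_coord_eq ψ 1
  have h2 := sum_lintegral_coord_eq (𝓕 ψ) (2 * Real.pi)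
  simp only [one_mul, enorm_one, one_pow] at h1
  rw [Real.enorm_of_nonneg (by positivity)] at h2
  rw [← h1, ← h2, ← Finset.sum_add_distrib]
  set A : ℝ≥0∞ := ∑ k : Fin n, ((∫⁻ y : Config n, ‖((y k : ℝ) : ℂ) * ψ y‖ₑ ^ 2) +
    ∫⁻ ξ : Config n, ‖((2 * Real.pi * ξ k : ℝ) : ℂ) * (𝓕 ψ : Mode n) ξ‖ₑ ^ 2) with hA
  have h3 : A / 2 ≤ hamiltonianForm ψ + (n : ℝ≥0∞) / 2 * ‖ψ‖ₑ ^ 2 := by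
    -- the vacuum energy is subtracted in `[0, ∞]`; truncation could only enlarge the right side
    rw [hamiltonianForm]
    exact le_tsub_add
  calc A = 2 * (A / 2) := (ENNReal.mul_div_cancel two_ne_zero ENNReal.ofNat_ne_top).symm
    _ ≤ 2 * (hamiltonianForm ψ + (n : ℝ≥0∞) / 2 * ‖ψ‖ₑ ^ 2) := by gcongr
    _ = 2 * hamiltonianForm ψ + n * ‖ψ‖ₑ ^ 2 := by
        rw [mul_add, ← mul_assoc, ENNReal.mul_div_cancel two_ne_zero ENNReal.ofNat_ne_top]

/-- The second moment in the positions of the phase space density of a wave function. -/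
lemma lintegral_position_sq_le {c : ℝ≥0∞}
    (hF : ∀ F : Config n → Config n → ℝ≥0∞, Measurable (Function.uncurry F) →
      ∫⁻ x : PhaseSpace n, F (position x) ((2 * Real.pi)⁻¹ • momentum x) =
        c * ∫⁻ a, ∫⁻ b, F a b) (ψ : Mode n) :
    ∫⁻ x : PhaseSpace n, ‖position x‖ₑ ^ 2 * ‖⟪displacement x (coherent n), ψ⟫_ℂ‖ₑ ^ 2 ≤
      c * (2 * windowMass n * (∫⁻ y, ‖y‖ₑ ^ 2 * ‖ψ y‖ₑ ^ 2) + 2 * windowMoment n * ‖ψ‖ₑ ^ 2) := by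
  have hg := (continuous_gabor ψ).measurable
  have h1 : Measurable fun z : Config n × Config n => ‖z.1‖ₑ ^ 2 :=
    ((ENNReal.continuous_pow 2).comp continuous_fst.enorm).measurable
  simp_rw [enorm_inner_displacement]
  rw [hF (fun a b => ‖a‖ₑ ^ 2 * ‖𝓕 (windowed ψ a) b‖ₑ ^ 2) (h1.fun_mul hg)]
  gcongr
  refine le_trans (le_of_eq (lintegral_congr fun a => ?_)) (lintegral_gabor_sq_le ψ)
  have hb : Measurable fun b => ‖𝓕 (windowed ψ a) b‖ₑ ^ 2 :=
    ((continuous_gabor ψ).comp (Continuous.prodMk_right a)).measurable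
  exact lintegral_const_mul _ hb

/-- The second moment in the momenta of the phase space density of a wave function. -/
lemma lintegral_momentum_sq_le {c : ℝ≥0∞}
    (hF : ∀ F : Config n → Config n → ℝ≥0∞, Measurable (Function.uncurry F) →
      ∫⁻ x : PhaseSpace n, F (position x) ((2 * Real.pi)⁻¹ • momentum x) =
        c * ∫⁻ a, ∫⁻ b, F a b) (ψ : Mode n) :
    ∫⁻ x : PhaseSpace n, ‖momentum x‖ₑ ^ 2 * ‖⟪displacement x (coherent n), ψ⟫_ℂ‖ₑ ^ 2 ≤
      c * (ENNReal.ofReal (2 * Real.pi) ^ 2 *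
        (2 * windowMass n * (∫⁻ y, ‖y‖ₑ ^ 2 * ‖(𝓕 ψ : Mode n) y‖ₑ ^ 2) +
          2 * windowMoment n * ‖ψ‖ₑ ^ 2)) := by
  simp_rw [enorm_inner_displacement_fourier, enorm_sq_momentum]
  set p := ENNReal.ofReal (2 * Real.pi) ^ 2 with hp
  have hp' : p ≠ ∞ := ENNReal.pow_ne_top ENNReal.ofReal_ne_top
  set φ : Mode n := 𝓕 ψ with hφ
  have hg : Measurable fun z : Config n × Config n => ‖𝓕 (windowed φ z.2) (-z.1)‖ₑ ^ 2 :=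
    ((continuous_gabor φ).comp (continuous_snd.prodMk continuous_fst.neg)).measurable
  have h1 : Measurable fun z : Config n × Config n => p * ‖z.2‖ₑ ^ 2 :=
    ((ENNReal.continuous_pow 2).comp continuous_snd.enorm).measurable.const_mul p
  rw [hF (fun a b => p * ‖b‖ₑ ^ 2 * ‖𝓕 (windowed φ b) (-a)‖ₑ ^ 2) (h1.fun_mul hg),
    lintegral_lintegral_swap (h1.fun_mul hg).aemeasurable]
  have hn : ‖φ‖ₑ = ‖ψ‖ₑ := by
    rw [← ofReal_norm, ← ofReal_norm, hφ, Lp.norm_fourier_eq]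
  have h := lintegral_gabor_sq_le φ
  rw [hn] at h
  gcongr
  refine le_trans (le_of_eq ?_) (mul_le_mul_right h p)
  rw [← lintegral_const_mul' _ _ hp']
  refine lintegral_congr fun b => ?_
  have hb : Measurable fun a => ‖𝓕 (windowed φ b) (-a)‖ₑ ^ 2 :=
    ((continuous_gabor φ).comp (continuous_const.prodMk continuous_neg)).measurable
  rw [lintegral_const_mul _ hb, mul_assoc,
    lintegral_neg_eq_self (fun a => ‖𝓕 (windowed φ b) a‖ₑ ^ 2)]

/-- The coherent states form a tight frame (Moyal's identity), and the second moment of the phase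
space density of a wave function is controlled by its energy. -/
lemma exists_moyal (n : ℕ) : ∃ C D : ℝ≥0∞, C ≠ 0 ∧ C ≠ ∞ ∧ D ≠ ∞ ∧
    (∀ ψ : Mode n, ∫⁻ x : PhaseSpace n, ‖⟪displacement x (coherent n), ψ⟫_ℂ‖ₑ ^ 2 =
      C * ‖ψ‖ₑ ^ 2) ∧
    ∀ ψ : Mode n, ∫⁻ x : PhaseSpace n, ‖x‖ₑ ^ 2 * ‖⟪displacement x (coherent n), ψ⟫_ℂ‖ₑ ^ 2 ≤
      D * (hamiltonianForm ψ + ‖ψ‖ₑ ^ 2) := by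
  obtain ⟨c, hc0, hc, hF⟩ := exists_lintegral_phaseSpace n
  set K := windowMass n with hK
  set κ := windowMoment n with hκ
  set p := ENNReal.ofReal (2 * Real.pi) ^ 2 with hp
  have hp' : p ≠ ∞ := ENNReal.pow_ne_top ENNReal.ofReal_ne_top
  have hK' : K ≠ ∞ := windowMass_ne_top
  have hκ' : κ ≠ ∞ := windowMoment_ne_top
  -- `K` and `κ` are the mass and the second moment of the window, and `p = (2π)²`
  refine ⟨c * K, c * (2 * K * (2 + n) + 2 * κ * (1 + p)), mul_ne_zero hc0 windowMass_ne_zero,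
    ENNReal.mul_ne_top hc hK', by finiteness, fun ψ => ?_, fun ψ => ?_⟩
  · simp_rw [enorm_inner_displacement]
    rw [hF (fun a b => ‖𝓕 (windowed ψ a) b‖ₑ ^ 2) (continuous_gabor ψ).measurable,
      lintegral_gabor_one, mul_assoc]
  · have hq := lintegral_position_sq_le hF ψ
    have hp := lintegral_momentum_sq_le hF ψ
    have hsplit : ∫⁻ x : PhaseSpace n,
        ‖x‖ₑ ^ 2 * ‖⟪displacement x (coherent n), ψ⟫_ℂ‖ₑ ^ 2 =
        (∫⁻ x : PhaseSpace n,
          ‖position x‖ₑ ^ 2 * ‖⟪displacement x (coherent n), ψ⟫_ℂ‖ₑ ^ 2) +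
        ∫⁻ x : PhaseSpace n,
          ‖momentum x‖ₑ ^ 2 * ‖⟪displacement x (coherent n), ψ⟫_ℂ‖ₑ ^ 2 := by
      have h1 := (continuous_inner_displacement ψ).measurable
      have h2 : Measurable fun x : PhaseSpace n => ‖position x‖ₑ ^ 2 :=
        ((ENNReal.continuous_pow 2).comp continuous_position.enorm).measurable
      rw [← lintegral_add_left (h2.fun_mul h1)]
      simp_rw [enorm_sq_eq_position_add, add_mul]
    rw [hsplit]
    have hE := moments_le_hamiltonianForm ψ
    set I := ∫⁻ y, ‖y‖ₑ ^ 2 * ‖ψ y‖ₑ ^ 2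
    set J := ∫⁻ y, ‖y‖ₑ ^ 2 * ‖(𝓕 ψ : Mode n) y‖ₑ ^ 2
    set N := ‖ψ‖ₑ ^ 2
    calc _ ≤ c * (2 * K * I + 2 * κ * N) + c * (p * (2 * K * J + 2 * κ * N)) := by gcongr
      _ = c * (2 * K * (I + p * J) + 2 * κ * (1 + p) * N) := by ring
      _ ≤ c * (2 * K * (2 * hamiltonianForm ψ + n * N) + 2 * κ * (1 + p) * N) := by gcongr
      _ = c * (2 * K * 2) * hamiltonianForm ψ + c * (2 * K * n + 2 * κ * (1 + p)) * N := by ring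
      _ ≤ c * (2 * K * (2 + n) + 2 * κ * (1 + p)) * hamiltonianForm ψ +
          c * (2 * K * (2 + n) + 2 * κ * (1 + p)) * N := by
          gcongr
          · exact le_add_right (by gcongr; exact le_self_add)
          · exact le_add_self
      _ = c * (2 * K * (2 + n) + 2 * κ * (1 + p)) * (hamiltonianForm ψ + N) := by ring

end Moyal

/-! ### The frame of coherent states -/

section PosSqrt

variable {H : Type*} [NormedAddCommGroup H] [InnerProductSpace ℂ H] [CompleteSpace H]

/-- The square root of a positive operator, given by the continuous functional calculus. -/
def posSqrt (T : H →L[ℂ] H) : H →L[ℂ] H := CFC.sqrt T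

lemma expect_eq_enorm_posSqrt {T : H →L[ℂ] H} (hT : T.IsPositive) (v : H) :
    expect T v = ‖posSqrt T v‖ₑ ^ 2 := expect_eq_enorm_sqrt hT v

lemma adjoint_posSqrt (T : H →L[ℂ] H) : (posSqrt T).adjoint = posSqrt T :=
  ContinuousLinearMap.isSelfAdjoint_iff_isSymmetric.2 (sqrt_isSymmetric T)

lemma formExpectation_eq (q : H → ℝ≥0∞) (T : H →L[ℂ] H) :
    formExpectation q T = ∑' i, q (posSqrt T (basis H i)) := rfl

end PosSqrt

section Frame

variable {n : ℕ} {M G : Type*} [NormedAddCommGroup M] [InnerProductSpace ℂ M] [CompleteSpace M]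
  [NormedAddCommGroup G] [InnerProductSpace ℂ G] [CompleteSpace G]

/-- The coherent state centered at the point `x` of the phase space. -/
def coherentAt (x : PhaseSpace n) : Mode n := displacement x (coherent n)

lemma continuous_coherentAt : Continuous (coherentAt : PhaseSpace n → Mode n) :=
  continuous_displacement _

lemma enorm_coherentAt (x : PhaseSpace n) : ‖coherentAt x‖ₑ = ‖coherent n‖ₑ := by
  rw [coherentAt, ← ofReal_norm, ← ofReal_norm, LinearIsometry.norm_map]

/-- The Hilbert–Schmidt expansion of a weighted phase space integral. -/
lemma lintegral_mul_enorm_sq_coherentAt {ι : Type*} (g : HilbertBasis ι ℂ G) (T : Mode n →L[ℂ] G)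
    {w : PhaseSpace n → ℝ≥0∞} (hw : Measurable w) :
    ∫⁻ x, w x * ‖T (coherentAt x)‖ₑ ^ 2 =
      ∑' i, ∫⁻ x, w x * ‖⟪coherentAt x, T.adjoint (g i)⟫_ℂ‖ₑ ^ 2 := by
  have hc : ∀ i, Continuous fun x : PhaseSpace n =>
      ‖⟪coherentAt x, T.adjoint (g i)⟫_ℂ‖ₑ ^ 2 := fun i => continuous_inner_displacement _
  have hT : Continuous fun x : PhaseSpace n => ‖T (coherentAt x)‖ₑ ^ 2 :=
    (ENNReal.continuous_pow 2).comp (T.continuous.comp continuous_coherentAt).enorm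
  have hs : ∀ x : PhaseSpace n,
      ∑' i, ‖⟪coherentAt x, T.adjoint (g i)⟫_ℂ‖ₑ ^ 2 = ‖T (coherentAt x)‖ₑ ^ 2 := fun x => by
    rw [← tsum_enorm_inner_sq' g (T (coherentAt x))]
    simp_rw [ContinuousLinearMap.adjoint_inner_right]
  have h := lintegral_tsum_of_continuous (ν := volume.withDensity w) hc fun x => by
    rw [hs]; finiteness
  simp_rw [hs] at h
  rw [lintegral_withDensity_eq_lintegral_mul _ hw hT.measurable] at h
  refine h.trans (tsum_congr fun i => ?_)
  rw [lintegral_withDensity_eq_lintegral_mul _ hw (hc i).measurable]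
  rfl

variable {C D : ℝ≥0∞} (hC : ∀ ψ : Mode n, ∫⁻ x, ‖⟪coherentAt x, ψ⟫_ℂ‖ₑ ^ 2 = C * ‖ψ‖ₑ ^ 2)

include hC in
/-- The coherent states compute Hilbert–Schmidt norms as a Hilbert basis does, up to the constant
of the frame. -/
lemma lintegral_enorm_sq_coherentAt {κ : Type*} (b : HilbertBasis κ ℂ (Mode n))
    (T : Mode n →L[ℂ] G) :
    ∫⁻ x, ‖T (coherentAt x)‖ₑ ^ 2 = C * ∑' k, ‖T (b k)‖ₑ ^ 2 := by
  have h := lintegral_mul_enorm_sq_coherentAt (basis G) T (w := fun _ => 1) measurable_const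
  simp only [one_mul, hC] at h
  rw [h, ENNReal.tsum_mul_left, tsum_enorm_apply_sq_adjoint b (basis G)]

variable {ρ : HilbertTensor (Mode n) M →L[ℂ] HilbertTensor (Mode n) M}

lemma expect_tensorLeft_eq (hρ : IsState ρ) (ψ : Mode n) (m : M) :
    expect ρ (tensorLeft ψ m) = ‖(posSqrt ρ ∘L tensorRight m) ψ‖ₑ ^ 2 :=
  expect_eq_enorm_posSqrt hρ.pos _

lemma continuous_expect_coherentAt (m : M) :
    Continuous fun x : PhaseSpace n => expect ρ (tensorLeft (coherentAt x) m) :=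
  (continuous_expect ρ).comp ((tensorRight m).continuous.comp continuous_coherentAt)

include hC in
/-- The phase space marginal of a state. -/
lemma lintegral_expect_coherentAt (hρ : IsState ρ) (m : M) :
    ∫⁻ x, expect ρ (tensorLeft (coherentAt x) m) = C * expect (traceFst ρ) m := by
  simp_rw [expect_traceFst hρ (basis (Mode n)), expect_tensorLeft_eq hρ]
  exact lintegral_enorm_sq_coherentAt hC _ _

include hC in
/-- The product vectors built from the coherent states and from a Hilbert basis are a tight frame. -/
lemma tsum_lintegral_inner_coherentAt {κ : Type*} (m : HilbertBasis κ ℂ M)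
    (Ψ : HilbertTensor (Mode n) M) :
    ∑' b, ∫⁻ x, ‖⟪Ψ, tensorLeft (coherentAt x) (m b)⟫_ℂ‖ₑ ^ 2 = C * ‖Ψ‖ₑ ^ 2 := by
  have h1 : ∀ b, ∫⁻ x, ‖⟪Ψ, tensorLeft (coherentAt x) (m b)⟫_ℂ‖ₑ ^ 2 =
      C * ∑' i, ‖⟪basis (Mode n) i, (tensorRight (m b)).adjoint Ψ⟫_ℂ‖ₑ ^ 2 := fun b => by
    rw [tsum_enorm_inner_sq, ← hC]
    refine lintegral_congr fun x => ?_
    rw [ContinuousLinearMap.adjoint_inner_right, tensorRight_apply, ← inner_conj_symm,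
      RCLike.enorm_conj]
  simp_rw [h1]
  rw [ENNReal.tsum_mul_left, ← tsum_enorm_inner_sq (productBasis (basis (Mode n)) m) Ψ,
    ENNReal.tsum_prod', ENNReal.tsum_comm]
  simp_rw [productBasis_apply, ContinuousLinearMap.adjoint_inner_right, tensorRight_apply]

variable (hD : ∀ ψ : Mode n, ∫⁻ x : PhaseSpace n, ‖x‖ₑ ^ 2 * ‖⟪coherentAt x, ψ⟫_ℂ‖ₑ ^ 2 ≤
  D * (hamiltonianForm ψ + ‖ψ‖ₑ ^ 2))

include hD in
/-- A state of finite energy has a phase space density with finite second moment. -/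
lemma tsum_lintegral_sq_expect_coherentAt_le (hρ : IsState ρ) {κ : Type*}
    (m : HilbertBasis κ ℂ M) :
    ∑' b, ∫⁻ x : PhaseSpace n, ‖x‖ₑ ^ 2 * expect ρ (tensorLeft (coherentAt x) (m b)) ≤
      D * (meanEnergy (traceSnd ρ) + 1) := by
  have hA := traceSnd_isState hρ
  have hw : Measurable fun x : PhaseSpace n => ‖x‖ₑ ^ 2 := by fun_prop
  calc ∑' b, ∫⁻ x : PhaseSpace n, ‖x‖ₑ ^ 2 * expect ρ (tensorLeft (coherentAt x) (m b))
      ≤ ∫⁻ x : PhaseSpace n, ∑' b, ‖x‖ₑ ^ 2 * expect ρ (tensorLeft (coherentAt x) (m b)) :=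
        tsum_lintegral_le fun b =>
          (hw.fun_mul (continuous_expect_coherentAt (m b)).measurable).aemeasurable
    _ = ∫⁻ x : PhaseSpace n, ‖x‖ₑ ^ 2 * ‖posSqrt (traceSnd ρ) (coherentAt x)‖ₑ ^ 2 := by
        simp_rw [ENNReal.tsum_mul_left, ← expect_traceSnd hρ m, expect_eq_enorm_posSqrt hA.pos]
    _ = ∑' i, ∫⁻ x : PhaseSpace n, ‖x‖ₑ ^ 2 *
          ‖⟪coherentAt x, posSqrt (traceSnd ρ) (basis (Mode n) i)⟫_ℂ‖ₑ ^ 2 := by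
        rw [lintegral_mul_enorm_sq_coherentAt (basis (Mode n)) _ hw, adjoint_posSqrt]
    _ ≤ ∑' i, D * (hamiltonianForm (posSqrt (traceSnd ρ) (basis (Mode n) i)) +
          ‖posSqrt (traceSnd ρ) (basis (Mode n) i)‖ₑ ^ 2) :=
        ENNReal.tsum_le_tsum fun i => hD _
    _ = D * (meanEnergy (traceSnd ρ) + 1) := by
        rw [ENNReal.tsum_mul_left, ENNReal.tsum_add, ← hA.trace_eq_one,
          trace_eq_tsum (basis (Mode n)) hA.pos]
        simp_rw [expect_eq_enorm_posSqrt hA.pos]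
        rw [meanEnergy, formExpectation_eq]

/-- On phase space densities the heat semigroup is a convolution with a Gaussian measure. -/
lemma expect_heat_coherentAt {t : ℝ} (ht : 0 < t) (hρ : IsState ρ) (x : PhaseSpace n) (m : M) :
    expect (heat t ρ) (tensorLeft (coherentAt x) m) =
      ∫⁻ y, expect ρ (tensorLeft (coherentAt (x - y)) m) ∂gaussianMeasure n t := by
  have := isProbabilityMeasure_gaussianMeasure (n := n) ht
  rw [(isMixture_heat ht hρ).expect_eq hρ.pos]
  refine lintegral_congr fun y => ?_
  rw [displacementUnitary_symm_apply, displacementLeft_tensorLeft, coherentAt,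
    displacement_displacement, expect, expect, ← tensorRight_apply, map_smul, map_smul,
    inner_smul_left, inner_smul_right, ← mul_assoc, Complex.conj_mul', norm_weylPhase,
    neg_add_eq_sub]
  simp [coherentAt, tensorRight_apply]

/-- The convolution with a probability measure of finite second moment preserves the finiteness of
second moments. -/
lemma lintegral_sq_conv_le {γ : Measure (PhaseSpace n)} [IsProbabilityMeasure γ]
    {Q : PhaseSpace n → ℝ≥0∞} (hQ : Continuous Q) :
    ∫⁻ x, ‖x‖ₑ ^ 2 * ∫⁻ y, Q (x - y) ∂γ ≤
      2 * (∫⁻ x, ‖x‖ₑ ^ 2 * Q x) + 2 * (∫⁻ y, ‖y‖ₑ ^ 2 ∂γ) * ∫⁻ x, Q x := by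
  have hQm := hQ.measurable
  have e1 : ∀ y : PhaseSpace n, ∫⁻ x, ‖x‖ₑ ^ 2 * Q (x - y) ≤
      2 * (∫⁻ x, ‖x‖ₑ ^ 2 * Q x) + 2 * ‖y‖ₑ ^ 2 * ∫⁻ x, Q x := fun y => by
    calc ∫⁻ x, ‖x‖ₑ ^ 2 * Q (x - y)
        ≤ ∫⁻ x, (2 * (‖x - y‖ₑ ^ 2 * Q (x - y)) + 2 * ‖y‖ₑ ^ 2 * Q (x - y)) := by
          refine lintegral_mono fun x => ?_
          rw [← mul_assoc, ← add_mul]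
          gcongr
          rw [add_comm, enorm_sub_rev]
          exact enorm_sq_le_two_mul x y
      _ = _ := by
          rw [lintegral_add_left (by fun_prop), lintegral_const_mul _ (by fun_prop),
            lintegral_const_mul _ (by fun_prop),
            lintegral_sub_right_eq_self (fun x => ‖x‖ₑ ^ 2 * Q x) y,
            lintegral_sub_right_eq_self Q y]
  have e2 : ∀ x : PhaseSpace n, ‖x‖ₑ ^ 2 * ∫⁻ y, Q (x - y) ∂γ =
      ∫⁻ y, ‖x‖ₑ ^ 2 * Q (x - y) ∂γ := fun x => (lintegral_const_mul _ (by fun_prop)).symm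
  simp_rw [e2]
  rw [lintegral_lintegral_swap (by fun_prop)]
  refine (lintegral_mono e1).trans (le_of_eq ?_)
  rw [lintegral_add_left (by fun_prop), lintegral_const, measure_univ, mul_one,
    lintegral_mul_const _ (by fun_prop), lintegral_const_mul _ (by fun_prop)]

include hC hD in
/-- Along the heat semigroup the phase space density keeps a finite second moment. -/
lemma tsum_lintegral_sq_expect_heat_ne_top (hC' : C ≠ ∞) (hD' : D ≠ ∞) {t : ℝ} (ht : 0 ≤ t)
    (hρ : IsState ρ) (hA : meanEnergy (traceSnd ρ) < ∞) {κ : Type*} (m : HilbertBasis κ ℂ M) :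
    ∑' b, ∫⁻ x : PhaseSpace n,
      ‖x‖ₑ ^ 2 * expect (heat t ρ) (tensorLeft (coherentAt x) (m b)) ≠ ∞ := by
  have h0 : ∑' b, ∫⁻ x : PhaseSpace n,
      ‖x‖ₑ ^ 2 * expect ρ (tensorLeft (coherentAt x) (m b)) ≠ ∞ :=
    ne_top_of_le_ne_top (by finiteness) (tsum_lintegral_sq_expect_coherentAt_le hD hρ m)
  obtain rfl | ht := ht.eq_or_lt
  · rwa [heat_zero]
  have := isProbabilityMeasure_gaussianMeasure (n := n) ht
  have hm := lintegral_sq_enorm_gaussianMeasure_lt_top (n := n) ht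
  simp_rw [expect_heat_coherentAt ht hρ]
  refine ne_top_of_le_ne_top ?_ (ENNReal.tsum_le_tsum fun b =>
    lintegral_sq_conv_le (continuous_expect_coherentAt (m b)))
  simp_rw [lintegral_expect_coherentAt hC hρ]
  rw [ENNReal.tsum_add, ENNReal.tsum_mul_left, ENNReal.tsum_mul_left, ENNReal.tsum_mul_left,
    ← trace_eq_tsum m (traceFst_isPositive hρ), (traceFst_isState hρ).trace_eq_one]
  finiteness

end Frame

/-! ### Klein's inequality and finiteness of the entropy -/

section Klein

/-- The scalar form of Klein's inequality, `-x ln x ≤ -x ln y + y`: the relative entropy of `x` and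
`y` is nonnegative. -/
lemma ofReal_negMulLog_le {x y : ℝ} (hx : 0 ≤ x) (hx1 : x ≤ 1) (hy : 0 ≤ y) (hy1 : y ≤ 1) :
    ENNReal.ofReal (Real.negMulLog x) ≤ ENNReal.ofReal x * negLog y + ENNReal.ofReal y := by
  rw [← scalarRelEntropy_add hx hx1 hy hy1]
  exact le_add_self.trans le_self_add

lemma negLog_exp_mul (a : ℝ) (ha : 0 ≤ a) {y : ℝ} (hy : 0 ≤ y) (hy1 : y ≤ 1) :
    negLog (Real.exp (-a) * y) = ENNReal.ofReal a + negLog y := by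
  obtain rfl | hy := hy.eq_or_lt
  · simp [negLog]
  rw [negLog, negLog, if_neg hy.ne', if_neg (by positivity),
    ← ENNReal.ofReal_add ha (by simpa using Real.log_nonpos hy.le hy1),
    Real.log_mul (Real.exp_pos _).ne' hy.ne', Real.log_exp]
  congr 1
  ring

variable {n : ℕ} {M : Type*} [NormedAddCommGroup M] [InnerProductSpace ℂ M] [CompleteSpace M]
  {ρ : HilbertTensor (Mode n) M →L[ℂ] HilbertTensor (Mode n) M} {C : ℝ≥0∞}

/-- Klein's inequality with respect to the frame of the coherent states: the entropy of a state is
bounded by its cross entropy with the weights `exp(-|x|² / 2) μ`, where `μ` runs through the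
eigenvalues of the marginal. -/
lemma mul_entropy_le
    (hC : ∀ ψ : Mode n, ∫⁻ x, ‖⟪coherentAt x, ψ⟫_ℂ‖ₑ ^ 2 = C * ‖ψ‖ₑ ^ 2)
    (hρ : IsState ρ) {κ : Type*} {m : HilbertBasis κ ℂ M} {mu : κ → ℝ}
    (hm : IsDiag m mu (traceFst ρ)) :
    C * entropy ρ ≤
      (∑' b, ∫⁻ x : PhaseSpace n, ‖x‖ₑ ^ 2 * expect ρ (tensorLeft (coherentAt x) (m b))) +
        C * entropy (traceFst ρ) +
        ‖coherent n‖ₑ ^ 2 * ∫⁻ x : PhaseSpace n, ENNReal.ofReal (Real.exp (-(‖x‖ ^ 2 / 2))) := by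
  obtain ⟨ι, e, lam, he⟩ := hρ.exists_isDiag
  have hM := traceFst_isState hρ
  have hmu := hm.nonneg hM.pos
  have hmu1 := hm.le_one hM
  have hlam := he.nonneg hρ.pos
  have hlam1 := he.le_one hρ
  let v : κ → PhaseSpace n → HilbertTensor (Mode n) M := fun b x => tensorLeft (coherentAt x) (m b)
  have hv : ∀ b, Continuous (v b) := fun b =>
    (tensorRight (m b)).continuous.comp continuous_coherentAt
  have hvi : ∀ b i, Measurable fun x => ‖⟪e i, v b x⟫_ℂ‖ₑ ^ 2 := fun b i =>
    ((ENNReal.continuous_pow 2).comp (continuous_const.inner (hv b)).enorm).measurable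
  have hq : Measurable fun x : PhaseSpace n => ENNReal.ofReal (‖x‖ ^ 2 / 2) := by fun_prop
  have hg : Measurable fun x : PhaseSpace n => ENNReal.ofReal (Real.exp (-(‖x‖ ^ 2 / 2))) := by
    fun_prop
  have hQ : ∀ b x, ∑' i, ENNReal.ofReal (lam i) * ‖⟪e i, v b x⟫_ℂ‖ₑ ^ 2 = expect ρ (v b x) :=
    fun b x => (he.expect_eq_tsum hρ.pos.isSymmetric hlam (v b x)).symm
  have hN : ∀ b x, ∑' i, ‖⟪e i, v b x⟫_ℂ‖ₑ ^ 2 = ‖coherent n‖ₑ ^ 2 := fun b x => by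
    rw [tsum_enorm_inner_sq, enorm_tensorLeft, enorm_coherentAt, enorm_hilbertBasis, mul_one]
  calc C * entropy ρ
      = ∑' i, ∑' b, ∫⁻ x, ENNReal.ofReal (Real.negMulLog (lam i)) * ‖⟪e i, v b x⟫_ℂ‖ₑ ^ 2 := by
        rw [he.entropy_eq hρ, ← ENNReal.tsum_mul_left]
        refine tsum_congr fun i => ?_
        simp_rw [lintegral_const_mul _ (hvi _ i)]
        rw [ENNReal.tsum_mul_left, tsum_lintegral_inner_coherentAt hC, enorm_hilbertBasis]
        ring
    _ ≤ ∑' i, ∑' b, ∫⁻ x, ((ENNReal.ofReal (‖x‖ ^ 2 / 2) + negLog (mu b)) *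
          (ENNReal.ofReal (lam i) * ‖⟪e i, v b x⟫_ℂ‖ₑ ^ 2) +
          ENNReal.ofReal (Real.exp (-(‖x‖ ^ 2 / 2))) * ENNReal.ofReal (mu b) *
            ‖⟪e i, v b x⟫_ℂ‖ₑ ^ 2) := by
        refine ENNReal.tsum_le_tsum fun i => ENNReal.tsum_le_tsum fun b =>
          lintegral_mono fun x => ?_
        have h1 : Real.exp (-(‖x‖ ^ 2 / 2)) ≤ 1 := by
          rw [Real.exp_le_one_iff]
          have := sq_nonneg ‖x‖
          linarith
        have h2 := ofReal_negMulLog_le (hlam i) (hlam1 i)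
          (mul_nonneg (Real.exp_pos (-(‖x‖ ^ 2 / 2))).le (hmu b))
          (mul_le_one₀ h1 (hmu b) (hmu1 b))
        rw [negLog_exp_mul _ (by positivity) (hmu b) (hmu1 b),
          ENNReal.ofReal_mul (Real.exp_pos _).le] at h2
        rw [← mul_assoc, ← add_mul, mul_comm (_ + _) (ENNReal.ofReal (lam i))]
        gcongr
    _ ≤ ∑' b, ∫⁻ x, ∑' i, ((ENNReal.ofReal (‖x‖ ^ 2 / 2) + negLog (mu b)) *
          (ENNReal.ofReal (lam i) * ‖⟪e i, v b x⟫_ℂ‖ₑ ^ 2) +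
          ENNReal.ofReal (Real.exp (-(‖x‖ ^ 2 / 2))) * ENNReal.ofReal (mu b) *
            ‖⟪e i, v b x⟫_ℂ‖ₑ ^ 2) := by
        rw [ENNReal.tsum_comm]
        refine ENNReal.tsum_le_tsum fun b => tsum_lintegral_le fun i => Measurable.aemeasurable ?_
        exact (((hq.add_const _).mul ((hvi b i).const_mul _)).add
          ((hg.mul_const _).mul (hvi b i)))
    _ = ∑' b, ((∫⁻ x, ENNReal.ofReal (‖x‖ ^ 2 / 2) * expect ρ (v b x)) +
          negLog (mu b) * (∫⁻ x, expect ρ (v b x)) +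
          ENNReal.ofReal (mu b) * (‖coherent n‖ₑ ^ 2 *
            ∫⁻ x : PhaseSpace n, ENNReal.ofReal (Real.exp (-(‖x‖ ^ 2 / 2))))) := by
        refine tsum_congr fun b => ?_
        have hQm : Measurable fun x => expect ρ (v b x) :=
          (continuous_expect_coherentAt (m b)).measurable
        simp_rw [ENNReal.tsum_add, ENNReal.tsum_mul_left, hQ, hN, add_mul]
        rw [lintegral_add_right _ ((hg.mul_const _).mul_const _),
          lintegral_add_right _ (hQm.const_mul _), lintegral_const_mul _ hQm,
          lintegral_mul_const _ (hg.mul_const _), lintegral_mul_const _ hg]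
        ring
    _ ≤ _ := by
        rw [ENNReal.tsum_add, ENNReal.tsum_add, ENNReal.tsum_mul_right, hm.tsum_eq_one hM, one_mul]
        simp_rw [v, lintegral_expect_coherentAt hC hρ, hm.expect_self]
        gcongr with b x
        · rw [← ofReal_norm, ← ENNReal.ofReal_pow (norm_nonneg _)]
          refine ENNReal.ofReal_le_ofReal ?_
          have := sq_nonneg ‖x‖
          linarith
        · rw [hm.entropy_eq_tsum_negLog hM, ← ENNReal.tsum_mul_left]
          exact (tsum_congr fun b => by ring).le

/-- Klein's inequality is applied to the evolved state, whose marginal on `M` is that of `ρ`. -/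
lemma entropy_heat_ne_top {t : ℝ} (ht : 0 ≤ t) (hρ : IsState ρ)
    (hA : meanEnergy (traceSnd ρ) < ∞) (hM : entropy (traceFst ρ) < ∞) :
    entropy (heat t ρ) ≠ ∞ := by
  obtain ⟨C, D, hC0, hC, hD, h1, h2⟩ := exists_moyal n
  have hρt : IsState (heat t ρ) := by
    obtain rfl | ht := ht.eq_or_lt
    · rwa [heat_zero]
    · exact isState_heat ht hρ
  obtain ⟨κ, m, mu, hm⟩ := (traceFst_isState hρt).exists_isDiag
  have hK := mul_entropy_le h1 hρt hm
  have hg : ∫⁻ x : PhaseSpace n, ENNReal.ofReal (Real.exp (-(‖x‖ ^ 2 / 2))) ≠ ∞ := by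
    have h := (integrable_exp_neg_mul_sq_norm (V := PhaseSpace n) (b := 1 / 2)
      (by norm_num)).lintegral_lt_top.ne
    refine ne_of_eq_of_ne (lintegral_congr fun x => ?_) h
    congr 2
    ring
  have h3 := tsum_lintegral_sq_expect_heat_ne_top h1 h2 hC hD ht hρ hA m
  rw [traceFst_heat ht hρ] at hK
  intro htop
  rw [htop, ENNReal.mul_top hC0] at hK
  refine (lt_of_le_of_lt hK ?_).ne rfl
  have hM' := hM.ne
  exact lt_top_iff_ne_top.2 (by finiteness)

end Klein

/-! ### Difference quotients of subadditive functions at zero -/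

section Limit

lemma le_natCast_mul_of_subadditive {g : ℝ → ℝ}
    (hsub : ∀ s t, 0 < s → 0 < t → g (s + t) ≤ g s + g t) {t : ℝ} (ht : 0 < t) (N : ℕ) :
    g ((N + 1 : ℕ) * t) ≤ (N + 1 : ℕ) * g t := by
  induction N with
  | zero => simp
  | succ N ih =>
    have h := hsub ((N + 1 : ℕ) * t) t (by positivity) ht
    push_cast at h ih ⊢
    rw [show ((N : ℝ) + 1 + 1) * t = (N + 1) * t + t by ring]
    linarith

/-- A monotone version of Fekete's lemma at zero: the difference quotients at zero of a monotone
subadditive function converge, to their supremum. -/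
lemma exists_tendsto_div_of_subadditive {g : ℝ → ℝ} (h0 : ∀ t, 0 < t → 0 ≤ g t)
    (hmono : ∀ s t, 0 < s → s < t → g s ≤ g t)
    (hsub : ∀ s t, 0 < s → 0 < t → g (s + t) ≤ g s + g t) :
    ∃ L : EReal, Tendsto (fun t : ℝ => (g t : EReal) / (t : EReal)) (𝓝[>] 0) (𝓝 L) := by
  refine ⟨⨆ t : Set.Ioi (0 : ℝ), ((g t / t : ℝ) : EReal), tendsto_order.2 ⟨fun a ha => ?_,
    fun a ha => ?_⟩⟩
  -- if `a < g T / T`, then `a < g T / (T + t) ≤ g t / t` for small `t`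
  · obtain ⟨⟨T, hT⟩, hT'⟩ := lt_iSup_iff.1 ha
    have hT0 : 0 < T := hT
    obtain ⟨r, har, hr⟩ := EReal.lt_iff_exists_real_btwn.1 hT'
    have hr' : r < g T / (T + 0) := by simpa using hr
    have hc : Tendsto (fun t : ℝ => g T / (T + t)) (𝓝[>] 0) (𝓝 (g T / (T + 0))) :=
      (ContinuousAt.div continuousAt_const (by fun_prop)
        (by simpa using hT0.ne')).tendsto.mono_left nhdsWithin_le_nhds
    have hlt : ∀ᶠ t : ℝ in 𝓝[>] 0, t < T := nhdsWithin_le_nhds (eventually_lt_nhds hT0)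
    filter_upwards [hc.eventually_const_lt hr', hlt, self_mem_nhdsWithin] with t h1 h2 ht
    have ht0 : 0 < t := ht
    refine har.trans_le ?_
    rw [← EReal.coe_div, EReal.coe_le_coe_iff]
    refine h1.le.trans ?_
    -- `T` is covered by `⌊T / t⌋ + 1` intervals of length `t`
    have hN : T < (⌊T / t⌋₊ + 1 : ℕ) * t := by
      have := Nat.lt_floor_add_one (T / t)
      rw [div_lt_iff₀ ht0] at this
      exact_mod_cast this
    have h3 : g T ≤ (T / t + 1) * g t := by
      calc g T ≤ (⌊T / t⌋₊ + 1 : ℕ) * g t :=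
            (hmono _ _ hT0 hN).trans (le_natCast_mul_of_subadditive hsub ht0 _)
        _ ≤ (T / t + 1) * g t := by
            have := Nat.floor_le (show 0 ≤ T / t by positivity)
            have := h0 t ht0
            push_cast
            gcongr
    rw [div_le_div_iff₀ (by positivity) ht0]
    calc g T * t ≤ (T / t + 1) * g t * t := by gcongr
      _ = g t * (T + t) := by field_simp
  · filter_upwards [self_mem_nhdsWithin] with t ht
    refine lt_of_le_of_lt ?_ ha
    rw [← EReal.coe_div]
    exact le_iSup (fun t : Set.Ioi (0 : ℝ) => ((g t / t : ℝ) : EReal)) ⟨t, ht⟩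

end Limit

/-! ### The right derivative of the entropy along the heat semigroup -/

section EntropyDerivative

variable {n : ℕ} {s t : ℝ} {M : Type*} [NormedAddCommGroup M] [InnerProductSpace ℂ M]
  [CompleteSpace M] {ρ : HilbertTensor (Mode n) M →L[ℂ] HilbertTensor (Mode n) M}

/-- The right derivative at `0` of the entropy along the heat semigroup exists, finite or infinite. -/
lemma exists_tendsto_entropy_heat (hρ : IsState ρ)
    (hfin : ∀ t, 0 ≤ t → entropy (heat t ρ) ≠ ∞) :
    ∃ L : EReal, Tendsto (fun t : ℝ =>
      (((entropy (heat t ρ)).toReal - (entropy ρ).toReal : ℝ) : EReal) / (t : EReal))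
      (𝓝[>] 0) (𝓝 L) := by
  have h0 : entropy ρ ≠ ∞ := by simpa only [heat_zero] using hfin 0 le_rfl
  refine exists_tendsto_div_of_subadditive
    (g := fun t => (entropy (heat t ρ)).toReal - (entropy ρ).toReal) (fun t ht => ?_)
    (fun s t hs hst => ?_) fun s t hs ht => ?_
  · exact sub_nonneg.2 (ENNReal.toReal_mono (hfin t ht.le) (entropy_le_entropy_heat ht hρ))
  · have h := entropy_le_entropy_heat (sub_pos.2 hst) (isState_heat hs hρ)
    rw [heat_heat (sub_pos.2 hst) hs hρ, sub_add_cancel] at h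
    exact sub_le_sub_right (ENNReal.toReal_mono (hfin t (hs.trans hst).le) h) _
  · have h := ENNReal.toReal_mono (ENNReal.add_ne_top.2 ⟨hfin s hs.le, hfin t ht.le⟩)
      (entropy_heat_add_le hs ht hρ)
    rw [ENNReal.toReal_add (hfin _ (add_pos hs ht).le) h0,
      ENNReal.toReal_add (hfin s hs.le) (hfin t ht.le)] at h
    linarith

end EntropyDerivative

end Bosonic

end

theorem mainTheorem8 (n : ℕ) {M : Type*} [NormedAddCommGroup M] [InnerProductSpace ℂ M]
    [CompleteSpace M]
    (ρ : Bosonic.HilbertTensor (Bosonic.Mode n) M →L[ℂ] Bosonic.HilbertTensor (Bosonic.Mode n) M)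
    (hρ : Bosonic.IsState ρ)
    (hA : Bosonic.meanEnergy (Bosonic.traceSnd ρ) < ∞)
    (hM : Bosonic.entropy (Bosonic.traceFst ρ) < ∞) :
    -- the conditional entropy is finite along the heat semigroup
    (∀ t : ℝ, 0 ≤ t → Bosonic.condEntropy (Bosonic.heat t ρ) ≠ ⊤ ∧
      Bosonic.condEntropy (Bosonic.heat t ρ) ≠ ⊥) ∧
    -- the limit that defines `J(A|M)` exists, finite or infinite
    Tendsto (fun t : ℝ => Bosonic.integralFisherInfo ρ t / (t : EReal)) (𝓝[>] 0)
      (𝓝 (Bosonic.fisherInfo ρ)) ∧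
    -- `J(A|M)` is the right derivative at `t = 0` of the conditional entropy
    Tendsto (fun t : ℝ => (Bosonic.condEntropy (Bosonic.heat t ρ) -
        Bosonic.condEntropy (Bosonic.heat 0 ρ)) / (t : EReal)) (𝓝[>] 0)
      (𝓝 (Bosonic.fisherInfo ρ)) := by
  have hfin : ∀ t, 0 ≤ t → Bosonic.entropy (Bosonic.heat t ρ) ≠ ∞ := fun t ht =>
    Bosonic.entropy_heat_ne_top ht hρ hA hM
  have h0 : Bosonic.entropy ρ ≠ ∞ := by simpa only [Bosonic.heat_zero] using hfin 0 le_rfl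
  have hcond := fun (t : ℝ) (ht : 0 ≤ t) => Bosonic.condEntropy_heat ht hρ hM.ne (hfin t ht)
  obtain ⟨L, hL⟩ := Bosonic.exists_tendsto_entropy_heat hρ hfin
  have hF : Tendsto (fun t : ℝ => Bosonic.integralFisherInfo ρ t / (t : EReal)) (𝓝[>] 0)
      (𝓝 L) := by
    refine hL.congr' ?_
    filter_upwards [self_mem_nhdsWithin] with t ht
    rw [Bosonic.integralFisherInfo_eq ht hρ hM.ne h0 (hfin t (le_of_lt ht))]
  have hJ : Bosonic.fisherInfo ρ = L := hF.limUnder_eq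
  rw [hJ]
  refine ⟨fun t ht => ?_, hF, hL.congr' ?_⟩
  · rw [hcond t ht]
    exact ⟨EReal.coe_ne_top _, EReal.coe_ne_bot _⟩
  · filter_upwards [self_mem_nhdsWithin] with t ht
    rw [hcond t (le_of_lt ht), hcond 0 le_rfl, Bosonic.heat_zero, ← EReal.coe_sub]
    congr 2
    ring
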